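/- Let $n,m\ge 0$ be integers, $t_0<t_f$, $x_0\in\mathbb R^n$. Let $f_1,f_2:\mathbb R^n\times\mathbb R^m\times\mathbb R\to\mathbb R^n$ and $L_1,L_2:\mathbb R^n\times\mathbb R^m\times\mathbb R\to\mathbb R$ be continuous functions of $(x,u,t)$ which are differentiable in $(x,u)$, with derivative jointly continuous in $(x,u,t)$; let $g:\mathbb R^n\to\mathbb R$ be continuously differentiable and $\varphi:\mathbb R^n\to\mathbb R$ differentiable. Put $f=f_1,\ L=L_1$ where $g(x)\le 0$ and $f=f_2,\ L=L_2$ where $g(x)>0$. An admissible pair $(x,u)$ consists of a piecewise continuous control $u:[t_0,t_f]\to\mathbb R^m$ (continuous except at finitely many times, with finite one-sided limits everywhere) and a continuous $x:[t_0,t_f]\to\mathbb R^n$ with $x(t_0)=x_0$ that crosses the interface exactly once, i.e. for some $\sigma\in(t_0,t_f)$ one has $g(x(t))<0$ for $t_0\le t<\sigma$, $g(x(\sigma))=0$ and $g(x(t))>0$ for $\sigma<t\le t_f$, and which satisfies $\dot x(t)=f(x(t),u(t),t)$ at every $t\in(t_0,t_f)\setminus\{\sigma\}$ at which $u$ is continuous.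 The cost is $J(x,u)=\varphi(x(t_f))+\int_{t_0}^{t_f}L(x(t),u(t),t)\,dt$. Let $(x,u)$ be an admissible pair with crossing time $\tau$, and suppose that the crossing is not tangential, i.e. $\nabla g(x(\tau))^\top f_1(x(\tau),u(\tau^-),\tau)\ne0$ and $\nabla g(x(\tau))^\top f_2(x(\tau),u(\tau^+),\tau)\ne0$. For $c\in\{0,1\}$ let $H_i(x,\lambda,u,t)=c\,L_i(x,u,t)+\lambda^\top f_i(x,u,t)$; $c=1$ gives the usual Hamiltonian. Consider the following conditions on continuous functions $\lambda_1:[t_0,\tau]\to\mathbb R^n$, $\lambda_2:[\tau,t_f]\to\mathbb R^n$ and $\nu\in\mathbb R$. (i) At every $t\in(t_0,\tau)$ (for $i=1$), respectively $t\in(\tau,t_f)$ (for $i=2$), at which $u$ is continuous, $$\dot\lambda_i=-\Big(\frac{\partial H_i}{\partial x}\Big)^{\top},\qquad \frac{\partial H_i}{\partial u}=0,$$ with derivatives of $H_i$ evaluated at $(x(t),\lambda_i(t),u(t),t)$. (ii) $\lambda_2(\tau)-\lambda_1(\tau)+\nu\,\nabla g(x(\tau))=0$. (iii) The Hamiltonian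 is continuous at the crossing: $$H_1(x(\tau),\lambda_1(\tau),u(\tau^-),\tau)=H_2(x(\tau),\lambda_2(\tau),u(\tau^+),\tau),$$ and $H_1(x(t),\lambda_1(t),u(t),t)$ as $t\uparrow\tau$ and $H_2(x(t),\lambda_2(t),u(t),t)$ as $t\downarrow\tau$ both tend to this common value. Then: (a) (Free terminal state.) If $(x,u)$ minimizes $J$ among all admissible pairs, then there are $\lambda_1,\lambda_2,\nu$ satisfying (i)–(iii) with $c=1$ and $\lambda_2(t_f)=\nabla\varphi(x(t_f))$. (b) (Prescribed terminal state.) If $(x,u)$ minimizes $J$ among all admissible pairs with the prescribed terminal state $x(t_f)=x_f$, then either there are $\lambda_1,\lambda_2,\nu$ satisfying (i)–(iii) with $c=1$, or the trajectory is abnormal: there are $\lambda_1,\lambda_2,\nu$ with $\lambda_2(t_f)\ne0$ satisfying (i)–(iii) with $c=0$. -/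

import Mathlib

open Set Filter Topology

/-- A function of time is piecewise continuous on `[a, b]`: it is continuous outside a finite set
and has finite one-sided limits everywhere. -/
def PiecewiseContinuousOn {F : Type*} [TopologicalSpace F] (u : ℝ → F) (a b : ℝ) : Prop :=
  (∃ S : Set ℝ, S.Finite ∧ ContinuousOn u (Icc a b \ S)) ∧
  (∀ t ∈ Ico a b, ∃ l, Tendsto u (𝓝[>] t) (𝓝 l)) ∧
  (∀ t ∈ Ioc a b, ∃ l, Tendsto u (𝓝[<] t) (𝓝 l))

/-- `h (x, u, t)` is continuous, and continuously differentiable with respect to `(x, u)`: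
the derivative in `(x, u)` exists everywhere and is jointly continuous in `(x, u, t)`. -/
def IsC1InStateControl {n m : ℕ} {F : Type*} [NormedAddCommGroup F] [NormedSpace ℝ F]
    (h : EuclideanSpace ℝ (Fin n) → EuclideanSpace ℝ (Fin m) → ℝ → F) : Prop :=
  Continuous (fun q : (EuclideanSpace ℝ (Fin n) × EuclideanSpace ℝ (Fin m)) × ℝ =>
    h q.1.1 q.1.2 q.2) ∧
  (∀ t, Differentiable ℝ
    (fun z : EuclideanSpace ℝ (Fin n) × EuclideanSpace ℝ (Fin m) => h z.1 z.2 t)) ∧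
  Continuous (fun q : (EuclideanSpace ℝ (Fin n) × EuclideanSpace ℝ (Fin m)) × ℝ =>
    fderiv ℝ (fun z : EuclideanSpace ℝ (Fin n) × EuclideanSpace ℝ (Fin m) => h z.1 z.2 q.2) q.1)

/-- The data of a two-mode optimal control problem with state in `ℝⁿ` and control in `ℝᵐ`, the mode
being selected by the sign of `g` at the current state. -/
structure SwitchedProblem (n m : ℕ) where
  /-- dynamics where `g ≤ 0` -/
  f₁ : EuclideanSpace ℝ (Fin n) → EuclideanSpace ℝ (Fin m) → ℝ → EuclideanSpace ℝ (Fin n)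
  /-- dynamics where `g ≥ 0` -/
  f₂ : EuclideanSpace ℝ (Fin n) → EuclideanSpace ℝ (Fin m) → ℝ → EuclideanSpace ℝ (Fin n)
  /-- stage cost where `g ≤ 0` -/
  L₁ : EuclideanSpace ℝ (Fin n) → EuclideanSpace ℝ (Fin m) → ℝ → ℝ
  /-- stage cost where `g ≥ 0` -/
  L₂ : EuclideanSpace ℝ (Fin n) → EuclideanSpace ℝ (Fin m) → ℝ → ℝ
  /-- the interface is `g = 0` -/
  g : EuclideanSpace ℝ (Fin n) → ℝ
  /-- terminal cost -/
  φ : EuclideanSpace ℝ (Fin n) → ℝ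
  /-- initial time -/
  t₀ : ℝ
  /-- final time -/
  t_f : ℝ
  /-- initial state -/
  x₀ : EuclideanSpace ℝ (Fin n)

namespace SwitchedProblem

variable {n m : ℕ} (P : SwitchedProblem n m)

/-- Smoothness of the data. -/
structure Regular : Prop where
  f₁ : IsC1InStateControl P.f₁
  f₂ : IsC1InStateControl P.f₂
  L₁ : IsC1InStateControl P.L₁
  L₂ : IsC1InStateControl P.L₂
  g : ContDiff ℝ 1 P.g
  φ : Differentiable ℝ P.φ

open Classical in
/-- The switched dynamics. (A trajectory that crosses the interface once is on it at a single
instant, so the choice made where `g = 0` is immaterial.) -/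
noncomputable def f (x : EuclideanSpace ℝ (Fin n)) (u : EuclideanSpace ℝ (Fin m)) (t : ℝ) :
    EuclideanSpace ℝ (Fin n) :=
  if P.g x ≤ 0 then P.f₁ x u t else P.f₂ x u t

open Classical in
/-- The switched stage cost. -/
noncomputable def L (x : EuclideanSpace ℝ (Fin n)) (u : EuclideanSpace ℝ (Fin m)) (t : ℝ) : ℝ :=
  if P.g x ≤ 0 then P.L₁ x u t else P.L₂ x u t

/-- The trajectory `x` crosses the interface exactly once on `[t₀, t_f]`, at the time `τ`, from
`g < 0` to `g > 0`. -/
structure CrossesOnceAt (x : ℝ → EuclideanSpace ℝ (Fin n)) (τ : ℝ) : Prop where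
  mem : τ ∈ Ioo P.t₀ P.t_f
  before : ∀ t ∈ Ico P.t₀ τ, P.g (x t) < 0
  at_interface : P.g (x τ) = 0
  after : ∀ t ∈ Ioc τ P.t_f, 0 < P.g (x t)

/-- `(x, u)` is an admissible state-control pair: `u` is piecewise continuous, `x` is a continuous
trajectory of the switched dynamics which starts at `x₀` and crosses the interface exactly once. -/
structure Admissible (x : ℝ → EuclideanSpace ℝ (Fin n)) (u : ℝ → EuclideanSpace ℝ (Fin m)) :
    Prop where
  control : PiecewiseContinuousOn u P.t₀ P.t_f
  continuousOn : ContinuousOn x (Icc P.t₀ P.t_f)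
  initial : x P.t₀ = P.x₀
  dynamics : ∀ t ∈ Ioo P.t₀ P.t_f, P.g (x t) ≠ 0 → ContinuousAt u t →
    HasDerivAt x (P.f (x t) (u t) t) t
  crosses : ∃ τ, P.CrossesOnceAt x τ

/-- The performance index. -/
noncomputable def J (x : ℝ → EuclideanSpace ℝ (Fin n)) (u : ℝ → EuclideanSpace ℝ (Fin m)) : ℝ :=
  P.φ (x P.t_f) + ∫ t in P.t₀..P.t_f, P.L (x t) (u t) t

/-- `(x, u)` minimizes the performance index among the admissible pairs whose terminal state
lies in `M`. -/
def IsOptimal (M : Set (EuclideanSpace ℝ (Fin n)))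
    (x : ℝ → EuclideanSpace ℝ (Fin n)) (u : ℝ → EuclideanSpace ℝ (Fin m)) : Prop :=
  P.Admissible x u ∧ x P.t_f ∈ M ∧
    ∀ y v, P.Admissible y v → y P.t_f ∈ M → P.J x u ≤ P.J y v

/-- The Hamiltonian `c L₁ + pᵀ f₁` of the first mode; the usual Hamiltonian is the case `c = 1`. -/
noncomputable def H₁ (c : ℝ) (x p : EuclideanSpace ℝ (Fin n)) (u : EuclideanSpace ℝ (Fin m))
    (t : ℝ) : ℝ :=
  c * P.L₁ x u t + inner ℝ p (P.f₁ x u t)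

/-- The Hamiltonian `c L₂ + pᵀ f₂` of the second mode. -/
noncomputable def H₂ (c : ℝ) (x p : EuclideanSpace ℝ (Fin n)) (u : EuclideanSpace ℝ (Fin m))
    (t : ℝ) : ℝ :=
  c * P.L₂ x u t + inner ℝ p (P.f₂ x u t)

/-- The Hamiltonian `c L + pᵀ f` of the switched system. -/
noncomputable def H (c : ℝ) (x p : EuclideanSpace ℝ (Fin n)) (u : EuclideanSpace ℝ (Fin m))
    (t : ℝ) : ℝ :=
  c * P.L x u t + inner ℝ p (P.f x u t)

/-- The costates `p₁` on `[t₀, τ]` and `p₂` on `[τ, t_f]`, with the multiplier `ν` of the interface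
and the multiplier `c` of the cost, satisfy the stationarity conditions along `(x, u)`, and the
Hamiltonian is continuous at the crossing time `τ`. Here `um` and `up` are the left and right
limits of `u` at `τ`. -/
structure StationaryWith (x : ℝ → EuclideanSpace ℝ (Fin n)) (u : ℝ → EuclideanSpace ℝ (Fin m))
    (τ : ℝ) (um up : EuclideanSpace ℝ (Fin m)) (c : ℝ) (p₁ p₂ : ℝ → EuclideanSpace ℝ (Fin n))
    (ν : ℝ) : Prop where
  continuousOn₁ : ContinuousOn p₁ (Icc P.t₀ τ)
  continuousOn₂ : ContinuousOn p₂ (Icc τ P.t_f)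
  /-- adjoint equation of the first phase -/
  adjoint₁ : ∀ t ∈ Ioo P.t₀ τ, ContinuousAt u t →
    HasDerivAt p₁ (-gradient (fun y => P.H₁ c y (p₁ t) (u t) t) (x t)) t
  /-- adjoint equation of the second phase -/
  adjoint₂ : ∀ t ∈ Ioo τ P.t_f, ContinuousAt u t →
    HasDerivAt p₂ (-gradient (fun y => P.H₂ c y (p₂ t) (u t) t) (x t)) t
  /-- `∂H₁/∂u = 0` -/
  control₁ : ∀ t ∈ Ioo P.t₀ τ, ContinuousAt u t →
    gradient (fun w => P.H₁ c (x t) (p₁ t) w t) (u t) = 0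
  /-- `∂H₂/∂u = 0` -/
  control₂ : ∀ t ∈ Ioo τ P.t_f, ContinuousAt u t →
    gradient (fun w => P.H₂ c (x t) (p₂ t) w t) (u t) = 0
  /-- jump of the costate at the interface -/
  jump : p₂ τ - p₁ τ + ν • gradient P.g (x τ) = 0
  /-- the two one-sided values of the Hamiltonian at the crossing time agree -/
  hamiltonian_eq : P.H₁ c (x τ) (p₁ τ) um τ = P.H₂ c (x τ) (p₂ τ) up τ
  /-- the Hamiltonian along the trajectory is continuous in time at the crossing -/
  hamiltonian_tendsto :
    Tendsto (fun t => P.H c (x t) (if t < τ then p₁ t else p₂ t) (u t) t) (𝓝[≠] τ)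
      (𝓝 (P.H₁ c (x τ) (p₁ τ) um τ))

end SwitchedProblem

/-! The accumulated cost is appended to the state, so that each mode becomes a field `(fᵢ, Lᵢ)` on
`ℝⁿ × ℝ` and `J` a function of the terminal augmented state. The control is replaced by two
controls, one per phase, each continued across `τ` by its one-sided limit there. Each is then
continuous at `τ`, and each phase of the trajectory continues slightly beyond `τ`. Both controls are
perturbed by the same small bounded continuous function `v`.

A phase solves `x - ξ - ∫ F (x, u + v, s) ds = 0` in a space of bounded continuous functions. The
partial derivative in `x` is `1 - K` with `K` a Volterra operator, hence invertible, and the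
implicit function theorem gives a flow strictly differentiable in `(ξ, v)`
(`IsC1Field.exists_isFlowNear`), and even jointly in `(ξ, v)` and time at `τ`
(`IsFlowNear.hasStrictFDerivAt_eval`). A second implicit function argument, which rests on
transversality, solves for the perturbed switching time (`exists_switching_data`). Transversality on
both sides also ensures that the perturbed trajectories cross the interface only once. So the
terminal augmented state is a map `Φ` of `v`, strictly differentiable at `0`, whose values near `0`
are attained by admissible pairs (`SwitchedProblem.Admissible.exists_endpoint_map`).

Optimality now yields a nonzero covector `ℓ` that annihilates the range of `Φ'`. With a free end,
`0` is a local minimum of `φ (Φ v).1 + (Φ v).2`, and `ℓ` is the differential of `(y, z) ↦ φ y + z`.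
With a prescribed end, `Φ'` cannot be onto: otherwise `Φ` would be open at `0` and a lower cost
would be reached at the same terminal state.

Finally `exists_costates` propagates `ℓ` backwards by the adjoint equations. The jump `ν ∇g` of the
costate is not seen by the variations, since the perturbed crossing states stay on the interface to
first order. The number `ν` is free to make the two Hamiltonians agree, and this agreement cancels
the variation of the switching time. What remains is `∫ q F_u v = 0` for all `v`, hence `∂H/∂u = 0`.
The cost component of the costate is constant, because the fields do not depend on the accumulated
cost; it is the multiplier `c`. -/

set_option linter.unusedSectionVars false

/-! ### Volterra operators with bounded measurable kernels -/

section
open MeasureTheory BoundedContinuousFunction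
open scoped BoundedContinuousFunction

/-- The point of `[α, β]` closest to `t`. -/
noncomputable def clampTo (α β t : ℝ) : ℝ := max α (min t β)

theorem continuous_clampTo (α β : ℝ) : Continuous (clampTo α β) := by
  unfold clampTo; fun_prop

theorem clampTo_mem {α β : ℝ} (h : α ≤ β) (t : ℝ) : clampTo α β t ∈ Icc α β :=
  ⟨le_max_left _ _, max_le h (min_le_right _ _)⟩

theorem clampTo_of_mem {α β t : ℝ} (h : t ∈ Icc α β) : clampTo α β t = t := by
  simp [clampTo, h.1, h.2]

variable {E U G : Type*} [NormedAddCommGroup E] [NormedSpace ℝ E]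
  [NormedAddCommGroup U] [NormedSpace ℝ U] [NormedAddCommGroup G] [NormedSpace ℝ G]

theorem uIoc_subset_Icc' {α β a b : ℝ} (ha : a ∈ Icc α β) (hb : b ∈ Icc α β) :
    Set.uIoc a b ⊆ Icc α β := uIoc_subset_uIcc.trans (uIcc_subset_Icc ha hb)

theorem MeasureTheory.IntegrableOn.intervalIntegrable_of_mem_Icc {α β a b : ℝ} {h : ℝ → E}
    (hh : IntegrableOn h (Icc α β)) (ha : a ∈ Icc α β) (hb : b ∈ Icc α β) :
    IntervalIntegrable h volume a b := by
  rw [intervalIntegrable_iff]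
  exact hh.mono_set (uIoc_subset_Icc' ha hb)

/-- The primitive of an integrable function on `[α, β]`, extended by constants. -/
theorem exists_boundedContinuous_primitive {α β a : ℝ} (ha : a ∈ Icc α β) {h : ℝ → E}
    (hh : IntegrableOn h (Icc α β)) :
    ∃ H : ℝ →ᵇ E, ∀ t, H t = ∫ s in a..clampTo α β t, h s := by
  have hαβ : α ≤ β := ha.1.trans ha.2
  have hc : Continuous fun t => ∫ s in a..clampTo α β t, h s := by
    have h1 : ContinuousOn (fun t => ∫ s in a..t, h s) (Icc α β) := by
      have := intervalIntegral.continuousOn_primitive_interval' (a := a) (b₁ := α) (b₂ := β)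
        (μ := volume) (f := h) (hh.intervalIntegrable_of_mem_Icc ⟨le_rfl, hαβ⟩ ⟨hαβ, le_rfl⟩)
        (by rwa [uIcc_of_le hαβ])
      rwa [uIcc_of_le hαβ] at this
    exact h1.comp_continuous (continuous_clampTo α β) (clampTo_mem hαβ)
  refine ⟨ofNormedAddCommGroup _ hc (∫ s in Icc α β, ‖h s‖) ?_, fun t => rfl⟩
  intro t
  refine intervalIntegral.norm_integral_le_integral_norm_uIoc.trans ?_
  exact setIntegral_mono_set hh.norm (Eventually.of_forall fun s => norm_nonneg _)
    (uIoc_subset_Icc' ha (clampTo_mem hαβ t)).eventuallyLE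

theorem norm_integral_clampTo_le {α β a C : ℝ} (ha : a ∈ Icc α β) {h : ℝ → E}
    (hh : ∀ s ∈ Icc α β, ‖h s‖ ≤ C) (t : ℝ) :
    ‖∫ s in a..clampTo α β t, h s‖ ≤ C * (β - α) := by
  have hαβ : α ≤ β := ha.1.trans ha.2
  have hC : 0 ≤ C := (norm_nonneg _).trans (hh a ha)
  have hm := clampTo_mem hαβ t
  refine (intervalIntegral.norm_integral_le_of_norm_le_const
    fun s hs => hh s (uIoc_subset_Icc' ha hm hs)).trans ?_
  refine mul_le_mul_of_nonneg_left ?_ hC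
  rw [abs_le]; constructor <;> linarith [ha.1, ha.2, hm.1, hm.2]

/-- A bounded measurable coefficient on `[α, β]`. -/
structure BddMeasurableOn (h : ℝ → E) (α β : ℝ) : Prop where
  aesm : AEStronglyMeasurable h (volume.restrict (Icc α β))
  bdd : ∃ C, ∀ t ∈ Icc α β, ‖h t‖ ≤ C

theorem BddMeasurableOn.integrableOn {h : ℝ → E} {α β : ℝ} (hh : BddMeasurableOn h α β) :
    IntegrableOn h (Icc α β) := by
  obtain ⟨C, hC⟩ := hh.bdd
  exact Integrable.of_bound hh.aesm C
    ((ae_restrict_iff' measurableSet_Icc).2 (Eventually.of_forall hC))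

theorem BddMeasurableOn.mono {h : ℝ → E} {α β α' β' : ℝ} (hh : BddMeasurableOn h α β)
    (h' : Icc α' β' ⊆ Icc α β) : BddMeasurableOn h α' β' :=
  ⟨hh.aesm.mono_measure (Measure.restrict_mono h' le_rfl),
    hh.bdd.imp fun _ hC t ht => hC t (h' ht)⟩

theorem BddMeasurableOn.of_continuousOn {h : ℝ → E} {α β : ℝ}
    (hh : ContinuousOn h (Icc α β)) : BddMeasurableOn h α β :=
  ⟨hh.aestronglyMeasurable measurableSet_Icc, isCompact_Icc.exists_bound_of_continuousOn hh⟩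

theorem BddMeasurableOn.clm_apply {A : ℝ → G →L[ℝ] E} {y : ℝ → G} {α β : ℝ}
    (hA : BddMeasurableOn A α β) (hy : BddMeasurableOn y α β) :
    BddMeasurableOn (fun s => A s (y s)) α β := by
  obtain ⟨C, hC⟩ := hA.bdd
  obtain ⟨D, hD⟩ := hy.bdd
  refine ⟨isBoundedBilinearMap_apply.continuous.comp_aestronglyMeasurable
    (hA.aesm.prodMk hy.aesm), C * D, fun t ht => ?_⟩
  exact ((A t).le_opNorm _).trans
    (mul_le_mul (hC t ht) (hD t ht) (norm_nonneg _) ((norm_nonneg _).trans (hC t ht)))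

/-- The linear Volterra operator with a bounded measurable kernel. -/
theorem exists_volterra {α β a : ℝ} (ha : a ∈ Icc α β) {A : ℝ → G →L[ℝ] E}
    (hA : BddMeasurableOn A α β) :
    ∃ K : (ℝ →ᵇ G) →L[ℝ] (ℝ →ᵇ E), ∀ y t, K y t = ∫ s in a..clampTo α β t, A s (y s) := by
  have hαβ : α ≤ β := ha.1.trans ha.2
  have hi : ∀ y : ℝ →ᵇ G, IntegrableOn (fun s => A s (y s)) (Icc α β) := fun y =>
    (hA.clm_apply (.of_continuousOn y.continuous.continuousOn)).integrableOn
  choose K hK using fun y : ℝ →ᵇ G => exists_boundedContinuous_primitive ha (hi y)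
  obtain ⟨C, hC⟩ := hA.bdd
  have hii : ∀ y : ℝ →ᵇ G, ∀ t,
      IntervalIntegrable (fun s => A s (y s)) volume a (clampTo α β t) :=
    fun y t => (hi y).intervalIntegrable_of_mem_Icc ha (clampTo_mem hαβ t)
  refine ⟨LinearMap.mkContinuous
    { toFun := K
      map_add' := fun y z => ?_
      map_smul' := fun c y => ?_ } (C * (β - α)) (fun y => ?_), hK⟩
  · ext t
    rw [BoundedContinuousFunction.add_apply, hK, hK, hK,
      ← intervalIntegral.integral_add (hii y t) (hii z t)]
    simp
  · ext t
    change K (c • y) t = c • K y t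
    rw [hK, hK, ← intervalIntegral.integral_smul]
    simp
  · have hC0 : 0 ≤ C := (norm_nonneg _).trans (hC a ha)
    refine (norm_le (by have := sub_nonneg.2 hαβ; positivity)).2 fun t => ?_
    change ‖K y t‖ ≤ _
    rw [hK]
    refine (norm_integral_clampTo_le (C := C * ‖y‖) ha (fun s hs => ?_) t).trans (by linarith)
    exact ((A s).le_opNorm _).trans
      (mul_le_mul (hC s hs) (y.norm_coe_le_norm s) (norm_nonneg _) hC0)

/-- Each iteration integrates the bound `|s - a| ^ k / k!` once more. The factorial this produces
makes some power of `K` a contraction without any smallness of the interval. -/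
theorem volterra_pow_le {α β a M : ℝ} (ha : a ∈ Icc α β) {A : ℝ → E →L[ℝ] E}
    (hM : ∀ t ∈ Icc α β, ‖A t‖ ≤ M) {K : (ℝ →ᵇ E) →L[ℝ] (ℝ →ᵇ E)}
    (hK : ∀ y t, K y t = ∫ s in a..clampTo α β t, A s (y s)) (k : ℕ) (y : ℝ →ᵇ E) (t : ℝ) :
    ‖(K ^ k) y t‖ ≤ M ^ k * |clampTo α β t - a| ^ k / k.factorial * ‖y‖ := by
  have hαβ : α ≤ β := ha.1.trans ha.2
  have hM0 : 0 ≤ M := (norm_nonneg _).trans (hM a ha)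
  induction k generalizing t with
  | zero => simpa using y.norm_coe_le_norm t
  | succ k ih =>
    have hm := clampTo_mem hαβ t
    rw [pow_succ', mul_apply_eq_comp, hK, intervalIntegral.norm_intervalIntegral_eq]
    have key : ∀ s ∈ uIoc a (clampTo α β t), ‖A s ((K ^ k) y s)‖ ≤
        (M ^ (k + 1) / k.factorial * ‖y‖) * |s - a| ^ k := by
      intro s hs
      have hs' := uIoc_subset_Icc' ha hm hs
      have h1 := ih s
      rw [clampTo_of_mem hs'] at h1
      calc ‖A s ((K ^ k) y s)‖ ≤ ‖A s‖ * ‖(K ^ k) y s‖ := (A s).le_opNorm _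
        _ ≤ M * (M ^ k * |s - a| ^ k / k.factorial * ‖y‖) :=
          mul_le_mul (hM s hs') h1 (norm_nonneg _) hM0
        _ = _ := by ring
    have hint : IntegrableOn (fun s => (M ^ (k + 1) / k.factorial * ‖y‖) * |s - a| ^ k)
        (uIoc a (clampTo α β t)) := by
      rw [← intervalIntegrable_iff]
      exact Continuous.intervalIntegrable (by fun_prop) _ _
    refine (norm_integral_le_of_norm_le hint
      ((ae_restrict_iff' measurableSet_uIoc).2 (Eventually.of_forall key))).trans ?_
    rw [integral_const_mul, integral_pow_abs_sub_uIoc, Nat.factorial_succ]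
    apply le_of_eq
    push_cast
    field_simp

/-- `1 - K` is invertible for a Volterra operator `K`. -/
theorem isUnit_one_sub_volterra [CompleteSpace E] {α β a : ℝ} (ha : a ∈ Icc α β)
    {A : ℝ → E →L[ℝ] E} (hA : ∃ C, ∀ t ∈ Icc α β, ‖A t‖ ≤ C) {K : (ℝ →ᵇ E) →L[ℝ] (ℝ →ᵇ E)}
    (hK : ∀ y t, K y t = ∫ s in a..clampTo α β t, A s (y s)) : IsUnit (1 - K) := by
  have hαβ : α ≤ β := ha.1.trans ha.2
  obtain ⟨M, hM⟩ := hA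
  have hM0 : 0 ≤ M := (norm_nonneg _).trans (hM a ha)
  have hd : 0 ≤ β - α := sub_nonneg.2 hαβ
  obtain ⟨k, hk⟩ : ∃ k : ℕ, (M * (β - α)) ^ k / k.factorial < 1 :=
    ((FloorSemiring.tendsto_pow_div_factorial_atTop (M * (β - α))).eventually
      (gt_mem_nhds zero_lt_one)).exists
  have hn : ‖K ^ k‖ < 1 := by
    refine lt_of_le_of_lt (ContinuousLinearMap.opNorm_le_bound _ (by positivity) fun y => ?_) hk
    refine (norm_le (by positivity)).2 fun t => (volterra_pow_le ha hM hK k y t).trans ?_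
    have hm := clampTo_mem hαβ t
    have : |clampTo α β t - a| ≤ β - α := by
      rw [abs_le]; constructor <;> linarith [ha.1, ha.2, hm.1, hm.2]
    rw [mul_pow]
    gcongr
  have hu : IsUnit (1 - K ^ k) := isUnit_one_sub_of_norm_lt_one hn
  -- `1 - K ^ k` is a product of `1 - K` and the geometric sum; these commute, so each factor of
  -- this unit is a unit.
  rw [← mul_neg_geom_sum] at hu
  have hc : Commute (1 - K) (∑ i ∈ Finset.range k, K ^ i) :=
    Commute.sum_right _ _ _ fun i _ =>
      (Commute.one_left _).sub_left ((Commute.refl K).pow_right i)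
  exact (hc.isUnit_mul_iff.1 hu).1

/-! ### Fields of class C¹ in state and control -/

/-- A field `F (x, u, t)` which is continuous and continuously differentiable in `(x, u)`. -/
structure IsC1Field (F : (E × U) × ℝ → G) (F' : (E × U) × ℝ → E × U →L[ℝ] G) : Prop where
  cont : Continuous F
  cont' : Continuous F'
  hasFDerivAt : ∀ z t, HasFDerivAt (fun z => F (z, t)) (F' (z, t)) z

theorem BddMeasurableOn.comp_continuous [FiniteDimensional ℝ E] [FiniteDimensional ℝ U]
    {Φ : (E × U) × ℝ → G} (hΦ : Continuous Φ) {x : ℝ → E} {u : ℝ → U} {α β : ℝ}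
    (hx : BddMeasurableOn x α β) (hu : BddMeasurableOn u α β) :
    BddMeasurableOn (fun s => Φ ((x s, u s), s)) α β := by
  obtain ⟨C, hC⟩ := hx.bdd
  obtain ⟨D, hD⟩ := hu.bdd
  refine ⟨hΦ.comp_aestronglyMeasurable
    ((hx.aesm.prodMk hu.aesm).prodMk continuous_id.aestronglyMeasurable), ?_⟩
  have := FiniteDimensional.proper_real E
  have := FiniteDimensional.proper_real U
  obtain ⟨M, hM⟩ := (((isCompact_closedBall (0 : E) C).prod (isCompact_closedBall (0 : U) D)).prod
    (isCompact_Icc (a := α) (b := β))).exists_bound_of_continuousOn hΦ.continuousOn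
  exact ⟨M, fun t ht => hM _ ⟨⟨by simpa using hC t ht, by simpa using hD t ht⟩, ht⟩⟩

/-- The points `(x s, u s, s)` stay in a compact set, on which `F'` is uniformly continuous, and the
mean value inequality on a ball does the rest. Only bounds on `x` and `u` enter, so a discontinuous
control does no harm. -/
theorem IsC1Field.uniform_strict [FiniteDimensional ℝ E] [FiniteDimensional ℝ U]
    {F : (E × U) × ℝ → G} {F' : (E × U) × ℝ → E × U →L[ℝ] G} (hF : IsC1Field F F')
    {x : ℝ → E} {u : ℝ → U} {α β : ℝ}
    (hx : ∃ C, ∀ t ∈ Icc α β, ‖x t‖ ≤ C) (hu : ∃ C, ∀ t ∈ Icc α β, ‖u t‖ ≤ C)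
    {ε : ℝ} (hε : 0 < ε) :
    ∃ δ > 0, ∀ s ∈ Icc α β, ∀ z z' : E × U, ‖z - (x s, u s)‖ < δ → ‖z' - (x s, u s)‖ < δ →
      ‖F (z, s) - F (z', s) - F' ((x s, u s), s) (z - z')‖ ≤ ε * ‖z - z'‖ := by
  obtain ⟨C, hC⟩ := hx
  obtain ⟨D, hD⟩ := hu
  have := FiniteDimensional.proper_real E
  have := FiniteDimensional.proper_real U
  have hK := ((isCompact_closedBall (0 : E) C).prod (isCompact_closedBall (0 : U) D)).prod
    (isCompact_Icc (a := α) (b := β))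
  -- Only one of the two compared points has to lie in the compact set, so the ball around `(x s, u
  -- s)` may leave it.
  have h1 := hK.uniformContinuousAt_of_continuousAt F' (fun a _ => hF.cont'.continuousAt)
    (Metric.dist_mem_uniformity hε)
  obtain ⟨δ, hδ, h2⟩ := Metric.mem_uniformity_dist.1 h1
  refine ⟨δ, hδ, fun s hs z z' hz hz' => ?_⟩
  refine (convex_ball ((x s, u s) : E × U) δ).norm_image_sub_le_of_norm_hasFDerivWithin_le'
    (f := fun z => F (z, s)) (f' := fun z => F' (z, s)) (x := z') (y := z)
    (fun y _ => (hF.hasFDerivAt y s).hasFDerivWithinAt) (fun y hy => ?_)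
    (by rwa [mem_ball_iff_norm]) (by rwa [mem_ball_iff_norm])
  have h3 : dist (((x s, u s), s) : (E × U) × ℝ) (y, s) < δ := by
    rw [Prod.dist_eq, dist_self, max_eq_left dist_nonneg, dist_comm]
    exact hy
  have h4 := h2 h3 ⟨⟨by simpa using hC s hs, by simpa using hD s hs⟩, hs⟩
  rw [← dist_eq_norm, dist_comm]
  exact le_of_lt h4

end

/-! ### Differentiable dependence of trajectories on initial state, control and time -/

section
open MeasureTheory BoundedContinuousFunction
open scoped BoundedContinuousFunction

variable {E U : Type*} [NormedAddCommGroup E] [NormedSpace ℝ E] [FiniteDimensional ℝ E]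
  [NormedAddCommGroup U] [NormedSpace ℝ U] [FiniteDimensional ℝ U]
  {F : (E × U) × ℝ → E} {F' : (E × U) × ℝ → E × U →L[ℝ] E} {u : ℝ → U} {α β a : ℝ}

theorem exists_const_clm (E : Type*) [NormedAddCommGroup E] [NormedSpace ℝ E] :
    ∃ c : E →L[ℝ] (ℝ →ᵇ E), ∀ ξ t, c ξ t = ξ :=
  ⟨LinearMap.mkContinuous
    { toFun := fun ξ => const ℝ ξ
      map_add' := fun _ _ => rfl
      map_smul' := fun _ _ => rfl } 1
    (fun ξ => by rw [one_mul]; exact (norm_le (norm_nonneg _)).2 fun _ => le_rfl),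
    fun _ _ => rfl⟩

theorem IsC1Field.bddMeasurableOn_comp (hF : IsC1Field F F') (hu : BddMeasurableOn u α β)
    (x : ℝ →ᵇ E) (v : ℝ →ᵇ U) : BddMeasurableOn (fun s => F ((x s, u s + v s), s)) α β := by
  refine (BddMeasurableOn.of_continuousOn x.continuous.continuousOn).comp_continuous
    (Φ := F) (u := fun s => u s + v s) hF.cont ⟨hu.aesm.add v.continuous.aestronglyMeasurable, ?_⟩
  obtain ⟨C, hC⟩ := hu.bdd
  exact ⟨C + ‖v‖, fun t ht => (norm_add_le _ _).trans (add_le_add (hC t ht) (v.norm_coe_le_norm t))⟩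

theorem IsC1Field.bddMeasurableOn_deriv (hF : IsC1Field F F') (hu : BddMeasurableOn u α β)
    (x : ℝ →ᵇ E) : BddMeasurableOn (fun s => F' ((x s, u s), s)) α β :=
  (BddMeasurableOn.of_continuousOn x.continuous.continuousOn).comp_continuous hF.cont' hu

/-- Strict differentiability of `(x, v) ↦ ∫ F (x, u + v, s) ds` in the uniform norm. -/
theorem IsC1Field.hasStrictFDerivAt_integral (hF : IsC1Field F F') (ha : a ∈ Icc α β)
    (hu : BddMeasurableOn u α β) (x : ℝ →ᵇ E) {N : (ℝ →ᵇ E) × (ℝ →ᵇ U) → (ℝ →ᵇ E)}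
    (hN : ∀ p t, N p t = ∫ s in a..clampTo α β t, F ((p.1 s, u s + p.2 s), s))
    {N' : (ℝ →ᵇ E) × (ℝ →ᵇ U) →L[ℝ] (ℝ →ᵇ E)}
    (hN' : ∀ p t, N' p t = ∫ s in a..clampTo α β t, F' ((x s, u s), s) (p.1 s, p.2 s)) :
    HasStrictFDerivAt N N' (x, 0) := by
  have hαβ : α ≤ β := ha.1.trans ha.2
  refine .of_isLittleO (Asymptotics.isLittleO_iff.2 fun c hc => ?_)
  have hd : 0 ≤ β - α := sub_nonneg.2 hαβ
  -- Integration over `[α, β]` multiplies the error by at most `β - α`; the summand `1` keeps the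
  -- quotient meaningful when `α = β`.
  obtain ⟨δ, hδ, h⟩ := hF.uniform_strict
    (BddMeasurableOn.of_continuousOn x.continuous.continuousOn).bdd hu.bdd
    (ε := c / (β - α + 1)) (by positivity)
  have hnear : ∀ p : (ℝ →ᵇ E) × (ℝ →ᵇ U), ‖p - (x, 0)‖ < δ →
      ∀ s, ‖((p.1 s, u s + p.2 s) : E × U) - (x s, u s)‖ < δ := by
    intro p hp s
    have h1 := (norm_prod_le_iff.1 (le_refl ‖p - (x, 0)‖)).1
    have h2 := (norm_prod_le_iff.1 (le_refl ‖p - (x, 0)‖)).2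
    refine lt_of_le_of_lt (norm_prod_le_iff.2 ⟨?_, ?_⟩) hp
    · exact ((p.1 - x).norm_coe_le_norm s).trans h1
    · have := ((p.2 - 0).norm_coe_le_norm s).trans h2
      simpa using this
  filter_upwards [prod_mem_nhds (Metric.ball_mem_nhds ((x, 0) : (ℝ →ᵇ E) × (ℝ →ᵇ U)) hδ)
    (Metric.ball_mem_nhds _ hδ)] with ⟨p, q⟩ ⟨hp, hq⟩
  simp only [Metric.mem_ball, dist_eq_norm] at hp hq
  refine (norm_le (by positivity)).2 fun t => ?_
  have hi1 := (hF.bddMeasurableOn_comp hu p.1 p.2).integrableOn.intervalIntegrable_of_mem_Icc ha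
    (clampTo_mem hαβ t)
  have hi2 := (hF.bddMeasurableOn_comp hu q.1 q.2).integrableOn.intervalIntegrable_of_mem_Icc ha
    (clampTo_mem hαβ t)
  have hi3 := ((hF.bddMeasurableOn_deriv hu x).clm_apply (y := fun s => ((p - q).1 s, (p - q).2 s))
    (.of_continuousOn (by fun_prop))).integrableOn.intervalIntegrable_of_mem_Icc ha
    (clampTo_mem hαβ t)
  change ‖N p t - N q t - N' (p - q) t‖ ≤ _
  rw [hN, hN, hN', ← intervalIntegral.integral_sub hi1 hi2,
    ← intervalIntegral.integral_sub (hi1.sub hi2) hi3]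
  refine (norm_integral_clampTo_le ha (C := c / (β - α + 1) * ‖p - q‖) (fun s hs => ?_) t).trans ?_
  · have h1 := h s hs _ _ (hnear p hp s) (hnear q hq s)
    have h2 : ((p.1 s, u s + p.2 s) : E × U) - (q.1 s, u s + q.2 s) =
        ((p - q).1 s, (p - q).2 s) := by simp
    rw [h2] at h1
    refine h1.trans (mul_le_mul_of_nonneg_left (norm_prod_le_iff.2 ⟨?_, ?_⟩) (by positivity))
    · exact ((p - q).1.norm_coe_le_norm s).trans (norm_fst_le (p - q))
    · exact ((p - q).2.norm_coe_le_norm s).trans (norm_snd_le (p - q))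
  · rw [mul_right_comm]
    refine mul_le_mul_of_nonneg_right ?_ (norm_nonneg _)
    rw [div_mul_eq_mul_div, div_le_iff₀ (by positivity)]
    nlinarith

/-- `X (ξ, v)` is, for `(ξ, v)` near `(ξ₀, 0)`, the solution on `[α, β]` of
`x' = F (x, u + v, t)`, `x a = ξ`; it depends on `(ξ, v)` in a strictly differentiable way, and its
derivative solves the linearized equation. -/
structure IsFlowNear (F : (E × U) × ℝ → E) (F' : (E × U) × ℝ → E × U →L[ℝ] E) (u : ℝ → U)
    (α β a : ℝ) (ξ₀ : E) (X : E × (ℝ →ᵇ U) → (ℝ →ᵇ E)) (X' : E × (ℝ →ᵇ U) →L[ℝ] (ℝ →ᵇ E)) :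
    Prop where
  strict : HasStrictFDerivAt X X' (ξ₀, 0)
  eventually_eq : ∀ᶠ p in 𝓝 ((ξ₀, 0) : E × (ℝ →ᵇ U)), ∀ t,
    X p t = p.1 + ∫ s in a..clampTo α β t, F ((X p s, u s + p.2 s), s)
  deriv_eq : ∀ p t,
    X' p t = p.1 + ∫ s in a..clampTo α β t, F' ((X (ξ₀, 0) s, u s), s) (X' p s, p.2 s)

/-- Implicit function theorem for `x - ξ - N (x, v) = 0`, where `N` is the integral operator. The
partial derivative in `x` at the given solution is `1` minus the Volterra operator with kernel
`∂F/∂x`, which is invertible. Because of `clampTo` the unknown is a function on all of `ℝ`, constant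
outside `[α, β]`, and the equation holds for every `t`. -/
theorem IsC1Field.exists_isFlowNear (hF : IsC1Field F F') (ha : a ∈ Icc α β)
    (hu : BddMeasurableOn u α β) {x : ℝ →ᵇ E} {ξ₀ : E}
    (hx : ∀ t, x t = ξ₀ + ∫ s in a..clampTo α β t, F ((x s, u s), s)) :
    ∃ X X', IsFlowNear F F' u α β a ξ₀ X X' ∧ X (ξ₀, 0) = x := by
  have : CompleteSpace E := FiniteDimensional.complete ℝ E
  have : CompleteSpace U := FiniteDimensional.complete ℝ U
  have hαβ : α ≤ β := ha.1.trans ha.2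
  choose N hN using fun p : (ℝ →ᵇ E) × (ℝ →ᵇ U) =>
    exists_boundedContinuous_primitive ha (hF.bddMeasurableOn_comp hu p.1 p.2).integrableOn
  have hD := hF.bddMeasurableOn_deriv hu x
  have hA : BddMeasurableOn (fun s => (F' ((x s, u s), s)).comp (.inl ℝ E U)) α β :=
    (BddMeasurableOn.of_continuousOn x.continuous.continuousOn).comp_continuous
      (Φ := fun q => (F' q).comp (.inl ℝ E U)) (by have := hF.cont'; fun_prop) hu
  have hB : BddMeasurableOn (fun s => (F' ((x s, u s), s)).comp (.inr ℝ E U)) α β :=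
    (BddMeasurableOn.of_continuousOn x.continuous.continuousOn).comp_continuous
      (Φ := fun q => (F' q).comp (.inr ℝ E U)) (by have := hF.cont'; fun_prop) hu
  obtain ⟨KA, hKA⟩ := exists_volterra ha hA
  obtain ⟨KB, hKB⟩ := exists_volterra ha hB
  obtain ⟨c, hc⟩ := exists_const_clm E
  have hN' : ∀ (p : (ℝ →ᵇ E) × (ℝ →ᵇ U)) t,
      (KA.comp (.fst ℝ (ℝ →ᵇ E) (ℝ →ᵇ U)) + KB.comp (.snd ℝ (ℝ →ᵇ E) (ℝ →ᵇ U))) p t =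
        ∫ s in a..clampTo α β t, F' ((x s, u s), s) (p.1 s, p.2 s) := by
    intro p t
    change KA p.1 t + KB p.2 t = _
    rw [hKA, hKB, ← intervalIntegral.integral_add]
    · refine intervalIntegral.integral_congr fun s _ => ?_
      simp [← map_add]
    · exact (hA.clm_apply (.of_continuousOn
        p.1.continuous.continuousOn)).integrableOn.intervalIntegrable_of_mem_Icc ha
        (clampTo_mem hαβ t)
    · exact (hB.clm_apply (.of_continuousOn
        p.2.continuous.continuousOn)).integrableOn.intervalIntegrable_of_mem_Icc ha
        (clampTo_mem hαβ t)
  have hNs := hF.hasStrictFDerivAt_integral ha hu x hN hN'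
  set N' := KA.comp (.fst ℝ (ℝ →ᵇ E) (ℝ →ᵇ U)) + KB.comp (.snd ℝ (ℝ →ᵇ E) (ℝ →ᵇ U))
  let f : (E × (ℝ →ᵇ U)) × (ℝ →ᵇ E) → (ℝ →ᵇ E) := fun q => q.2 - c q.1.1 - N (q.2, q.1.2)
  let swap : (E × (ℝ →ᵇ U)) × (ℝ →ᵇ E) →L[ℝ] (ℝ →ᵇ E) × (ℝ →ᵇ U) :=
    (ContinuousLinearMap.snd ℝ _ _).prod
      ((ContinuousLinearMap.snd ℝ _ _).comp (ContinuousLinearMap.fst ℝ _ _))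
  let f' : (E × (ℝ →ᵇ U)) × (ℝ →ᵇ E) →L[ℝ] (ℝ →ᵇ E) :=
    ContinuousLinearMap.snd ℝ _ _ -
      c.comp ((ContinuousLinearMap.fst ℝ _ _).comp (ContinuousLinearMap.fst ℝ _ _)) -
      N'.comp swap
  have hf : HasStrictFDerivAt f f' ((ξ₀, 0), x) := by
    refine HasStrictFDerivAt.sub (HasStrictFDerivAt.sub hasStrictFDerivAt_snd ?_) ?_
    · exact ContinuousLinearMap.hasStrictFDerivAt (c.comp ((ContinuousLinearMap.fst ℝ E
        (ℝ →ᵇ U)).comp (ContinuousLinearMap.fst ℝ (E × (ℝ →ᵇ U)) (ℝ →ᵇ E))))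
    · exact HasStrictFDerivAt.comp (g := N) (f := swap) _ hNs swap.hasStrictFDerivAt
  have hinv : (f'.comp (ContinuousLinearMap.inr ℝ _ _)).IsInvertible := by
    have h1 : f'.comp (ContinuousLinearMap.inr ℝ _ _) = 1 - KA := by
      ext y t
      simp [f', swap, N']
    rw [h1]
    obtain ⟨w, hw⟩ := isUnit_one_sub_volterra ha hA.bdd hKA
    exact ⟨ContinuousLinearEquiv.unitsEquiv ℝ _ w, by rw [← hw]; rfl⟩
  have hf0 : f ((ξ₀, 0), x) = 0 := by
    ext t
    change x t - c ξ₀ t - N (x, 0) t = 0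
    rw [hc, hN, hx t]
    simp
  set X := hf.implicitFunctionOfProdDomain hinv
  have hXx : X (ξ₀, 0) = x :=
    (hf.eventually_apply_eq_iff_implicitFunctionOfProdDomain hinv).self_of_nhds.1 rfl
  have hXs := hf.hasStrictFDerivAt_implicitFunctionOfProdDomain hinv
  have hXe := hf.eventually_apply_implicitFunctionOfProdDomain hinv
  set X' := (-(f'.comp (ContinuousLinearMap.inr ℝ _ _)).inverse).comp
    (f'.comp (ContinuousLinearMap.inl ℝ _ _))
  rw [hf0] at hXe
  refine ⟨X, X', ⟨hXs, ?_, ?_⟩, hXx⟩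
  · filter_upwards [hXe] with p hp t
    have h1 : X p t - c p.1 t - N (X p, p.2) t = 0 := congrArg (fun y : ℝ →ᵇ E => y t) hp
    rw [hc, hN, sub_sub, sub_eq_zero] at h1
    exact h1
  · intro p t
    -- The linearized equation comes from differentiating the identity `f (p, X p) = 0`, valid near
    -- `(ξ₀, 0)`, so the inverse in the formula for `X'` need not be computed.
    have hpair : HasStrictFDerivAt (fun p => (p, X p))
        ((ContinuousLinearMap.id ℝ (E × (ℝ →ᵇ U))).prod X') (ξ₀, 0) :=
      (hasStrictFDerivAt_id _).prodMk hXs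
    have h1 : HasStrictFDerivAt f f' ((ξ₀, 0), X (ξ₀, 0)) := by rw [hXx]; exact hf
    have h2 := (HasStrictFDerivAt.comp (g := f) (ξ₀, 0) h1 hpair).hasFDerivAt
    have h3 : HasFDerivAt (f ∘ fun p => (p, X p))
        (0 : E × (ℝ →ᵇ U) →L[ℝ] (ℝ →ᵇ E)) (ξ₀, 0) :=
      (hasFDerivAt_const (0 : ℝ →ᵇ E) _).congr_of_eventuallyEq hXe
    have h4 := congrArg (fun L : E × (ℝ →ᵇ U) →L[ℝ] (ℝ →ᵇ E) => L p t) (h2.unique h3)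
    have h5 : X' p t - c p.1 t - N' (X' p, p.2) t = 0 := h4
    rw [hc, hN', sub_sub, sub_eq_zero] at h5
    rw [h5, hXx]

/-- Joint strict differentiability of the flow in the parameters and in time. -/
theorem IsFlowNear.hasStrictFDerivAt_eval {X : E × (ℝ →ᵇ U) → (ℝ →ᵇ E)}
    {X' : E × (ℝ →ᵇ U) →L[ℝ] (ℝ →ᵇ E)} {ξ₀ : E} {τ : ℝ} (hF : IsC1Field F F') (ha : a ∈ Icc α β)
    (hu : BddMeasurableOn u α β) (hX : IsFlowNear F F' u α β a ξ₀ X X') (hτ : τ ∈ Ioo α β)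
    (huτ : ContinuousAt u τ) :
    HasStrictFDerivAt (fun q : (E × (ℝ →ᵇ U)) × ℝ => X q.1 q.2)
      (((evalCLM ℝ τ).comp X').comp (.fst ℝ _ _) +
        (ContinuousLinearMap.snd ℝ (E × (ℝ →ᵇ U)) ℝ).smulRight (F ((X (ξ₀, 0) τ, u τ), τ)))
      ((ξ₀, 0), τ) := by
  have hαβ : α ≤ β := ha.1.trans ha.2
  set x := X (ξ₀, 0)
  set F₀ := F ((x τ, u τ), τ)
  refine .of_isLittleO (Asymptotics.isLittleO_iff.2 fun c hc => ?_)
  -- The increment is the sum of three errors: the time step of `X p`, the linearization in the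
  -- parameters at time `σ'`, and the replacement of `σ'` by `τ` in `X' (p - p')`. Each gets a third
  -- of `c`.
  have hε : 0 < c / 3 := by positivity
  -- the integrand is close to its value at the nominal point
  have hXc : Tendsto X (𝓝 (ξ₀, 0)) (𝓝 x) := hX.strict.continuousAt
  have hcont : Tendsto (fun w : ((ℝ →ᵇ E) × (ℝ →ᵇ U)) × ℝ =>
      F ((w.1.1 w.2, u w.2 + w.1.2 w.2), w.2)) (𝓝 ((x, 0), τ)) (𝓝 F₀) := by
    have h1 : ContinuousAt (fun w : ((ℝ →ᵇ E) × (ℝ →ᵇ U)) × ℝ =>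
      F ((w.1.1 w.2, u w.2 + w.1.2 w.2), w.2)) ((x, 0), τ) := by
      refine hF.cont.continuousAt.comp ?_
      refine ContinuousAt.prodMk (ContinuousAt.prodMk ?_ (ContinuousAt.add ?_ ?_)) continuousAt_snd
      · exact (continuous_eval (F := ℝ →ᵇ E)).continuousAt.comp (x := (((x, 0), τ) :
          ((ℝ →ᵇ E) × (ℝ →ᵇ U)) × ℝ)) (f := fun w => (w.1.1, w.2)) (by fun_prop)
      · exact ContinuousAt.comp (x := (((x, 0), τ) :
          ((ℝ →ᵇ E) × (ℝ →ᵇ U)) × ℝ)) (f := fun w => w.2) huτ continuousAt_snd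
      · exact (continuous_eval (F := ℝ →ᵇ U)).continuousAt.comp (x := (((x, 0), τ) :
          ((ℝ →ᵇ E) × (ℝ →ᵇ U)) × ℝ)) (f := fun w => (w.1.2, w.2)) (by fun_prop)
    simpa [ContinuousAt, F₀] using h1
  have hclose : ∀ᶠ w in 𝓝 (((x, 0), τ) : ((ℝ →ᵇ E) × (ℝ →ᵇ U)) × ℝ),
      ‖F ((w.1.1 w.2, u w.2 + w.1.2 w.2), w.2) - F₀‖ ≤ c / 3 := by
    filter_upwards [hcont (Metric.ball_mem_nhds F₀ hε)] with w hw
    exact le_of_lt (by simpa [dist_eq_norm] using hw)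
  rw [nhds_prod_eq] at hclose
  obtain ⟨P₁, hP₁, P₂, hP₂, hcl⟩ := eventually_prod_iff.1 hclose
  obtain ⟨δ₁, hδ₁, hδ₁'⟩ := Metric.eventually_nhds_iff.1 hP₂
  obtain ⟨M, hM⟩ := (hF.bddMeasurableOn_deriv hu x).bdd
  have hM0 : 0 ≤ M := (norm_nonneg _).trans (hM a ha)
  -- By the linearized equation `X' (p - p')` is Lipschitz in time on `[α, β]` with constant `C * ‖p
  -- - p'‖`; the summand `1` accounts for the control component of `p - p'`.
  set C := M * (‖X'‖ + 1)
  have hC0 : 0 ≤ C := by positivity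
  have hpar : ∀ᶠ p in 𝓝 ((ξ₀, 0) : E × (ℝ →ᵇ U)), P₁ (X p, p.2) := by
    refine Tendsto.eventually ?_ hP₁
    rw [nhds_prod_eq (x := x)]
    exact hXc.prodMk continuousAt_snd
  have hlin := Asymptotics.isLittleO_iff.1 hX.strict.isLittleO hε
  have htime : ∀ᶠ σ in 𝓝 τ, σ ∈ Ioo α β ∧ dist σ τ < δ₁ ∧ C * |σ - τ| ≤ c / 3 := by
    refine Filter.Eventually.and (Ioo_mem_nhds hτ.1 hτ.2)
      (Filter.Eventually.and (Metric.ball_mem_nhds τ hδ₁) ?_)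
    have : Tendsto (fun σ => C * |σ - τ|) (𝓝 τ) (𝓝 (C * |τ - τ|)) := by
      apply Continuous.tendsto; fun_prop
    simp only [sub_self, abs_zero, mul_zero] at this
    exact this.eventually (ge_mem_nhds hε)
  have hfull : ∀ᶠ q in 𝓝 (((ξ₀, 0), τ) : (E × (ℝ →ᵇ U)) × ℝ),
      (q.2 ∈ Ioo α β ∧ dist q.2 τ < δ₁ ∧ C * |q.2 - τ| ≤ c / 3) ∧ P₁ (X q.1, q.1.2) ∧ ∀ t,
      X q.1 t = q.1.1 + ∫ s in a..clampTo α β t, F ((X q.1 s, u s + q.1.2 s), s) := by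
    rw [nhds_prod_eq]
    exact (tendsto_snd.eventually htime).and ((tendsto_fst.eventually hpar).and
      (tendsto_fst.eventually hX.eventually_eq))
  have hlin' : ∀ᶠ w in 𝓝 ((((ξ₀, 0), τ), ((ξ₀, 0), τ)) :
      ((E × (ℝ →ᵇ U)) × ℝ) × ((E × (ℝ →ᵇ U)) × ℝ)),
      ‖X w.1.1 - X w.2.1 - X' (w.1.1 - w.2.1)‖ ≤ c / 3 * ‖w.1.1 - w.2.1‖ := by
    have : ContinuousAt (fun w : ((E × (ℝ →ᵇ U)) × ℝ) × ((E × (ℝ →ᵇ U)) × ℝ) =>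
      (w.1.1, w.2.1)) (((ξ₀, 0), τ), ((ξ₀, 0), τ)) := by fun_prop
    exact this.eventually hlin
  have hfull' := (hfull.prod_inl_nhds ((((ξ₀, 0), τ)) : (E × (ℝ →ᵇ U)) × ℝ)).and
    (hfull.prod_inr_nhds ((((ξ₀, 0), τ)) : (E × (ℝ →ᵇ U)) × ℝ))
  filter_upwards [hlin', hfull']
    with ⟨⟨p, σ⟩, ⟨p', σ'⟩⟩ h1 ⟨⟨⟨hσ, hσd, hσC⟩, hp1, hp⟩, ⟨hσ', hσd', hσC'⟩, hp1', hp'⟩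
  dsimp only at *
  have hm : σ ∈ Icc α β := Ioo_subset_Icc_self hσ
  have hm' : σ' ∈ Icc α β := Ioo_subset_Icc_self hσ'
  have hmτ : τ ∈ Icc α β := Ioo_subset_Icc_self hτ
  have hnp : ‖p - p'‖ ≤ ‖((p, σ) : (E × (ℝ →ᵇ U)) × ℝ) - (p', σ')‖ :=
    norm_fst_le (((p, σ) : (E × (ℝ →ᵇ U)) × ℝ) - (p', σ'))
  have hns : |σ - σ'| ≤ ‖((p, σ) : (E × (ℝ →ᵇ U)) × ℝ) - (p', σ')‖ :=
    norm_snd_le (((p, σ) : (E × (ℝ →ᵇ U)) × ℝ) - (p', σ'))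
  set q := ((p, σ) : (E × (ℝ →ᵇ U)) × ℝ) - (p', σ')
  have hint := (hF.bddMeasurableOn_comp hu (X p) p.2).integrableOn
  have t1 : ‖X p σ - X p σ' - (σ - σ') • F₀‖ ≤ c / 3 * ‖q‖ := by
    rw [hp σ, hp σ', add_sub_add_left_eq_sub, clampTo_of_mem hm, clampTo_of_mem hm',
      intervalIntegral.integral_interval_sub_left (hint.intervalIntegrable_of_mem_Icc ha hm)
        (hint.intervalIntegrable_of_mem_Icc ha hm'), ← intervalIntegral.integral_const,
      ← intervalIntegral.integral_sub (hint.intervalIntegrable_of_mem_Icc hm' hm)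
        _root_.intervalIntegrable_const]
    refine (intervalIntegral.norm_integral_le_of_norm_le_const (C := c / 3) fun s hs => ?_).trans
      (mul_le_mul_of_nonneg_left hns hε.le)
    refine hcl hp1 (hδ₁' ?_) (x := (X p, p.2)) (y := s)
    have hsub : uIoc σ' σ ⊆ Metric.ball τ δ₁ := by
      refine uIoc_subset_uIcc.trans ?_
      rw [← segment_eq_uIcc]
      exact (convex_ball τ δ₁).segment_subset hσd' hσd
    exact hsub hs
  have t2 : ‖(X p - X p' - X' (p - p')) σ'‖ ≤ c / 3 * ‖q‖ :=
    (norm_coe_le_norm _ _).trans (h1.trans (mul_le_mul_of_nonneg_left hnp hε.le))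
  have t3 : ‖X' (p - p') σ' - X' (p - p') τ‖ ≤ c / 3 * ‖q‖ := by
    have hi := ((hF.bddMeasurableOn_deriv hu x).clm_apply
      (y := fun s => (X' (p - p') s, (p - p').2 s))
      (.of_continuousOn (by fun_prop))).integrableOn
    rw [hX.deriv_eq _ σ', hX.deriv_eq _ τ, add_sub_add_left_eq_sub, clampTo_of_mem hm',
      clampTo_of_mem hmτ,
      intervalIntegral.integral_interval_sub_left (hi.intervalIntegrable_of_mem_Icc ha hm')
        (hi.intervalIntegrable_of_mem_Icc ha hmτ)]
    refine (intervalIntegral.norm_integral_le_of_norm_le_const (C := C * ‖p - p'‖)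
      fun s hs => ?_).trans ?_
    · refine (ContinuousLinearMap.le_opNorm _ _).trans ?_
      rw [mul_assoc]
      refine mul_le_mul (hM s (uIoc_subset_Icc' hmτ hm' hs)) (norm_prod_le_iff.2 ⟨?_, ?_⟩)
        (norm_nonneg _) hM0
      · refine (norm_coe_le_norm _ _).trans ((X'.le_opNorm _).trans ?_)
        nlinarith [norm_nonneg (p - p')]
      · refine (norm_coe_le_norm _ _).trans ((norm_snd_le (p - p')).trans ?_)
        nlinarith [norm_nonneg (p - p'), norm_nonneg X']
    · rw [mul_right_comm]
      exact (mul_le_mul_of_nonneg_right hσC' (norm_nonneg _)).trans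
        (mul_le_mul_of_nonneg_left hnp hε.le)
  have hsum : X p σ - X p' σ' - (X' (p - p') τ + (σ - σ') • F₀) =
      (X p σ - X p σ' - (σ - σ') • F₀) + (X p - X p' - X' (p - p')) σ' +
        (X' (p - p') σ' - X' (p - p') τ) := by
    change _ = _ + (X p σ' - X p' σ' - X' (p - p') σ') + _
    abel
  change ‖X p σ - X p' σ' - (X' (p - p') τ + (σ - σ') • F₀)‖ ≤ c * ‖q‖
  rw [hsum]
  refine (norm_add₃_le).trans ?_
  linarith

end

/-! ### Linear equations, their adjoints and the fundamental lemma -/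

section
open MeasureTheory BoundedContinuousFunction
open scoped BoundedContinuousFunction

section linear
variable {E U : Type*} [NormedAddCommGroup E] [NormedSpace ℝ E]
  [NormedAddCommGroup U] [NormedSpace ℝ U]

theorem hasDerivAt_of_eq_add_integral [CompleteSpace E] {α β a t : ℝ} {h y : ℝ → E} {c : E}
    (hh : IntegrableOn h (Icc α β)) (ha : a ∈ Icc α β)
    (hy : ∀ t ∈ Icc α β, y t = c + ∫ s in a..t, h s) (ht : t ∈ Ioo α β) (hc : ContinuousAt h t) :
    HasDerivAt y (h t) t := by
  have hn : Icc α β ∈ 𝓝 t := Icc_mem_nhds ht.1 ht.2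
  have h1 := intervalIntegral.integral_hasDerivAt_right
    (hh.intervalIntegrable_of_mem_Icc ha (Ioo_subset_Icc_self ht))
    ⟨Icc α β, hn, hh.aestronglyMeasurable⟩ hc
  exact (h1.const_add c).congr_of_eventuallyEq (by filter_upwards [hn] with s hs using hy s hs)

theorem BddMeasurableOn.clm_comp {G : Type*} [NormedAddCommGroup G] [NormedSpace ℝ G]
    {A : ℝ → U →L[ℝ] G} {B : ℝ → E →L[ℝ] U} {α β : ℝ}
    (hA : BddMeasurableOn A α β) (hB : BddMeasurableOn B α β) :
    BddMeasurableOn (fun s => (A s).comp (B s)) α β := by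
  obtain ⟨C, hC⟩ := hA.bdd
  obtain ⟨D, hD⟩ := hB.bdd
  refine ⟨isBoundedBilinearMap_comp.continuous.comp_aestronglyMeasurable
    (hA.aesm.prodMk hB.aesm), C * D, fun t ht => ?_⟩
  exact ((A t).opNorm_comp_le _).trans
    (mul_le_mul (hC t ht) (hD t ht) (norm_nonneg _) ((norm_nonneg _).trans (hC t ht)))

theorem BddMeasurableOn.map {h : ℝ → E} {α β : ℝ} (hh : BddMeasurableOn h α β) (T : E →L[ℝ] U) :
    BddMeasurableOn (fun s => T (h s)) α β := by
  obtain ⟨C, hC⟩ := hh.bdd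
  exact ⟨T.continuous.comp_aestronglyMeasurable hh.aesm, ‖T‖ * C, fun t ht =>
    (T.le_opNorm _).trans (mul_le_mul_of_nonneg_left (hC t ht) (norm_nonneg _))⟩

/-- With this operator the adjoint equation is a linear equation in the dual space with coefficient
`T (A s)`, so `exists_linear_solution` applies to it. -/
theorem exists_neg_precomp (E : Type*) [NormedAddCommGroup E] [NormedSpace ℝ E] :
    ∃ T : (E →L[ℝ] E) →L[ℝ] (E →L[ℝ] ℝ) →L[ℝ] (E →L[ℝ] ℝ), ∀ A q, T A q = -q.comp A :=
  ⟨-(ContinuousLinearMap.compL ℝ E E ℝ).flip, fun _ _ => rfl⟩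

/-- A linear equation with bounded measurable coefficients has a global solution. -/
theorem exists_linear_solution [CompleteSpace E] {α β a : ℝ} (ha : a ∈ Icc α β)
    {A : ℝ → E →L[ℝ] E} (hA : BddMeasurableOn A α β) (ξ : E) :
    ∃ y : ℝ →ᵇ E, ∀ t ∈ Icc α β, y t = ξ + ∫ s in a..t, A s (y s) := by
  obtain ⟨K, hK⟩ := exists_volterra ha hA
  obtain ⟨c, hc⟩ := exists_const_clm E
  obtain ⟨w, hw⟩ := isUnit_one_sub_volterra ha hA.bdd hK
  refine ⟨(↑w⁻¹ : (ℝ →ᵇ E) →L[ℝ] (ℝ →ᵇ E)) (c ξ), fun t ht => ?_⟩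
  set y := (↑w⁻¹ : (ℝ →ᵇ E) →L[ℝ] (ℝ →ᵇ E)) (c ξ)
  have h1 : (1 - K) y = c ξ := by
    rw [← hw]
    change ((w : (ℝ →ᵇ E) →L[ℝ] (ℝ →ᵇ E)) * ↑w⁻¹) (c ξ) = c ξ
    rw [w.mul_inv]; rfl
  have h2 : y t - K y t = ξ := by
    have := congrArg (fun y : ℝ →ᵇ E => y t) h1
    rwa [hc] at this
  rw [hK, clampTo_of_mem ht, sub_eq_iff_eq_add] at h2
  exact h2

/-- The backward linear equation `q' = -q ∘ A`, `q β = ℓ`. -/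
theorem exists_adjoint_solution {α β : ℝ} (hαβ : α ≤ β) {A : ℝ → E →L[ℝ] E}
    (hA : BddMeasurableOn A α β) (ℓ : E →L[ℝ] ℝ) :
    ∃ q : ℝ →ᵇ (E →L[ℝ] ℝ), ∀ t ∈ Icc α β, q t = ℓ + ∫ s in β..t, -(q s).comp (A s) := by
  obtain ⟨T, hT⟩ := exists_neg_precomp E
  obtain ⟨q, hq⟩ := exists_linear_solution (a := β) ⟨hαβ, le_rfl⟩ (hA.map T) ℓ
  exact ⟨q, by simpa only [hT] using hq⟩

/-- Integration by parts for a solution of a linear equation and a solution of its adjoint. -/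
theorem adjoint_pairing [CompleteSpace E] {α β : ℝ} (hαβ : α ≤ β) {A : ℝ → E →L[ℝ] E} {b : ℝ → E}
    (hA : BddMeasurableOn A α β) (hb : BddMeasurableOn b α β) {S : Set ℝ} (hS : S.Countable)
    (hAc : ∀ t ∈ Ioo α β \ S, ContinuousAt A t) (hbc : ∀ t ∈ Ioo α β \ S, ContinuousAt b t)
    {y : ℝ → E} (hyc : Continuous y) {c : E}
    (hy : ∀ t ∈ Icc α β, y t = c + ∫ s in α..t, (A s (y s) + b s))
    {q : ℝ → E →L[ℝ] ℝ} (hqc : Continuous q) {ℓ : E →L[ℝ] ℝ}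
    (hq : ∀ t ∈ Icc α β, q t = ℓ + ∫ s in β..t, -(q s).comp (A s)) :
    q β (y β) = q α (y α) + ∫ s in α..β, q s (b s) := by
  have hiy : IntegrableOn (fun s => A s (y s) + b s) (Icc α β) :=
    (hA.clm_apply (.of_continuousOn hyc.continuousOn)).integrableOn.add hb.integrableOn
  have hiq : IntegrableOn (fun s => -(q s).comp (A s)) (Icc α β) :=
    ((BddMeasurableOn.of_continuousOn hqc.continuousOn).clm_comp hA).integrableOn.neg
  have hqb : BddMeasurableOn (fun s => q s (b s)) α β :=
    (BddMeasurableOn.of_continuousOn hqc.continuousOn).clm_apply hb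
  -- `q t (y t)` is continuous, so its derivative is needed only off a countable set. There the two
  -- terms with `A` cancel and `q t (b t)` is left.
  have hftc := integral_eq_of_hasDerivAt_off_countable_of_le (fun t => q t (y t))
    (fun t => q t (b t)) hαβ hS (by fun_prop) (fun t ht => ?_)
    (hqb.integrableOn.intervalIntegrable_of_mem_Icc ⟨le_rfl, hαβ⟩ ⟨hαβ, le_rfl⟩)
  · rw [hftc]; ring
  · have h1 := hasDerivAt_of_eq_add_integral hiy ⟨le_rfl, hαβ⟩ hy ht.1
      (((hAc t ht).clm_apply hyc.continuousAt).add (hbc t ht))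
    have h2 := hasDerivAt_of_eq_add_integral hiq ⟨hαβ, le_rfl⟩ hq ht.1
      (hqc.continuousAt.clm_comp (hAc t ht)).neg
    have h3 := h2.clm_apply h1
    convert h3 using 1
    simp

/-- Fundamental lemma of the calculus of variations at a point of continuity. -/
theorem eq_zero_of_forall_integral_apply_eq_zero {α β t : ℝ} {h : ℝ → U →L[ℝ] ℝ}
    (hh : BddMeasurableOn h α β)
    (h0 : ∀ v : ℝ →ᵇ U, ∫ s in α..β, h s (v s) = 0) (ht : t ∈ Ioo α β) (hc : ContinuousAt h t) :
    h t = 0 := by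
  have hαβ : α ≤ β := (ht.1.trans ht.2).le
  by_contra hne
  obtain ⟨w, hw⟩ : ∃ w, h t w ≠ 0 := by
    by_contra! hcon
    exact hne (ContinuousLinearMap.ext hcon)
  have hkc : ContinuousAt (fun s => h s w) t := hc.clm_apply continuousAt_const
  have hkb : BddMeasurableOn (fun s => h s w) α β := hh.clm_apply (.of_continuousOn continuousOn_const)
  -- Testing with scalar bumps times the fixed direction `w` reduces the claim to the scalar lemma.
  -- Its almost everywhere conclusion contradicts `h s w ≠ 0` on a neighbourhood of `t`, which has
  -- positive measure.
  have hae := isOpen_Ioo.ae_eq_zero_of_integral_contDiff_smul_eq_zero (U := Ioo α β)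
    (f := fun s => h s w) (μ := volume)
    (hkb.integrableOn.mono_set Ioo_subset_Icc_self).locallyIntegrableOn (fun g hg hgc hgs => ?_)
  · have hn : {s | ¬ (s ∈ Ioo α β → h s w = 0)} ∈ 𝓝 t := by
      filter_upwards [Ioo_mem_nhds ht.1 ht.2, hkc.eventually_ne hw] with s hs hs'
      exact fun hcon => hs' (hcon hs)
    exact (Measure.measure_pos_of_mem_nhds volume hn).ne' hae
  · obtain ⟨C, hC⟩ := hgc.exists_bound_of_continuous hg.continuous
    let v : ℝ →ᵇ U := ofNormedAddCommGroup (fun s => g s • w) (by have := hg.continuous; fun_prop)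
      (C * ‖w‖) (fun s => by
        rw [norm_smul]; exact mul_le_mul_of_nonneg_right (hC s) (norm_nonneg _))
    have h1 := h0 v
    rw [intervalIntegral.integral_of_le hαβ] at h1
    rw [← h1]
    have h2 : ∀ s, h s (v s) = g s • h s w := fun s => by
      change h s (g s • w) = _
      rw [map_smul]
    simp_rw [h2]
    refine (setIntegral_eq_integral_of_forall_compl_eq_zero fun s hs => ?_).symm
    have : s ∉ tsupport g := fun hs' => hs (Ioo_subset_Ioc_self (hgs hs'))
    rw [image_eq_zero_of_notMem_tsupport this, zero_smul]

end linear

/-! ### Two phases: costates and the perturbed switching time -/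

variable {E U : Type*} [NormedAddCommGroup E] [NormedSpace ℝ E] [FiniteDimensional ℝ E]
  [NormedAddCommGroup U] [NormedSpace ℝ U] [FiniteDimensional ℝ U]
  {F₁ F₂ : (E × U) × ℝ → E} {F₁' F₂' : (E × U) × ℝ → E × U →L[ℝ] E} {u₁ u₂ : ℝ → U}

theorem IsC1Field.bddMeasurableOn_deriv_comp {H : Type*} [NormedAddCommGroup H] [NormedSpace ℝ H]
    {α β : ℝ} (hF₁ : IsC1Field F₁ F₁') (hu₁ : BddMeasurableOn u₁ α β) (x : ℝ →ᵇ E)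
    (i : H →L[ℝ] E × U) : BddMeasurableOn (fun s => (F₁' ((x s, u₁ s), s)).comp i) α β :=
  (BddMeasurableOn.of_continuousOn x.continuous.continuousOn).comp_continuous
    (Φ := fun q => (F₁' q).comp i) (by have := hF₁.cont'; fun_prop) hu₁

theorem IsC1Field.continuousAt_deriv_comp {H : Type*} [NormedAddCommGroup H] [NormedSpace ℝ H]
    (hF₁ : IsC1Field F₁ F₁') (x : ℝ →ᵇ E) (i : H →L[ℝ] E × U) {t : ℝ} (ht : ContinuousAt u₁ t) :
    ContinuousAt (fun s => (F₁' ((x s, u₁ s), s)).comp i) t :=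
  ContinuousAt.clm_comp (hF₁.cont'.continuousAt.comp
    ((x.continuous.continuousAt.prodMk ht).prodMk continuousAt_id)) continuousAt_const

/-- If a covector `ℓ` annihilates the terminal states of all first variations of a trajectory which
switches at `τ` from `F₁` to `F₂` on the surface with conormal `γ'`, then it propagates backwards to
costates that make the Hamiltonians stationary. -/
theorem exists_costates (hF₁ : IsC1Field F₁ F₁') (hF₂ : IsC1Field F₂ F₂') {a τ b : ℝ}
    (haτ : a < τ) (hτb : τ < b) (hu₁ : BddMeasurableOn u₁ a τ) (hu₂ : BddMeasurableOn u₂ τ b)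
    {S : Set ℝ} (hS : S.Countable) (hc₁ : ∀ t ∈ Ioo a τ \ S, ContinuousAt u₁ t)
    (hc₂ : ∀ t ∈ Ioo τ b \ S, ContinuousAt u₂ t) (x₁ x₂ : ℝ →ᵇ E) {γ' ℓ : E →L[ℝ] ℝ} {w₁ w₂ : E}
    (hγ : γ' w₁ ≠ 0)
    (hvar : ∀ v : ℝ →ᵇ U, ∃ (y₁ y₂ : ℝ →ᵇ E) (d : ℝ) (c : E),
      (∀ t ∈ Icc a τ, y₁ t = 0 + ∫ s in a..t, F₁' ((x₁ s, u₁ s), s) (y₁ s, v s)) ∧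
      (∀ t ∈ Icc τ b, y₂ t = c + ∫ s in τ..t, F₂' ((x₂ s, u₂ s), s) (y₂ s, v s)) ∧
      y₁ τ + d • w₁ = y₂ τ + d • w₂ ∧ γ' (y₁ τ + d • w₁) = 0 ∧ ℓ (y₂ b) = 0) :
    ∃ (q₁ q₂ : ℝ →ᵇ (E →L[ℝ] ℝ)) (ν : ℝ),
      (∀ t ∈ Icc a τ, q₁ t = (q₂ τ + ν • γ') +
        ∫ s in τ..t, -(q₁ s).comp ((F₁' ((x₁ s, u₁ s), s)).comp (.inl ℝ E U))) ∧
      (∀ t ∈ Icc τ b, q₂ t = ℓ +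
        ∫ s in b..t, -(q₂ s).comp ((F₂' ((x₂ s, u₂ s), s)).comp (.inl ℝ E U))) ∧
      q₁ τ w₁ = q₂ τ w₂ ∧
      (∀ t ∈ Ioo a τ, ContinuousAt u₁ t →
        (q₁ t).comp ((F₁' ((x₁ t, u₁ t), t)).comp (.inr ℝ E U)) = 0) ∧
      (∀ t ∈ Ioo τ b, ContinuousAt u₂ t →
        (q₂ t).comp ((F₂' ((x₂ t, u₂ t), t)).comp (.inr ℝ E U)) = 0) := by
  have : CompleteSpace E := FiniteDimensional.complete ℝ E
  have hA₁ := hF₁.bddMeasurableOn_deriv_comp hu₁ x₁ (.inl ℝ E U)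
  have hA₂ := hF₂.bddMeasurableOn_deriv_comp hu₂ x₂ (.inl ℝ E U)
  have hB₁ := hF₁.bddMeasurableOn_deriv_comp hu₁ x₁ (.inr ℝ E U)
  have hB₂ := hF₂.bddMeasurableOn_deriv_comp hu₂ x₂ (.inr ℝ E U)
  obtain ⟨q₂, hq₂⟩ := exists_adjoint_solution hτb.le hA₂ ℓ
  -- The one value for which the jump `ν • γ'` makes `q₁ τ w₁ = q₂ τ w₂`; the division is where
  -- transversality enters.
  set ν := (q₂ τ w₂ - q₂ τ w₁) / γ' w₁
  obtain ⟨q₁, hq₁⟩ := exists_adjoint_solution haτ.le hA₁ (q₂ τ + ν • γ')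
  have hq₁τ : q₁ τ = q₂ τ + ν • γ' := by simpa using hq₁ τ ⟨haτ.le, le_rfl⟩
  have hham : q₁ τ w₁ = q₂ τ w₂ := by
    rw [hq₁τ]
    simp only [_root_.add_apply, _root_.smul_apply, smul_eq_mul, ν]
    field_simp
    ring
  let h₁ : ℝ → U →L[ℝ] ℝ := fun s => (q₁ s).comp ((F₁' ((x₁ s, u₁ s), s)).comp (.inr ℝ E U))
  let h₂ : ℝ → U →L[ℝ] ℝ := fun s => (q₂ s).comp ((F₂' ((x₂ s, u₂ s), s)).comp (.inr ℝ E U))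
  have hb₁ : BddMeasurableOn h₁ a τ :=
    (BddMeasurableOn.of_continuousOn q₁.continuous.continuousOn).clm_comp hB₁
  have hb₂ : BddMeasurableOn h₂ τ b :=
    (BddMeasurableOn.of_continuousOn q₂.continuous.continuousOn).clm_comp hB₂
  have hsplit : ∀ (L : E × U →L[ℝ] E) (y : E) (v : U),
      L (y, v) = L.comp (.inl ℝ E U) y + L.comp (.inr ℝ E U) v := fun L y v => by
    simp [← map_add]
  -- the first variation of `ℓ`
  have hzero : ∀ v : ℝ →ᵇ U, (∫ s in a..τ, h₁ s (v s)) + ∫ s in τ..b, h₂ s (v s) = 0 := by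
    intro v
    obtain ⟨y₁, y₂, d, c, hy₁, hy₂, hmatch, htan, hend⟩ := hvar v
    simp only [hsplit] at hy₁ hy₂
    have hv₁ := BddMeasurableOn.of_continuousOn (α := a) (β := τ) v.continuous.continuousOn
    have hv₂ := BddMeasurableOn.of_continuousOn (α := τ) (β := b) v.continuous.continuousOn
    have p₁ := adjoint_pairing haτ.le hA₁ (hB₁.clm_apply hv₁) hS
      (fun t ht => hF₁.continuousAt_deriv_comp x₁ _ (hc₁ t ht))
      (fun t ht => (hF₁.continuousAt_deriv_comp x₁ _ (hc₁ t ht)).clm_apply v.continuous.continuousAt)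
      y₁.continuous hy₁ q₁.continuous hq₁
    have p₂ := adjoint_pairing hτb.le hA₂ (hB₂.clm_apply hv₂) hS
      (fun t ht => hF₂.continuousAt_deriv_comp x₂ _ (hc₂ t ht))
      (fun t ht => (hF₂.continuousAt_deriv_comp x₂ _ (hc₂ t ht)).clm_apply v.continuous.continuousAt)
      y₂.continuous hy₂ q₂.continuous hq₂
    have hq₂b : q₂ b = ℓ := by simpa using hq₂ b ⟨hτb.le, le_rfl⟩
    have hy₁a : y₁ a = 0 := by simpa using hy₁ a ⟨le_rfl, haτ.le⟩
    rw [hq₂b, hend] at p₂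
    rw [hy₁a, map_zero, zero_add] at p₁
    -- The jump vanishes on `y₁ τ + d • w₁`, which is tangent to the surface. Since `q₁ τ w₁ = q₂ τ
    -- w₂`, the terms with `d` then cancel, and the two pairings chain into one identity.
    have e₁ : q₁ τ (y₁ τ + d • w₁) = q₂ τ (y₁ τ + d • w₁) := by
      rw [hq₁τ, _root_.add_apply, _root_.smul_apply, htan, smul_zero,
        add_zero]
    rw [hmatch, map_add (q₂ τ), map_smul, ← hham, ← hmatch, map_add (q₁ τ), map_smul] at e₁
    have e₂ : q₁ τ (y₁ τ) = q₂ τ (y₂ τ) := add_right_cancel e₁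
    rw [← e₂, p₁] at p₂
    exact p₂.symm
  have hi₁ : ∀ v : ℝ →ᵇ U, IntervalIntegrable (fun s => h₁ s (v s)) volume a τ := fun v =>
    (hb₁.clm_apply (.of_continuousOn
      v.continuous.continuousOn)).integrableOn.intervalIntegrable_of_mem_Icc ⟨le_rfl, haτ.le⟩
      ⟨haτ.le, le_rfl⟩
  have hi₂ : ∀ v : ℝ →ᵇ U, IntervalIntegrable (fun s => h₂ s (v s)) volume τ b := fun v =>
    (hb₂.clm_apply (.of_continuousOn
      v.continuous.continuousOn)).integrableOn.intervalIntegrable_of_mem_Icc ⟨le_rfl, hτb.le⟩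
      ⟨hτb.le, le_rfl⟩
  classical
  -- Only the sum of the two integrals is known to vanish, with one `v` on all of `[a, b]`. The
  -- integrands are therefore glued before the fundamental lemma is applied.
  let h : ℝ → U →L[ℝ] ℝ := fun s => if s < τ then h₁ s else h₂ s
  have heq₁ : ∀ s < τ, h s = h₁ s := fun s hs => if_pos hs
  have heq₂ : ∀ s, τ ≤ s → h s = h₂ s := fun s hs => if_neg hs.not_gt
  have hb : BddMeasurableOn h a b := by
    obtain ⟨C, hC⟩ := hb₁.bdd
    obtain ⟨D, hD⟩ := hb₂.bdd
    constructor
    · rw [← Ico_union_Icc_eq_Icc haτ.le hτb.le, aestronglyMeasurable_union_iff]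
      constructor
      · refine (hb₁.aesm.mono_measure (Measure.restrict_mono Ico_subset_Icc_self le_rfl)).congr ?_
        exact (ae_restrict_iff' measurableSet_Ico).2
          (Eventually.of_forall fun s hs => (heq₁ s hs.2).symm)
      · refine hb₂.aesm.congr ?_
        exact (ae_restrict_iff' measurableSet_Icc).2
          (Eventually.of_forall fun s hs => (heq₂ s hs.1).symm)
    · refine ⟨max C D, fun t ht => ?_⟩
      rcases lt_or_ge t τ with hlt | hge
      · rw [heq₁ t hlt]; exact (hC t ⟨ht.1, hlt.le⟩).trans (le_max_left _ _)
      · rw [heq₂ t hge]; exact (hD t ⟨hge, ht.2⟩).trans (le_max_right _ _)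
  have hint : ∀ v : ℝ →ᵇ U, ∫ s in a..b, h s (v s) = 0 := by
    intro v
    have e₁ : ∫ s in a..τ, h₁ s (v s) = ∫ s in a..τ, h s (v s) := by
      refine intervalIntegral.integral_congr_ae ?_
      filter_upwards [compl_mem_ae_iff.2 (measure_singleton (μ := volume) τ)] with s hs hs'
      rw [uIoc_of_le haτ.le] at hs'
      rw [heq₁ s (lt_of_le_of_ne hs'.2 hs)]
    have e₂ : ∫ s in τ..b, h₂ s (v s) = ∫ s in τ..b, h s (v s) := by
      refine intervalIntegral.integral_congr fun s hs => ?_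
      rw [uIcc_of_le hτb.le] at hs
      simp only [heq₂ s hs.1]
    have hhv : IntegrableOn (fun s => h s (v s)) (Icc a b) :=
      (hb.clm_apply (.of_continuousOn v.continuous.continuousOn)).integrableOn
    have hab := (haτ.trans hτb).le
    rw [← intervalIntegral.integral_add_adjacent_intervals (b := τ)
      (hhv.intervalIntegrable_of_mem_Icc ⟨le_rfl, hab⟩ ⟨haτ.le, hτb.le⟩)
      (hhv.intervalIntegrable_of_mem_Icc ⟨haτ.le, hτb.le⟩ ⟨hab, le_rfl⟩), ← e₁, ← e₂]
    exact hzero v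
  refine ⟨q₁, q₂, ν, hq₁, hq₂, hham, fun t ht hut => ?_, fun t ht hut => ?_⟩
  · have hct : ContinuousAt h t :=
      (q₁.continuous.continuousAt.clm_comp (hF₁.continuousAt_deriv_comp x₁ (.inr ℝ E U) hut)).congr
        (by filter_upwards [gt_mem_nhds ht.2] with s hs using (heq₁ s hs).symm)
    have := eq_zero_of_forall_integral_apply_eq_zero hb hint ⟨ht.1, ht.2.trans hτb⟩ hct
    rwa [heq₁ t ht.2] at this
  · have hct : ContinuousAt h t :=
      (q₂.continuous.continuousAt.clm_comp (hF₂.continuousAt_deriv_comp x₂ (.inr ℝ E U) hut)).congr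
        (by filter_upwards [lt_mem_nhds ht.1] with s hs using (heq₂ s hs.le).symm)
    have := eq_zero_of_forall_integral_apply_eq_zero hb hint ⟨haτ.trans ht.1, ht.2⟩ hct
    rwa [heq₂ t ht.1.le] at this

/-- The terminal state as a function of the control variation, for a trajectory that switches from
`F₁` to `F₂` when it reaches the surface `γ = 0` transversally. -/
theorem exists_switching_data (hF₁ : IsC1Field F₁ F₁') (hF₂ : IsC1Field F₂ F₂') {a β τ α b : ℝ}
    (hτ₁ : τ ∈ Ioo a β) (hτ₂ : τ ∈ Ioo α b) (hu₁ : BddMeasurableOn u₁ a β)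
    (hu₂ : BddMeasurableOn u₂ α b) (huτ₁ : ContinuousAt u₁ τ) (huτ₂ : ContinuousAt u₂ τ)
    {ξ₁ ξ₂ : E} {X₁ X₂ : E × (ℝ →ᵇ U) → (ℝ →ᵇ E)} {X₁' X₂' : E × (ℝ →ᵇ U) →L[ℝ] (ℝ →ᵇ E)}
    (hX₁ : IsFlowNear F₁ F₁' u₁ a β a ξ₁ X₁ X₁') (hX₂ : IsFlowNear F₂ F₂' u₂ α b τ ξ₂ X₂ X₂')
    (hmatch : X₁ (ξ₁, 0) τ = X₂ (ξ₂, 0) τ) {γ : E → ℝ} {γ' : E →L[ℝ] ℝ}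
    (hγ : HasStrictFDerivAt γ γ' (X₁ (ξ₁, 0) τ)) (hγ0 : γ (X₁ (ξ₁, 0) τ) = 0)
    (htr : γ' (F₁ ((X₁ (ξ₁, 0) τ, u₁ τ), τ)) ≠ 0) :
    ∃ (ξ : (ℝ →ᵇ U) → E) (σ : (ℝ →ᵇ U) → ℝ) (ξ' : (ℝ →ᵇ U) →L[ℝ] E) (σ' : (ℝ →ᵇ U) →L[ℝ] ℝ),
      HasStrictFDerivAt ξ ξ' 0 ∧ HasStrictFDerivAt σ σ' 0 ∧ ξ 0 = ξ₂ ∧ σ 0 = τ ∧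
      (∀ᶠ v in 𝓝 0, X₁ (ξ₁, v) (σ v) = X₂ (ξ v, v) (σ v) ∧ γ (X₁ (ξ₁, v) (σ v)) = 0) ∧
      ∀ v, X₁' (0, v) τ + σ' v • F₁ ((X₁ (ξ₁, 0) τ, u₁ τ), τ) =
          X₂' (ξ' v, v) τ + σ' v • F₂ ((X₂ (ξ₂, 0) τ, u₂ τ), τ) ∧
        γ' (X₁' (0, v) τ + σ' v • F₁ ((X₁ (ξ₁, 0) τ, u₁ τ), τ)) = 0 := by
  have : CompleteSpace E := FiniteDimensional.complete ℝ E
  have : CompleteSpace U := FiniteDimensional.complete ℝ U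
  have hE₁ := hX₁.hasStrictFDerivAt_eval hF₁ ⟨le_rfl, (hτ₁.1.trans hτ₁.2).le⟩ hu₁ hτ₁ huτ₁
  have hE₂ := hX₂.hasStrictFDerivAt_eval hF₂ (Ioo_subset_Icc_self hτ₂) hu₂ hτ₂ huτ₂
  set x₁ := X₁ (ξ₁, 0) τ
  set x₂ := X₂ (ξ₂, 0) τ
  set w₁ := F₁ ((x₁, u₁ τ), τ)
  set w₂ := F₂ ((x₂, u₂ τ), τ)
  -- The unknowns are the state `e` of the second phase at the fixed time `τ` and the switching time
  -- `r`. The equations say that both phases meet at time `r`, and on the surface. Fixing the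
  -- starting time of the second phase at `τ` keeps `X₂` a single flow; its backward extension
  -- covers `r < τ`.
  let i₁ : (ℝ →ᵇ U) × (E × ℝ) → (E × (ℝ →ᵇ U)) × ℝ := fun p => ((ξ₁, p.1), p.2.2)
  let i₁' : (ℝ →ᵇ U) × (E × ℝ) →L[ℝ] (E × (ℝ →ᵇ U)) × ℝ :=
    ((0 : (ℝ →ᵇ U) × (E × ℝ) →L[ℝ] E).prod (.fst ℝ _ _)).prod
      ((ContinuousLinearMap.snd ℝ E ℝ).comp (.snd ℝ _ _))
  have hi₁ : HasStrictFDerivAt i₁ i₁' (0, (ξ₂, τ)) :=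
    ((hasStrictFDerivAt_const _ _).prodMk hasStrictFDerivAt_fst).prodMk
      (hasStrictFDerivAt_snd.comp _ hasStrictFDerivAt_snd)
  let i₂ : (ℝ →ᵇ U) × (E × ℝ) →L[ℝ] (E × (ℝ →ᵇ U)) × ℝ :=
    (((ContinuousLinearMap.fst ℝ E ℝ).comp (.snd ℝ _ _)).prod (.fst ℝ _ _)).prod
      ((ContinuousLinearMap.snd ℝ E ℝ).comp (.snd ℝ _ _))
  have hY₁ := HasStrictFDerivAt.comp (g := fun q : (E × (ℝ →ᵇ U)) × ℝ => X₁ q.1 q.2)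
    ((0, (ξ₂, τ)) : (ℝ →ᵇ U) × (E × ℝ)) hE₁ hi₁
  have hY₂ := HasStrictFDerivAt.comp (g := fun q : (E × (ℝ →ᵇ U)) × ℝ => X₂ q.1 q.2)
    ((0, (ξ₂, τ)) : (ℝ →ᵇ U) × (E × ℝ)) hE₂ i₂.hasStrictFDerivAt
  have hYγ := HasStrictFDerivAt.comp (g := γ) ((0, (ξ₂, τ)) : (ℝ →ᵇ U) × (E × ℝ)) hγ hY₁
  have hG := (hY₁.sub hY₂).prodMk hYγ
  set G : (ℝ →ᵇ U) × (E × ℝ) → E × ℝ := fun p =>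
    (((fun q : (E × (ℝ →ᵇ U)) × ℝ => X₁ q.1 q.2) ∘ i₁) p -
      ((fun q : (E × (ℝ →ᵇ U)) × ℝ => X₂ q.1 q.2) ∘ i₂) p,
      (γ ∘ (fun q : (E × (ℝ →ᵇ U)) × ℝ => X₁ q.1 q.2) ∘ i₁) p)
  have hG0 : G (0, (ξ₂, τ)) = 0 := by
    change ((x₁ - x₂, γ x₁) : E × ℝ) = 0
    rw [hmatch, sub_self, ← hmatch, hγ0]; rfl
  set G' := ((((evalCLM ℝ τ).comp X₁').comp (.fst ℝ _ _) +
        (ContinuousLinearMap.snd ℝ (E × (ℝ →ᵇ U)) ℝ).smulRight w₁).comp i₁' -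
      (((evalCLM ℝ τ).comp X₂').comp (.fst ℝ _ _) +
        (ContinuousLinearMap.snd ℝ (E × (ℝ →ᵇ U)) ℝ).smulRight w₂).comp i₂).prod
      (γ'.comp ((((evalCLM ℝ τ).comp X₁').comp (.fst ℝ _ _) +
        (ContinuousLinearMap.snd ℝ (E × (ℝ →ᵇ U)) ℝ).smulRight w₁).comp i₁'))
  have hG'a : ∀ (v : ℝ →ᵇ U) (e : E) (r : ℝ), G' (v, (e, r)) =
      ((X₁' (0, v) τ + r • w₁) - (X₂' (e, v) τ + r • w₂), γ' (X₁' (0, v) τ + r • w₁)) :=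
    fun v e r => rfl
  have hX₂τ : ∀ e v, X₂' (e, v) τ = e := fun e v => by
    rw [hX₂.deriv_eq, clampTo_of_mem (Ioo_subset_Icc_self hτ₂), intervalIntegral.integral_same,
      add_zero]
  have hinv : (G'.comp (ContinuousLinearMap.inr ℝ (ℝ →ᵇ U) (E × ℝ))).IsInvertible := by
    -- The partial derivative sends `(e, r)` to `(r w₁ - e - r w₂, r γ' w₁)`. Transversality forces
    -- `r = 0`, then `e = 0`; in finite dimension injectivity suffices.
    have hinj : Function.Injective
        (G'.comp (ContinuousLinearMap.inr ℝ (ℝ →ᵇ U) (E × ℝ)) : E × ℝ →ₗ[ℝ] E × ℝ) := by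
      rw [injective_iff_map_eq_zero]
      rintro ⟨e, r⟩ h
      have h1 : ((X₁' (0, 0) τ + r • w₁) - (X₂' (e, 0) τ + r • w₂),
        γ' (X₁' (0, 0) τ + r • w₁)) = (0, 0) := h
      have h2 : X₁' (0, 0) τ = 0 := by
        rw [show ((0, 0) : E × (ℝ →ᵇ U)) = 0 from rfl, map_zero]; rfl
      rw [Prod.mk.injEq, hX₂τ, h2, zero_add, map_smul, smul_eq_mul] at h1
      have hr : r = 0 := (mul_eq_zero.1 h1.2).resolve_right htr
      have he := h1.1
      rw [hr] at he
      simp only [zero_smul, add_zero, zero_sub, neg_eq_zero] at he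
      rw [hr, he]; rfl
    exact ⟨(LinearEquiv.ofInjectiveEndo _ hinj).toContinuousLinearEquiv, by ext <;> rfl⟩
  set Ψ := hG.implicitFunctionOfProdDomain hinv
  have hΨ0 : Ψ 0 = (ξ₂, τ) :=
    (hG.eventually_apply_eq_iff_implicitFunctionOfProdDomain hinv).self_of_nhds.1 rfl
  have hΨs := hG.hasStrictFDerivAt_implicitFunctionOfProdDomain hinv
  have hΨe := hG.eventually_apply_implicitFunctionOfProdDomain hinv
  set Ψ' := (-(G'.comp (ContinuousLinearMap.inr ℝ (ℝ →ᵇ U) (E × ℝ))).inverse).comp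
    (G'.comp (ContinuousLinearMap.inl ℝ _ _))
  change ∀ᶠ v in 𝓝 0, G (v, Ψ v) = G (0, (ξ₂, τ)) at hΨe
  rw [hG0] at hΨe
  refine ⟨fun v => (Ψ v).1, fun v => (Ψ v).2, (ContinuousLinearMap.fst ℝ E ℝ).comp Ψ',
    (ContinuousLinearMap.snd ℝ E ℝ).comp Ψ', hΨs.fst, hΨs.snd, congrArg Prod.fst hΨ0, congrArg Prod.snd hΨ0, ?_, ?_⟩
  · filter_upwards [hΨe] with v hv
    have h1 : (X₁ (ξ₁, v) (Ψ v).2 - X₂ ((Ψ v).1, v) (Ψ v).2, γ (X₁ (ξ₁, v) (Ψ v).2)) =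
      ((0, 0) : E × ℝ) := hv
    rw [Prod.mk.injEq, sub_eq_zero] at h1
    exact h1
  · intro v
    have hpair : HasStrictFDerivAt (fun v => (v, Ψ v))
        ((ContinuousLinearMap.id ℝ (ℝ →ᵇ U)).prod Ψ') 0 := (hasStrictFDerivAt_id _).prodMk hΨs
    have h1 : HasStrictFDerivAt G G' (0, Ψ 0) := by rw [hΨ0]; exact hG
    have h2 := (HasStrictFDerivAt.comp (g := G) 0 h1 hpair).hasFDerivAt
    have h3 : HasFDerivAt (G ∘ fun v => (v, Ψ v)) (0 : (ℝ →ᵇ U) →L[ℝ] E × ℝ) 0 :=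
      (hasFDerivAt_const (0 : E × ℝ) _).congr_of_eventuallyEq hΨe
    have h4 := congrArg (fun L : (ℝ →ᵇ U) →L[ℝ] E × ℝ => L v) (h2.unique h3)
    have h5 : G' (v, ((Ψ' v).1, (Ψ' v).2)) = ((0, 0) : E × ℝ) := h4
    rw [hG'a, Prod.mk.injEq, sub_eq_zero] at h5
    exact h5

end

/-! ### Piecewise continuous controls, local solutions and transversal crossings -/

section
open MeasureTheory BoundedContinuousFunction
open scoped BoundedContinuousFunction

namespace PiecewiseContinuousOn
variable {V : Type*} [NormedAddCommGroup V] [NormedSpace ℝ V] {u w : ℝ → V} {a b : ℝ}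

theorem exists_finite_continuousAt (hu : PiecewiseContinuousOn u a b) :
    ∃ S : Set ℝ, S.Finite ∧ ∀ t ∈ Ioo a b \ S, ContinuousAt u t := by
  obtain ⟨S, hS, hc⟩ := hu.1
  refine ⟨S, hS, fun t ht => hc.continuousAt ?_⟩
  exact inter_mem (Icc_mem_nhds ht.1.1 ht.1.2) (hS.isClosed.isOpen_compl.mem_nhds ht.2)

/-- The one-sided limits bound `u` near each point, and compactness makes the bound global. For
measurability the finite exceptional set is discarded as a null set. -/
theorem bddMeasurableOn (hu : PiecewiseContinuousOn u a b) : BddMeasurableOn u a b := by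
  constructor
  · obtain ⟨S, hS, hc⟩ := hu.1
    have h1 : (Icc a b \ S : Set ℝ) =ᵐ[volume] Icc a b :=
      sdiff_null_ae_eq_self (hS.measure_zero volume)
    rw [← Measure.restrict_congr_set h1]
    exact hc.aestronglyMeasurable (measurableSet_Icc.diff hS.measurableSet)
  · refine isCompact_Icc.induction_on (p := fun s => ∃ C, ∀ t ∈ s, ‖u t‖ ≤ C) ⟨0, by simp⟩
      (fun s t hst ⟨C, hC⟩ => ⟨C, fun r hr => hC r (hst hr)⟩) ?_ ?_
    · rintro s t ⟨C, hC⟩ ⟨D, hD⟩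
      refine ⟨max C D, fun r hr => ?_⟩
      rcases hr with hr | hr
      · exact (hC r hr).trans (le_max_left _ _)
      · exact (hD r hr).trans (le_max_right _ _)
    · intro t ht
      have hbound : ∀ l : V, ∀ f : Filter ℝ, Tendsto u f (𝓝 l) → ∀ᶠ s in f, ‖u s‖ ≤ ‖l‖ + 1 :=
        fun l f h => (h.norm.eventually (gt_mem_nhds (lt_add_one ‖l‖))).mono fun _ => le_of_lt
      have hr : ∃ C, ∀ᶠ s in 𝓝[>] t, s ∈ Icc a b → ‖u s‖ ≤ C := by
        rcases ht.2.lt_or_eq with hlt | heq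
        · obtain ⟨l, hl⟩ := hu.2.1 t ⟨ht.1, hlt⟩
          exact ⟨_, (hbound l _ hl).mono fun s hs _ => hs⟩
        · refine ⟨0, ?_⟩
          filter_upwards [self_mem_nhdsWithin] with s hs hs'
          exact absurd hs'.2 (by rw [← heq]; exact not_le.2 hs)
      have hl : ∃ C, ∀ᶠ s in 𝓝[<] t, s ∈ Icc a b → ‖u s‖ ≤ C := by
        rcases ht.1.lt_or_eq with hlt | heq
        · obtain ⟨l, hl⟩ := hu.2.2 t ⟨hlt, ht.2⟩
          exact ⟨_, (hbound l _ hl).mono fun s hs _ => hs⟩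
        · refine ⟨0, ?_⟩
          filter_upwards [self_mem_nhdsWithin] with s hs hs'
          exact absurd hs'.1 (by rw [heq]; exact not_le.2 hs)
      obtain ⟨C, hC⟩ := hr
      obtain ⟨D, hD⟩ := hl
      refine ⟨_, inter_mem_nhdsWithin (Icc a b) (t := {s | s ∈ Icc a b →
        ‖u s‖ ≤ max (max C D) ‖u t‖}) ?_, max (max C D) ‖u t‖, fun s hs => hs.2 hs.1⟩
      rw [← nhdsNE_sup_pure, ← nhdsLT_sup_nhdsGT]
      refine mem_sup.2 ⟨mem_sup.2 ⟨?_, ?_⟩, ?_⟩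
      · filter_upwards [hD] with s hs hs'
        exact (hs hs').trans ((le_max_right _ _).trans (le_max_left _ _))
      · filter_upwards [hC] with s hs hs'
        exact (hs hs').trans ((le_max_left _ _).trans (le_max_left _ _))
      · exact fun _ => le_max_right _ _

theorem congr_off_finite (hu : PiecewiseContinuousOn u a b) {T : Set ℝ} (hT : T.Finite)
    (h : ∀ t, t ∉ T → w t = u t) : PiecewiseContinuousOn w a b := by
  obtain ⟨⟨S, hS, hc⟩, h1, h2⟩ := hu
  have hev : ∀ t, ∀ᶠ s in 𝓝[≠] t, u s = w s := fun t => by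
    have : (T \ {t})ᶜ ∈ 𝓝 t := (hT.subset sdiff_subset).isClosed.isOpen_compl.mem_nhds (by simp)
    filter_upwards [mem_nhdsWithin_of_mem_nhds this, self_mem_nhdsWithin] with s hs hs'
    exact (h s fun hsT => hs ⟨hsT, hs'⟩).symm
  refine ⟨⟨S ∪ T, hS.union hT, ?_⟩, fun t ht => ?_, fun t ht => ?_⟩
  · refine (hc.mono (sdiff_subset_sdiff_right subset_union_left)).congr fun t ht => ?_
    exact h t fun h' => ht.2 (Or.inr h')
  · obtain ⟨l, hl⟩ := h1 t ht
    exact ⟨l, hl.congr' ((hev t).filter_mono (nhdsWithin_mono _ fun s hs => ne_of_gt hs))⟩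
  · obtain ⟨l, hl⟩ := h2 t ht
    exact ⟨l, hl.congr' ((hev t).filter_mono (nhdsWithin_mono _ fun s hs => ne_of_lt hs))⟩

theorem ite_lt (hu : PiecewiseContinuousOn u a b) (hw : PiecewiseContinuousOn w a b) (σ : ℝ) :
    PiecewiseContinuousOn (fun t => if t < σ then u t else w t) a b := by
  obtain ⟨⟨S, hS, hc⟩, h1, h2⟩ := hu
  obtain ⟨⟨T, hT, hd⟩, k1, k2⟩ := hw
  refine ⟨⟨S ∪ T ∪ {σ}, (hS.union hT).union (finite_singleton σ), fun t ht => ?_⟩,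
    fun t ht => ?_, fun t ht => ?_⟩
  · have hu' := (hc.mono (show Icc a b \ (S ∪ T ∪ {σ}) ⊆ Icc a b \ S from
      sdiff_subset_sdiff_right fun s hs => Or.inl (Or.inl hs))) t ht
    have hw' := (hd.mono (show Icc a b \ (S ∪ T ∪ {σ}) ⊆ Icc a b \ T from
      sdiff_subset_sdiff_right fun s hs => Or.inl (Or.inr hs))) t ht
    have hne : t ≠ σ := fun h => ht.2 (Or.inr h)
    rcases hne.lt_or_gt with hlt | hgt
    · refine hu'.congr_of_eventuallyEq (mem_nhdsWithin_of_mem_nhds ?_) (if_pos hlt)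
      filter_upwards [gt_mem_nhds hlt] with s hs using if_pos hs
    · refine hw'.congr_of_eventuallyEq (mem_nhdsWithin_of_mem_nhds ?_) (if_neg hgt.not_gt)
      filter_upwards [lt_mem_nhds hgt] with s hs using if_neg hs.not_gt
  · rcases lt_or_ge t σ with hlt | hge
    · obtain ⟨l, hl⟩ := h1 t ht
      refine ⟨l, hl.congr' (mem_nhdsWithin_of_mem_nhds ?_)⟩
      filter_upwards [gt_mem_nhds hlt] with s hs using (if_pos hs).symm
    · obtain ⟨l, hl⟩ := k1 t ht
      refine ⟨l, hl.congr' ?_⟩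
      filter_upwards [self_mem_nhdsWithin] with s hs
      exact (if_neg (hge.trans (le_of_lt hs)).not_gt).symm
  · rcases lt_or_ge σ t with hlt | hge
    · obtain ⟨l, hl⟩ := k2 t ht
      refine ⟨l, hl.congr' (mem_nhdsWithin_of_mem_nhds ?_)⟩
      filter_upwards [lt_mem_nhds hlt] with s hs using (if_neg hs.not_gt).symm
    · obtain ⟨l, hl⟩ := h2 t ht
      refine ⟨l, hl.congr' ?_⟩
      filter_upwards [self_mem_nhdsWithin] with s hs
      exact (if_pos (lt_of_lt_of_le hs hge)).symm

theorem ite_le (hu : PiecewiseContinuousOn u a b) (hw : PiecewiseContinuousOn w a b) (σ : ℝ) :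
    PiecewiseContinuousOn (fun t => if t ≤ σ then u t else w t) a b := by
  refine (hu.ite_lt hw σ).congr_off_finite (finite_singleton σ) fun t ht => ?_
  have hne : t ≠ σ := ht
  simp [hne.le_iff_lt]

theorem add_continuous (hu : PiecewiseContinuousOn u a b) (hw : Continuous w) :
    PiecewiseContinuousOn (fun t => u t + w t) a b := by
  obtain ⟨⟨S, hS, hc⟩, h1, h2⟩ := hu
  refine ⟨⟨S, hS, hc.add hw.continuousOn⟩, fun t ht => ?_, fun t ht => ?_⟩
  · obtain ⟨l, hl⟩ := h1 t ht
    exact ⟨_, hl.add (hw.continuousAt.tendsto.mono_left nhdsWithin_le_nhds)⟩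
  · obtain ⟨l, hl⟩ := h2 t ht
    exact ⟨_, hl.add (hw.continuousAt.tendsto.mono_left nhdsWithin_le_nhds)⟩

theorem const (c : V) : PiecewiseContinuousOn (fun _ => c) a b :=
  ⟨⟨∅, finite_empty, continuousOn_const⟩, fun _ _ => ⟨c, tendsto_const_nhds⟩,
    fun _ _ => ⟨c, tendsto_const_nhds⟩⟩

end PiecewiseContinuousOn

variable {E U : Type*} [NormedAddCommGroup E] [NormedSpace ℝ E] [FiniteDimensional ℝ E]
  [NormedAddCommGroup U] [NormedSpace ℝ U] [FiniteDimensional ℝ U]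
  {F : (E × U) × ℝ → E} {F' : (E × U) × ℝ → E × U →L[ℝ] E} {u : ℝ → U} {α β a : ℝ}

/-- Local existence of trajectories for a constant control. -/
theorem IsC1Field.exists_local_solution (hF : IsC1Field F F') (y₀ : E) (w : U) (τ : ℝ) :
    ∃ ε > 0, ∃ y : ℝ → E, ContinuousOn y (Icc (τ - ε) (τ + ε)) ∧
      ∀ t ∈ Icc (τ - ε) (τ + ε), y t = y₀ + ∫ s in τ..t, F ((y s, w), s) := by
  have : CompleteSpace E := FiniteDimensional.complete ℝ E
  obtain ⟨C, hC, hev⟩ : ∃ C > 0, ∀ᶠ q in 𝓝 (((y₀, w), τ) : (E × U) × ℝ),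
      ‖F q‖ ≤ C ∧ ‖F' q‖ ≤ C := by
    refine ⟨max ‖F ((y₀, w), τ)‖ ‖F' ((y₀, w), τ)‖ + 1, by positivity, ?_⟩
    refine (hF.cont.norm.continuousAt.eventually (ge_mem_nhds ?_)).and
      (hF.cont'.norm.continuousAt.eventually (ge_mem_nhds ?_))
    · exact lt_of_le_of_lt (le_max_left _ _) (lt_add_one _)
    · exact lt_of_le_of_lt (le_max_right _ _) (lt_add_one _)
  obtain ⟨δ, hδ, hball⟩ := Metric.eventually_nhds_iff.1 hev
  have hin : ∀ y ∈ Metric.closedBall y₀ (δ / 2), ∀ t ∈ Icc (τ - δ / 2) (τ + δ / 2),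
      dist (((y, w), t) : (E × U) × ℝ) ((y₀, w), τ) < δ := by
    intro y hy t ht
    rw [Prod.dist_eq, Prod.dist_eq, dist_self]
    have h1 : dist y y₀ ≤ δ / 2 := hy
    have h2 : dist t τ ≤ δ / 2 := by
      rw [Real.dist_eq, abs_le]; constructor <;> linarith [ht.1, ht.2]
    exact lt_of_le_of_lt (max_le (max_le h1 (by positivity)) h2) (by linarith)
  -- The first bound keeps time within the region where `F` and `F'` are at most `C`. The second
  -- gives `C * ε ≤ δ / 2`, so the solution cannot leave the ball of radius `δ / 2`.
  set ε := min (δ / 2) (δ / 2 / C)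
  have hε : 0 < ε := by positivity
  have hεC : C * ε ≤ δ / 2 := by
    calc C * ε ≤ C * (δ / 2 / C) := mul_le_mul_of_nonneg_left (min_le_right _ _) hC.le
      _ = δ / 2 := by field_simp
  have hsub : Icc (τ - ε) (τ + ε) ⊆ Icc (τ - δ / 2) (τ + δ / 2) := by
    have : ε ≤ δ / 2 := min_le_left _ _
    exact Icc_subset_Icc (by linarith) (by linarith)
  have hτ : τ ∈ Icc (τ - ε) (τ + ε) := ⟨by linarith, by linarith⟩
  have hPL : IsPicardLindelof (fun t y => F ((y, w), t)) (tmin := τ - ε) (tmax := τ + ε) ⟨τ, hτ⟩ y₀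
      (δ / 2).toNNReal 0 C.toNNReal C.toNNReal := by
    rw [← Real.coe_toNNReal (δ / 2) (by positivity)] at hin hεC hsub
    refine ⟨fun t ht => ?_, fun y _ => ?_, fun t ht y hy => ?_, ?_⟩
    · refine (convex_closedBall y₀ _).lipschitzOnWith_of_nnnorm_hasFDerivWithin_le
        (f' := fun y => (F' ((y, w), t)).comp (.inl ℝ E U)) (fun y hy => ?_) (fun y hy => ?_)
      · have h1 : HasFDerivAt (fun y : E => (y, w)) (.inl ℝ E U) y := hasFDerivAt_prodMk_left y w
        exact (HasFDerivAt.comp (g := fun z => F (z, t)) y (hF.hasFDerivAt (y, w) t)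
          h1).hasFDerivWithinAt
      · rw [← NNReal.coe_le_coe, coe_nnnorm, Real.coe_toNNReal _ hC.le]
        refine (ContinuousLinearMap.opNorm_comp_le _ _).trans ?_
        have h1 := (hball (hin y hy t (hsub ht))).2
        have h2 := ContinuousLinearMap.norm_inl_le_one ℝ E U
        calc ‖F' ((y, w), t)‖ * ‖ContinuousLinearMap.inl ℝ E U‖ ≤ C * 1 :=
              mul_le_mul h1 h2 (norm_nonneg _) hC.le
          _ = C := mul_one C
    · have := hF.cont
      fun_prop
    · rw [Real.coe_toNNReal _ hC.le]
      exact (hball (hin y hy t (hsub ht))).1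
    · have : max (τ + ε - τ) (τ - (τ - ε)) = ε := by simp
      simp only [NNReal.coe_zero, sub_zero]
      rw [this, Real.coe_toNNReal _ hC.le]
      exact hεC
  obtain ⟨y, hy, hyc⟩ := hPL.exists_eq_forall_mem_Icc_hasDerivWithinAt₀
  refine ⟨ε, hε, y, fun t ht => (hyc t ht).continuousWithinAt, fun t ht => ?_⟩
  have hycont : ContinuousOn y (Icc (τ - ε) (τ + ε)) := fun t ht => (hyc t ht).continuousWithinAt
  have hsub' : uIcc τ t ⊆ Icc (τ - ε) (τ + ε) := uIcc_subset_Icc hτ ht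
  have hFc : ContinuousOn (fun s => F ((y s, w), s)) (Icc (τ - ε) (τ + ε)) :=
    hF.cont.comp_continuousOn ((hycont.prodMk continuousOn_const).prodMk continuousOn_id)
  have h1 := intervalIntegral.integral_eq_sub_of_hasDeriv_right (f := y)
    (f' := fun s => F ((y s, w), s)) (a := τ) (b := t) (hycont.mono hsub') (fun s hs => ?_)
    (hFc.mono hsub').intervalIntegrable
  · rw [h1, hy]; abel
  · have hs' : s ∈ Ioo (τ - ε) (τ + ε) := by
      refine ⟨lt_of_le_of_lt ?_ hs.1, lt_of_lt_of_le hs.2 ?_⟩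
      · exact le_min hτ.1 ht.1
      · exact max_le hτ.2 ht.2
    exact ((hyc s (Ioo_subset_Icc_self hs')).hasDerivAt
      (Icc_mem_nhds hs'.1 hs'.2)).hasDerivWithinAt

/-- Freezing `y` at its endpoint values outside `[α, β]` turns a solution on the interval into a
point of the function space in which `IsC1Field.exists_isFlowNear` works. -/
theorem IsC1Field.exists_boundedContinuous_solution (hF : IsC1Field F F') (ha : a ∈ Icc α β)
    (hu : BddMeasurableOn u α β) {y : ℝ → E} (hyc : ContinuousOn y (Icc α β)) {ξ : E}
    (hy : ∀ t ∈ Icc α β, y t = ξ + ∫ s in a..t, F ((y s, u s), s)) :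
    ∃ x : ℝ →ᵇ E, (∀ t ∈ Icc α β, x t = y t) ∧
      ∀ t, x t = ξ + ∫ s in a..clampTo α β t, F ((x s, u s), s) := by
  have hαβ : α ≤ β := ha.1.trans ha.2
  obtain ⟨H, hH⟩ := exists_boundedContinuous_primitive ha
    ((BddMeasurableOn.of_continuousOn hyc).comp_continuous hF.cont hu).integrableOn
  have hxy : ∀ t, (BoundedContinuousFunction.const ℝ ξ + H) t = y (clampTo α β t) := fun t => by
    rw [hy _ (clampTo_mem hαβ t), ← hH]; rfl
  refine ⟨BoundedContinuousFunction.const ℝ ξ + H, fun t ht => ?_, fun t => ?_⟩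
  · rw [hxy, clampTo_of_mem ht]
  · rw [hxy, hy _ (clampTo_mem hαβ t)]
    congr 1
    refine intervalIntegral.integral_congr fun s hs => ?_
    have hs' := uIcc_subset_Icc ha (clampTo_mem hαβ t) hs
    simp only [hxy, clampTo_of_mem hs']

/-- Mapping the compact `K` into an open set is an open condition in the compact-open topology,
which is coarser than uniform convergence. -/
theorem eventually_forall_mem_lt_zero {x : ℝ →ᵇ E} {γ : E → ℝ} (hγ : Continuous γ) {K : Set ℝ}
    (hK : IsCompact K) (h : ∀ t ∈ K, γ (x t) < 0) :
    ∀ᶠ y in 𝓝 x, ∀ t ∈ K, γ (y t) < 0 := by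
  have h1 := ContinuousMap.eventually_mapsTo (f := x.toContinuousMap) hK
    (isOpen_Iio.preimage hγ) (U := γ ⁻¹' Iio 0) (fun t ht => h t ht)
  have h2 : Continuous (fun y : ℝ →ᵇ E => y.toContinuousMap) :=
    ContinuousMap.continuous_of_continuous_uncurry _ (continuous_eval (F := ℝ →ᵇ E))
  exact h2.continuousAt.eventually h1

/-- Trajectories near one that crosses the level sets of `γ` transversally at `τ` cross them
monotonically near `τ`. -/
theorem IsFlowNear.exists_strictMonoOn {X : E × (ℝ →ᵇ U) → (ℝ →ᵇ E)}
    {X' : E × (ℝ →ᵇ U) →L[ℝ] (ℝ →ᵇ E)} {ξ₀ : E} {τ : ℝ} (hF : IsC1Field F F') (ha : a ∈ Icc α β)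
    (hu : BddMeasurableOn u α β) (hX : IsFlowNear F F' u α β a ξ₀ X X') (hτ : τ ∈ Ioo α β)
    (huτ : ∀ᶠ t in 𝓝 τ, ContinuousAt u t) {γ : E → ℝ} (hγ : ContDiff ℝ 1 γ)
    (hpos : 0 < fderiv ℝ γ (X (ξ₀, 0) τ) (F ((X (ξ₀, 0) τ, u τ), τ))) :
    ∃ η > 0, ∀ᶠ p in 𝓝 ((ξ₀, 0) : E × (ℝ →ᵇ U)),
      StrictMonoOn (fun t => γ (X p t)) (Ioo (τ - η) (τ + η)) := by
  have : CompleteSpace E := FiniteDimensional.complete ℝ E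
  have hXc : ContinuousAt X (ξ₀, 0) := hX.strict.continuousAt
  have hev : ContinuousAt (fun w : (E × (ℝ →ᵇ U)) × ℝ => X w.1 w.2) ((ξ₀, 0), τ) :=
    ContinuousAt.comp (g := fun q : (ℝ →ᵇ E) × ℝ => q.1 q.2)
      (f := fun w : (E × (ℝ →ᵇ U)) × ℝ => (X w.1, w.2)) continuous_eval.continuousAt
      (ContinuousAt.prodMk (ContinuousAt.comp (g := X) (f := Prod.fst) hXc continuousAt_fst)
        continuousAt_snd)
  have hcont : ContinuousAt (fun w : (E × (ℝ →ᵇ U)) × ℝ =>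
      fderiv ℝ γ (X w.1 w.2) (F ((X w.1 w.2, u w.2 + w.1.2 w.2), w.2))) ((ξ₀, 0), τ) := by
    refine ContinuousAt.clm_apply ?_ ?_
    · exact (hγ.continuous_fderiv one_ne_zero).continuousAt.comp hev
    · refine hF.cont.continuousAt.comp ((hev.prodMk (ContinuousAt.add ?_ ?_)).prodMk
        continuousAt_snd)
      · exact ContinuousAt.comp (x := (((ξ₀, 0), τ) : (E × (ℝ →ᵇ U)) × ℝ)) (f := fun w => w.2)
          huτ.self_of_nhds continuousAt_snd
      · exact (continuous_eval (F := ℝ →ᵇ U)).continuousAt.comp (x := (((ξ₀, 0), τ) :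
          (E × (ℝ →ᵇ U)) × ℝ)) (f := fun w => (w.1.2, w.2)) (by fun_prop)
  have hpos' : ∀ᶠ w in 𝓝 (((ξ₀, 0), τ) : (E × (ℝ →ᵇ U)) × ℝ),
      0 < fderiv ℝ γ (X w.1 w.2) (F ((X w.1 w.2, u w.2 + w.1.2 w.2), w.2)) := by
    refine hcont.eventually (lt_mem_nhds ?_)
    simpa using hpos
  -- A product neighbourhood on which the speed of `γ` is positive provides one window `η` that
  -- serves all nearby parameters.
  rw [nhds_prod_eq] at hpos'
  obtain ⟨P₁, hP₁, P₂, hP₂, hP⟩ := eventually_prod_iff.1 hpos'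
  obtain ⟨η, hη, hball⟩ := Metric.eventually_nhds_iff.1
    (hP₂.and (huτ.and (Ioo_mem_nhds hτ.1 hτ.2)))
  refine ⟨η, hη, ?_⟩
  filter_upwards [hP₁, hX.eventually_eq] with p hp heq
  have hd : ∀ t ∈ Ioo (τ - η) (τ + η), HasDerivAt (fun t => γ (X p t))
      (fderiv ℝ γ (X p t) (F ((X p t, u t + p.2 t), t))) t := by
    intro t ht
    obtain ⟨-, hut, htm⟩ := hball (y := t) (by rwa [← Metric.mem_ball, Real.ball_eq_Ioo])
    have h1 := hasDerivAt_of_eq_add_integral (hF.bddMeasurableOn_comp hu (X p) p.2).integrableOn ha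
      (y := X p) (c := p.1) (fun s hs => by rw [heq s, clampTo_of_mem hs]) htm
      (hF.cont.continuousAt.comp (((X p).continuous.continuousAt.prodMk
        (hut.add p.2.continuous.continuousAt)).prodMk continuousAt_id))
    exact HasFDerivAt.comp_hasDerivAt t (hγ.differentiable one_ne_zero _).hasFDerivAt h1
  refine strictMonoOn_of_deriv_pos (convex_Ioo _ _)
    (fun t ht => (hd t ht).continuousAt.continuousWithinAt) fun t ht => ?_
  rw [interior_Ioo] at ht
  rw [(hd t ht).deriv]
  exact hP hp (hball (y := t) (by rwa [← Metric.mem_ball, Real.ball_eq_Ioo])).1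

/-- The slopes from the left are nonnegative. With the non-tangency assumption this gives the
crossing speed its strict sign. -/
theorem HasDerivAt.nonneg_of_lt_before {φ : ℝ → ℝ} {d a τ : ℝ} (hd : HasDerivAt φ d τ)
    (haτ : a < τ) (h : ∀ t ∈ Ico a τ, φ t ≤ φ τ) : 0 ≤ d := by
  have h1 := (hasDerivAt_iff_tendsto_slope.1 hd).mono_left
    (nhdsWithin_mono τ (show Iio τ ⊆ {τ}ᶜ from fun s hs => ne_of_lt hs))
  refine ge_of_tendsto h1 ?_
  filter_upwards [Ioo_mem_nhdsLT haτ] with t ht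
  rw [slope_def_field]
  exact div_nonneg_of_nonpos (sub_nonpos.2 (h t ⟨ht.1.le, ht.2⟩)) (sub_nonpos.2 ht.2.le)

theorem HasDerivAt.nonneg_of_lt_after {φ : ℝ → ℝ} {d b τ : ℝ} (hd : HasDerivAt φ d τ)
    (hτb : τ < b) (h : ∀ t ∈ Ioc τ b, φ τ ≤ φ t) : 0 ≤ d := by
  have h1 := (hasDerivAt_iff_tendsto_slope.1 hd).mono_left
    (nhdsWithin_mono τ (show Ioi τ ⊆ {τ}ᶜ from fun s hs => ne_of_gt hs))
  refine ge_of_tendsto h1 ?_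
  filter_upwards [Ioo_mem_nhdsGT hτb] with t ht
  rw [slope_def_field]
  exact div_nonneg (sub_nonneg.2 (h t ⟨ht.1, ht.2.le⟩)) (sub_nonneg.2 ht.1.le)

end

/-! ### Continued trajectories, accumulated cost and admissible pairs -/

section
open MeasureTheory BoundedContinuousFunction
open scoped BoundedContinuousFunction

section extension
variable {E U : Type*} [NormedAddCommGroup E] [NormedSpace ℝ E] [FiniteDimensional ℝ E]
  [NormedAddCommGroup U] [NormedSpace ℝ U] [FiniteDimensional ℝ U]
  {F : (E × U) × ℝ → E} {F' : (E × U) × ℝ → E × U →L[ℝ] E} {u : ℝ → U}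

/-- Continuation of a trajectory on `[a, τ]` beyond `τ`, with a constant control. -/
theorem IsC1Field.exists_extension_right (hF : IsC1Field F F') {a τ ε₀ : ℝ} (haτ : a ≤ τ)
    (hε₀ : 0 < ε₀) (w : U) (hu : BddMeasurableOn (fun t => if t < τ then u t else w) a (τ + ε₀))
    {Z : ℝ → E} {ξ : E} (hZc : ContinuousOn Z (Icc a τ))
    (hZ : ∀ t ∈ Icc a τ, Z t = ξ + ∫ s in a..t, F ((Z s, u s), s)) :
    ∃ ε, 0 < ε ∧ ε ≤ ε₀ ∧ ∃ x : ℝ →ᵇ E,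
      (∀ t, x t = ξ + ∫ s in a..clampTo a (τ + ε) t,
        F ((x s, if s < τ then u s else w), s)) ∧ ∀ t ∈ Icc a τ, x t = Z t := by
  obtain ⟨ε₁, hε₁, Y, hYc, hY⟩ := hF.exists_local_solution (Z τ) w τ
  set ε := min ε₁ ε₀
  have hε : 0 < ε := lt_min hε₁ hε₀
  have hle : ε ≤ ε₀ := min_le_right _ _
  have hle₁ : ε ≤ ε₁ := min_le_left _ _
  have hsub : Icc τ (τ + ε) ⊆ Icc (τ - ε₁) (τ + ε₁) :=
    Icc_subset_Icc (by linarith) (by linarith)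
  have hYτ : Y τ = Z τ := by
    simpa using hY τ ⟨by linarith, by linarith⟩
  have hu' : BddMeasurableOn (fun t => if t < τ then u t else w) a (τ + ε) :=
    hu.mono (Icc_subset_Icc_right (by linarith))
  classical
  let y : ℝ → E := fun t => if t ≤ τ then Z t else Y t
  have hyZ : ∀ t ≤ τ, y t = Z t := fun t ht => if_pos ht
  have hyY : ∀ t, τ ≤ t → y t = Y t := fun t ht => by
    rcases ht.eq_or_lt with rfl | hlt
    · rw [hyZ _ le_rfl, hYτ]
    · exact if_neg hlt.not_ge
  have hyc : ContinuousOn y (Icc a (τ + ε)) := by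
    rw [← Icc_union_Icc_eq_Icc haτ (by linarith : τ ≤ τ + ε)]
    refine ContinuousOn.union_of_isClosed ?_ ?_ isClosed_Icc isClosed_Icc
    · exact hZc.congr fun t ht => hyZ t ht.2
    · exact (hYc.mono hsub).congr fun t ht => hyY t ht.1
  have ha : a ∈ Icc a (τ + ε) := ⟨le_rfl, by linarith⟩
  have hτm : τ ∈ Icc a (τ + ε) := ⟨haτ, by linarith⟩
  have hint := ((BddMeasurableOn.of_continuousOn hyc).comp_continuous hF.cont hu').integrableOn
  have h1 : ∀ t ∈ Icc a τ, y t = ξ + ∫ s in a..t, F ((y s, if s < τ then u s else w), s) := by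
    intro t ht
    rw [hyZ t ht.2, hZ t ht]
    congr 1
    refine intervalIntegral.integral_congr_ae ?_
    filter_upwards [compl_mem_ae_iff.2 (measure_singleton (μ := volume) τ)] with s hs hs'
    rw [uIoc_of_le ht.1] at hs'
    have hlt : s < τ := lt_of_le_of_ne (hs'.2.trans ht.2) hs
    rw [hyZ s hlt.le, if_pos hlt]
  obtain ⟨x, hxy, hx⟩ := hF.exists_boundedContinuous_solution ha hu' hyc (ξ := ξ) (fun t ht => by
    rcases le_total t τ with hle | hge
    · exact h1 t ⟨ht.1, hle⟩
    · rw [hyY t hge, hY t (hsub ⟨hge, ht.2⟩), ← hyZ τ le_rfl, h1 τ ⟨haτ, le_rfl⟩,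
        ← intervalIntegral.integral_add_adjacent_intervals
          (hint.intervalIntegrable_of_mem_Icc ha hτm) (hint.intervalIntegrable_of_mem_Icc hτm ht),
        add_assoc]
      congr 2
      refine intervalIntegral.integral_congr fun s hs => ?_
      rw [uIcc_of_le hge] at hs
      simp only [hyY s hs.1, if_neg hs.1.not_gt])
  exact ⟨ε, hε, hle, x, hx, fun t ht => by
    rw [hxy t ⟨ht.1, by linarith [ht.2]⟩, hyZ t ht.2]⟩

/-- Continuation of a trajectory on `[τ, b]` to times before `τ`, with a constant control. -/
theorem IsC1Field.exists_extension_left (hF : IsC1Field F F') {b τ ε₀ : ℝ} (hτb : τ ≤ b)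
    (hε₀ : 0 < ε₀) (w : U) (hu : BddMeasurableOn (fun t => if t ≤ τ then w else u t) (τ - ε₀) b)
    {Z : ℝ → E} {ξ : E} (hZc : ContinuousOn Z (Icc τ b))
    (hZ : ∀ t ∈ Icc τ b, Z t = ξ + ∫ s in τ..t, F ((Z s, u s), s)) :
    ∃ ε, 0 < ε ∧ ε ≤ ε₀ ∧ ∃ x : ℝ →ᵇ E,
      (∀ t, x t = ξ + ∫ s in τ..clampTo (τ - ε) b t,
        F ((x s, if s ≤ τ then w else u s), s)) ∧ ∀ t ∈ Icc τ b, x t = Z t := by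
  obtain ⟨ε₁, hε₁, Y, hYc, hY⟩ := hF.exists_local_solution ξ w τ
  set ε := min ε₁ ε₀
  have hε : 0 < ε := lt_min hε₁ hε₀
  have hle : ε ≤ ε₀ := min_le_right _ _
  have hle₁ : ε ≤ ε₁ := min_le_left _ _
  have hsub : Icc (τ - ε) τ ⊆ Icc (τ - ε₁) (τ + ε₁) :=
    Icc_subset_Icc (by linarith) (by linarith)
  have hYτ : Y τ = ξ := by
    simpa using hY τ ⟨by linarith, by linarith⟩
  have hZτ : Z τ = ξ := by
    simpa using hZ τ ⟨le_rfl, hτb⟩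
  have hu' : BddMeasurableOn (fun t => if t ≤ τ then w else u t) (τ - ε) b :=
    hu.mono (Icc_subset_Icc_left (by linarith))
  classical
  let y : ℝ → E := fun t => if t ≤ τ then Y t else Z t
  have hyY : ∀ t ≤ τ, y t = Y t := fun t ht => if_pos ht
  have hyZ : ∀ t, τ ≤ t → y t = Z t := fun t ht => by
    rcases ht.eq_or_lt with rfl | hlt
    · rw [hyY _ le_rfl, hYτ, hZτ]
    · exact if_neg hlt.not_ge
  have hyc : ContinuousOn y (Icc (τ - ε) b) := by
    rw [← Icc_union_Icc_eq_Icc (by linarith : τ - ε ≤ τ) hτb]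
    refine ContinuousOn.union_of_isClosed ?_ ?_ isClosed_Icc isClosed_Icc
    · exact (hYc.mono hsub).congr fun t ht => hyY t ht.2
    · exact hZc.congr fun t ht => hyZ t ht.1
  have hτm : τ ∈ Icc (τ - ε) b := ⟨by linarith, hτb⟩
  obtain ⟨x, hxy, hx⟩ := hF.exists_boundedContinuous_solution hτm hu' hyc (ξ := ξ) (fun t ht => by
    rcases le_total t τ with hle | hge
    · rw [hyY t hle, hY t (hsub ⟨ht.1, hle⟩)]
      congr 1
      refine intervalIntegral.integral_congr fun s hs => ?_
      rw [uIcc_of_ge hle] at hs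
      simp only [hyY s hs.2, if_pos hs.2]
    · rw [hyZ t hge, hZ t ⟨hge, ht.2⟩]
      congr 1
      refine intervalIntegral.integral_congr_ae (Eventually.of_forall fun s hs => ?_)
      rw [uIoc_of_le hge] at hs
      rw [hyZ s hs.1.le, if_neg hs.1.not_ge])
  exact ⟨ε, hε, hle, x, hx, fun t ht => by
    rw [hxy t ⟨by linarith [ht.1], ht.2⟩, hyZ t ht.1]⟩

/-- Turns the differential equation, which may fail where the control jumps, into an integral
equation. Continuity of `x` makes the finite exceptional set harmless in the fundamental theorem of
calculus. -/
theorem eq_add_integral_of_hasDerivAt_off_finite {a b : ℝ} {h x : ℝ → E}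
    (hxc : ContinuousOn x (Icc a b)) (hh : IntegrableOn h (Icc a b)) {S : Set ℝ} (hS : S.Finite)
    (hd : ∀ t ∈ Ioo a b \ S, HasDerivAt x (h t) t) {t : ℝ} (ht : t ∈ Icc a b) :
    x t = x a + ∫ s in a..t, h s := by
  have : CompleteSpace E := FiniteDimensional.complete ℝ E
  have h1 := integral_eq_of_hasDerivAt_off_countable_of_le x h ht.1 hS.countable
    (hxc.mono (Icc_subset_Icc_right ht.2)) (fun s hs => hd s ⟨⟨hs.1.1, hs.1.2.trans_le ht.2⟩, hs.2⟩)
    (hh.intervalIntegrable_of_mem_Icc ⟨le_rfl, ht.1.trans ht.2⟩ ht)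
  rw [h1]; abel

end extension

section augmented
variable {X U : Type*} [NormedAddCommGroup X] [NormedSpace ℝ X]
  [NormedAddCommGroup U] [NormedSpace ℝ U]

/-- The dynamics of the state together with the accumulated cost. -/
def augmentedField (f : X → U → ℝ → X) (L : X → U → ℝ → ℝ) (q : ((X × ℝ) × U) × ℝ) : X × ℝ :=
  (f q.1.1.1 q.1.2 q.2, L q.1.1.1 q.1.2 q.2)

/-- The derivative of `augmentedField f L` with respect to state, cost and control. -/
noncomputable def augmentedDeriv (f : X → U → ℝ → X) (L : X → U → ℝ → ℝ)
    (q : ((X × ℝ) × U) × ℝ) : (X × ℝ) × U →L[ℝ] X × ℝ :=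
  ((fderiv ℝ (fun z : X × U => f z.1 z.2 q.2) (q.1.1.1, q.1.2)).prod
    (fderiv ℝ (fun z : X × U => L z.1 z.2 q.2) (q.1.1.1, q.1.2))).comp
      ((ContinuousLinearMap.fst ℝ X ℝ).prodMap (.id ℝ U))

end augmented

theorem isC1Field_augmentedField {n m : ℕ}
    {f : EuclideanSpace ℝ (Fin n) → EuclideanSpace ℝ (Fin m) → ℝ → EuclideanSpace ℝ (Fin n)}
    {L : EuclideanSpace ℝ (Fin n) → EuclideanSpace ℝ (Fin m) → ℝ → ℝ}
    (hf : IsC1InStateControl f) (hL : IsC1InStateControl L) :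
    IsC1Field (augmentedField f L) (augmentedDeriv f L) := by
  have hπ : Continuous fun q : ((EuclideanSpace ℝ (Fin n) × ℝ) × EuclideanSpace ℝ (Fin m)) × ℝ =>
      ((q.1.1.1, q.1.2), q.2) := by fun_prop
  refine ⟨(hf.1.comp hπ).prodMk (hL.1.comp hπ), ?_, fun z t => ?_⟩
  · have h1 := hf.2.2.comp hπ
    have h2 := hL.2.2.comp hπ
    have h3 : Continuous fun q : ((EuclideanSpace ℝ (Fin n) × ℝ) × EuclideanSpace ℝ (Fin m)) × ℝ =>
      (fderiv ℝ (fun z : EuclideanSpace ℝ (Fin n) × EuclideanSpace ℝ (Fin m) => f z.1 z.2 q.2)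
        (q.1.1.1, q.1.2)).prod
      (fderiv ℝ (fun z : EuclideanSpace ℝ (Fin n) × EuclideanSpace ℝ (Fin m) => L z.1 z.2 q.2)
        (q.1.1.1, q.1.2)) :=
      (ContinuousLinearMap.prodₗᵢ ℝ).continuous.comp (h1.prodMk h2)
    exact h3.clm_comp continuous_const
  · have h1 : HasFDerivAt (fun z : (EuclideanSpace ℝ (Fin n) × ℝ) × EuclideanSpace ℝ (Fin m) =>
        (z.1.1, z.2)) ((ContinuousLinearMap.fst ℝ (EuclideanSpace ℝ (Fin n)) ℝ).prodMap
        (.id ℝ (EuclideanSpace ℝ (Fin m)))) z :=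
      ((ContinuousLinearMap.fst ℝ (EuclideanSpace ℝ (Fin n)) ℝ).prodMap
        (.id ℝ (EuclideanSpace ℝ (Fin m)))).hasFDerivAt
    exact HasFDerivAt.comp (g := fun w : EuclideanSpace ℝ (Fin n) × EuclideanSpace ℝ (Fin m) =>
      (f w.1 w.2 t, L w.1 w.2 t)) z
      (((hf.2.1 t) (z.1.1, z.2)).hasFDerivAt.prodMk ((hL.2.1 t) (z.1.1, z.2)).hasFDerivAt) h1

theorem intervalIntegral_snd_of_eqOn {X : Type*} [NormedAddCommGroup X] [NormedSpace ℝ X]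
    [CompleteSpace X] {a b : ℝ} (hab : a ≤ b) {h : ℝ → ℝ} {H : ℝ → X × ℝ}
    (hH : IntegrableOn H (Icc a b)) (heq : ∀ s ∈ Ioo a b, h s = (H s).2) :
    IntervalIntegrable h volume a b ∧ ∫ s in a..b, h s = (∫ s in a..b, H s).2 := by
  have hHi := hH.intervalIntegrable_of_mem_Icc ⟨le_rfl, hab⟩ ⟨hab, le_rfl⟩
  have h2 : IntervalIntegrable (fun s => (H s).2) volume a b :=
    ⟨hHi.1.snd, hHi.2.snd⟩
  have hae : ∀ᵐ s ∂volume, s ∈ uIoc a b → h s = (H s).2 := by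
    filter_upwards [compl_mem_ae_iff.2 (measure_singleton (μ := volume) b)] with s hs hs'
    rw [uIoc_of_le hab] at hs'
    exact heq s ⟨hs'.1, lt_of_le_of_ne hs'.2 hs⟩
  constructor
  · exact h2.congr_ae ((ae_restrict_iff' measurableSet_uIoc).2
      (hae.mono fun s hs hs' => (hs hs').symm))
  · rw [intervalIntegral.integral_congr_ae hae]
    exact (ContinuousLinearMap.snd ℝ X ℝ).intervalIntegral_comp_comm hHi

namespace SwitchedProblem
variable {n m : ℕ} {P : SwitchedProblem n m}

/-- The dynamics of the first mode, with the accumulated cost. -/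
def F₁ (P : SwitchedProblem n m) :
    ((EuclideanSpace ℝ (Fin n) × ℝ) × EuclideanSpace ℝ (Fin m)) × ℝ →
      EuclideanSpace ℝ (Fin n) × ℝ := augmentedField P.f₁ P.L₁

/-- The dynamics of the second mode, with the accumulated cost. -/
def F₂ (P : SwitchedProblem n m) :
    ((EuclideanSpace ℝ (Fin n) × ℝ) × EuclideanSpace ℝ (Fin m)) × ℝ →
      EuclideanSpace ℝ (Fin n) × ℝ := augmentedField P.f₂ P.L₂

theorem Regular.isC1Field₁ (hP : P.Regular) : IsC1Field P.F₁ (augmentedDeriv P.f₁ P.L₁) :=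
  isC1Field_augmentedField hP.f₁ hP.L₁

theorem Regular.isC1Field₂ (hP : P.Regular) : IsC1Field P.F₂ (augmentedDeriv P.f₂ P.L₂) :=
  isC1Field_augmentedField hP.f₂ hP.L₂

/-- The sign of `g` selects the mode on either side of the crossing, and the endpoints are
negligible. Hence the stage cost is integrated by the cost coordinates of the two augmented fields.
-/
theorem CrossesOnceAt.integral_L_eq {y : ℝ → EuclideanSpace ℝ (Fin n)}
    {w w₁ w₂ : ℝ → EuclideanSpace ℝ (Fin m)} {σ : ℝ} (hσ : P.CrossesOnceAt y σ)
    {Y₁ Y₂ : ℝ → EuclideanSpace ℝ (Fin n) × ℝ}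
    (hI₁ : IntegrableOn (fun s => P.F₁ ((Y₁ s, w₁ s), s)) (Icc P.t₀ σ))
    (hI₂ : IntegrableOn (fun s => P.F₂ ((Y₂ s, w₂ s), s)) (Icc σ P.t_f))
    (h₁ : ∀ s ∈ Ioo P.t₀ σ, (Y₁ s).1 = y s ∧ w₁ s = w s)
    (h₂ : ∀ s ∈ Ioo σ P.t_f, (Y₂ s).1 = y s ∧ w₂ s = w s) :
    ∫ s in P.t₀..P.t_f, P.L (y s) (w s) s =
      (∫ s in P.t₀..σ, P.F₁ ((Y₁ s, w₁ s), s)).2 + (∫ s in σ..P.t_f, P.F₂ ((Y₂ s, w₂ s), s)).2 := by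
  obtain ⟨i₁, e₁⟩ := intervalIntegral_snd_of_eqOn (h := fun s => P.L (y s) (w s) s)
    hσ.mem.1.le hI₁ (fun s hs => by
      rw [L, if_pos (hσ.before s ⟨hs.1.le, hs.2⟩).le, ← (h₁ s hs).1, ← (h₁ s hs).2]; rfl)
  obtain ⟨i₂, e₂⟩ := intervalIntegral_snd_of_eqOn (h := fun s => P.L (y s) (w s) s)
    hσ.mem.2.le hI₂ (fun s hs => by
      rw [L, if_neg (hσ.after s ⟨hs.1, hs.2.le⟩).not_ge, ← (h₂ s hs).1, ← (h₂ s hs).2]; rfl)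
  rw [← intervalIntegral.integral_add_adjacent_intervals i₁ i₂, e₁, e₂]

/-- Two solutions of the equations of the two modes which meet on the interface form an admissible
pair. -/
theorem exists_admissible_of_phases (hP : P.Regular) {w₁ w₂ : ℝ → EuclideanSpace ℝ (Fin m)}
    (hw₁ : PiecewiseContinuousOn w₁ P.t₀ P.t_f) (hw₂ : PiecewiseContinuousOn w₂ P.t₀ P.t_f)
    {σ α β a : ℝ} (hσ : σ ∈ Ioo P.t₀ P.t_f) (hσβ : σ < β) (hασ : α < σ) (hβ : β ≤ P.t_f)
    (hα : P.t₀ ≤ α) (ha : a ∈ Icc α P.t_f) {Y₁ Y₂ : ℝ → EuclideanSpace ℝ (Fin n) × ℝ}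
    (hc₁ : Continuous Y₁) (hc₂ : Continuous Y₂) {c : EuclideanSpace ℝ (Fin n) × ℝ}
    (h₁ : ∀ t ∈ Icc P.t₀ β, Y₁ t = (P.x₀, 0) + ∫ s in P.t₀..t, P.F₁ ((Y₁ s, w₁ s), s))
    (h₂ : ∀ t ∈ Icc α P.t_f, Y₂ t = c + ∫ s in a..t, P.F₂ ((Y₂ s, w₂ s), s))
    (hmatch : Y₁ σ = Y₂ σ) (hneg : ∀ t ∈ Ico P.t₀ σ, P.g (Y₁ t).1 < 0) (hzero : P.g (Y₁ σ).1 = 0)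
    (hpos : ∀ t ∈ Ioc σ P.t_f, 0 < P.g (Y₂ t).1) :
    ∃ y w, P.Admissible y w ∧ y P.t_f = (Y₂ P.t_f).1 ∧
      P.J y w = P.φ (Y₂ P.t_f).1 + (Y₂ P.t_f).2 := by
  classical
  have hF₁ := hP.isC1Field₁
  have hF₂ := hP.isC1Field₂
  let y : ℝ → EuclideanSpace ℝ (Fin n) := fun t => if t ≤ σ then (Y₁ t).1 else (Y₂ t).1
  let w : ℝ → EuclideanSpace ℝ (Fin m) := fun t => if t ≤ σ then w₁ t else w₂ t
  have hy₁ : ∀ t ≤ σ, y t = (Y₁ t).1 := fun t ht => if_pos ht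
  have hy₂ : ∀ t, σ < t → y t = (Y₂ t).1 := fun t ht => if_neg ht.not_ge
  have hv₁ : ∀ t ≤ σ, w t = w₁ t := fun t ht => if_pos ht
  have hv₂ : ∀ t, σ < t → w t = w₂ t := fun t ht => if_neg ht.not_ge
  have hcross : P.CrossesOnceAt y σ :=
    ⟨hσ, fun t ht => by rw [hy₁ t ht.2.le]; exact hneg t ht, by rw [hy₁ σ le_rfl, hzero],
      fun t ht => by rw [hy₂ t ht.1]; exact hpos t ht⟩
  have hI₁ : IntegrableOn (fun s => P.F₁ ((Y₁ s, w₁ s), s)) (Icc P.t₀ β) :=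
    ((BddMeasurableOn.of_continuousOn hc₁.continuousOn).comp_continuous hF₁.cont
      (hw₁.bddMeasurableOn.mono (Icc_subset_Icc_right hβ))).integrableOn
  have hI₂ : IntegrableOn (fun s => P.F₂ ((Y₂ s, w₂ s), s)) (Icc α P.t_f) :=
    ((BddMeasurableOn.of_continuousOn hc₂.continuousOn).comp_continuous hF₂.cont
      (hw₂.bddMeasurableOn.mono (Icc_subset_Icc_left hα))).integrableOn
  refine ⟨y, w, ⟨hw₁.ite_le hw₂ σ, ?_, ?_, ?_, σ, hcross⟩, hy₂ _ hσ.2, ?_⟩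
  · refine (Continuous.if_le (continuous_fst.comp hc₁) (continuous_fst.comp hc₂) continuous_id
      continuous_const fun t ht => ?_).continuousOn
    rw [show t = σ from ht]
    exact congrArg Prod.fst hmatch
  · have h0 := h₁ P.t₀ ⟨le_rfl, (hσ.1.trans hσβ).le⟩
    rw [intervalIntegral.integral_same, add_zero] at h0
    rw [hy₁ _ hσ.1.le, h0]
  · intro t ht hg hwt
    rcases lt_trichotomy t σ with hlt | heq | hgt
    · have hev : ∀ᶠ s in 𝓝 t, s < σ := gt_mem_nhds hlt
      have hw₁t : ContinuousAt w₁ t := hwt.congr (hev.mono fun s hs => hv₁ s hs.le)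
      have hd := hasDerivAt_of_eq_add_integral hI₁ ⟨le_rfl, (hσ.1.trans hσβ).le⟩ h₁
        ⟨ht.1, hlt.trans hσβ⟩ (hF₁.cont.continuousAt.comp
          ((hc₁.continuousAt.prodMk hw₁t).prodMk continuousAt_id))
      have hd' := (hasFDerivAt_fst (p := Y₁ t)).comp_hasDerivAt t hd
      rw [f, if_pos (hcross.before t ⟨ht.1.le, hlt⟩).le, hy₁ t hlt.le, hv₁ t hlt.le]
      exact hd'.congr_of_eventuallyEq (hev.mono fun s hs => hy₁ s hs.le)
    · exact absurd (heq ▸ hcross.at_interface) hg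
    · have hev : ∀ᶠ s in 𝓝 t, σ < s := lt_mem_nhds hgt
      have hw₂t : ContinuousAt w₂ t := hwt.congr (hev.mono fun s hs => hv₂ s hs)
      have hd := hasDerivAt_of_eq_add_integral hI₂ ha h₂
        ⟨hασ.trans hgt, ht.2⟩ (hF₂.cont.continuousAt.comp
          ((hc₂.continuousAt.prodMk hw₂t).prodMk continuousAt_id))
      have hd' := (hasFDerivAt_fst (p := Y₂ t)).comp_hasDerivAt t hd
      rw [f, if_neg (hcross.after t ⟨hgt, ht.2.le⟩).not_ge, hy₂ t hgt, hv₂ t hgt]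
      exact hd'.congr_of_eventuallyEq (hev.mono fun s hs => hy₂ s hs)
  · have hσm : σ ∈ Icc α P.t_f := ⟨hασ.le, hσ.2.le⟩
    have hfm : P.t_f ∈ Icc α P.t_f := ⟨hσm.1.trans hσm.2, le_rfl⟩
    have hJ := hcross.integral_L_eq (w := w) (hI₁.mono_set (Icc_subset_Icc_right hσβ.le))
      (hI₂.mono_set (Icc_subset_Icc_left hασ.le))
      (fun s hs => ⟨(hy₁ s hs.2.le).symm, (hv₁ s hs.2.le).symm⟩)
      (fun s hs => ⟨(hy₂ s hs.1).symm, (hv₂ s hs.1).symm⟩)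
    -- The first phase starts with cost `0` and hands its cost over at `σ`, so the increments
    -- telescope to the final cost coordinate of `Y₂`.
    have e₁ : ∫ s in P.t₀..σ, P.F₁ ((Y₁ s, w₁ s), s) = Y₁ σ - (P.x₀, 0) := by
      rw [h₁ σ ⟨hσ.1.le, hσβ.le⟩]; abel
    have e₂ : ∫ s in σ..P.t_f, P.F₂ ((Y₂ s, w₂ s), s) = Y₂ P.t_f - Y₂ σ := by
      rw [h₂ _ hfm, h₂ σ hσm, add_sub_add_left_eq_sub,
        intervalIntegral.integral_interval_sub_left (hI₂.intervalIntegrable_of_mem_Icc ha hfm)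
        (hI₂.intervalIntegrable_of_mem_Icc ha hσm)]
    rw [J, hJ, e₁, e₂, hy₂ _ hσ.2, ← hmatch]
    simp

end SwitchedProblem

end

/-! ### Continued controls and the endpoint map -/

section
open MeasureTheory BoundedContinuousFunction
open scoped BoundedContinuousFunction

section controls
variable {U : Type*} [NormedAddCommGroup U] [NormedSpace ℝ U] {u : ℝ → U} {w : U} {τ a b : ℝ}

/-- The control `u` before `τ`, continued by the constant `w`. -/
noncomputable abbrev extendRight (u : ℝ → U) (τ : ℝ) (w : U) (t : ℝ) : U := if t < τ then u t else w

/-- The control `u` after `τ`, continued by the constant `w` to times up to `τ`. -/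
noncomputable abbrev extendLeft (u : ℝ → U) (τ : ℝ) (w : U) (t : ℝ) : U := if t ≤ τ then w else u t

theorem continuousAt_extendRight_iff {t : ℝ} (ht : t < τ) :
    ContinuousAt (extendRight u τ w) t ↔ ContinuousAt u t :=
  continuousAt_congr (by filter_upwards [gt_mem_nhds ht] with s hs using if_pos hs)

theorem continuousAt_extendLeft_iff {t : ℝ} (ht : τ < t) :
    ContinuousAt (extendLeft u τ w) t ↔ ContinuousAt u t :=
  continuousAt_congr (by filter_upwards [lt_mem_nhds ht] with s hs using if_neg hs.not_ge)

theorem continuousAt_extendRight_self (h : Tendsto u (𝓝[<] τ) (𝓝 w)) :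
    ContinuousAt (extendRight u τ w) τ := by
  rw [ContinuousAt, extendRight, if_neg (lt_irrefl τ), ← nhdsLT_sup_nhdsGE, tendsto_sup]
  refine ⟨h.congr' ?_, tendsto_const_nhds.congr' ?_⟩
  · filter_upwards [self_mem_nhdsWithin] with s hs using (if_pos hs).symm
  · filter_upwards [self_mem_nhdsWithin] with s hs using (if_neg (not_lt.2 hs)).symm

theorem continuousAt_extendLeft_self (h : Tendsto u (𝓝[>] τ) (𝓝 w)) :
    ContinuousAt (extendLeft u τ w) τ := by
  rw [ContinuousAt, extendLeft, if_pos le_rfl, ← nhdsLE_sup_nhdsGT, tendsto_sup]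
  refine ⟨tendsto_const_nhds.congr' ?_, h.congr' ?_⟩
  · filter_upwards [self_mem_nhdsWithin] with s hs using (if_pos hs).symm
  · filter_upwards [self_mem_nhdsWithin] with s hs using (if_neg (not_le.2 hs)).symm

theorem PiecewiseContinuousOn.eventually_continuousAt (hu : PiecewiseContinuousOn u a b)
    (hτ : τ ∈ Ioo a b) : ∀ᶠ t in 𝓝 τ, t ≠ τ → ContinuousAt u t := by
  obtain ⟨S, hS, hc⟩ := hu.exists_finite_continuousAt
  have h1 : (S \ {τ})ᶜ ∈ 𝓝 τ :=
    (hS.subset sdiff_subset).isClosed.isOpen_compl.mem_nhds (by simp)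
  filter_upwards [h1, Ioo_mem_nhds hτ.1 hτ.2] with t ht ht' hne
  exact hc t ⟨ht', fun hs => ht ⟨hs, hne⟩⟩

/-- Continuing by the left limit removes the possible jump at `τ`, and other discontinuities do not
accumulate there. Differentiating the flow in time at `τ` and differentiating `γ` along nearby
trajectories both need this. -/
theorem PiecewiseContinuousOn.eventually_continuousAt_extendRight
    (hu : PiecewiseContinuousOn u a b) (hτ : τ ∈ Ioo a b) (h : Tendsto u (𝓝[<] τ) (𝓝 w)) :
    ∀ᶠ t in 𝓝 τ, ContinuousAt (extendRight u τ w) t := by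
  filter_upwards [hu.eventually_continuousAt hτ] with t ht
  rcases lt_trichotomy t τ with hlt | rfl | hgt
  · exact (continuousAt_extendRight_iff hlt).2 (ht hlt.ne)
  · exact continuousAt_extendRight_self h
  · refine (continuousAt_const : ContinuousAt (fun _ => w) t).congr ?_
    filter_upwards [lt_mem_nhds hgt] with s hs using (if_neg hs.not_gt).symm

theorem PiecewiseContinuousOn.eventually_continuousAt_extendLeft
    (hu : PiecewiseContinuousOn u a b) (hτ : τ ∈ Ioo a b) (h : Tendsto u (𝓝[>] τ) (𝓝 w)) :
    ∀ᶠ t in 𝓝 τ, ContinuousAt (extendLeft u τ w) t := by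
  filter_upwards [hu.eventually_continuousAt hτ] with t ht
  rcases lt_trichotomy t τ with hlt | rfl | hgt
  · refine (continuousAt_const : ContinuousAt (fun _ => w) t).congr ?_
    filter_upwards [gt_mem_nhds hlt] with s hs using (if_pos hs.le).symm
  · exact continuousAt_extendLeft_self h
  · exact (continuousAt_extendLeft_iff hgt).2 (ht hgt.ne')

end controls

theorem intervalIntegral_prodMk {X : Type*} [NormedAddCommGroup X] [NormedSpace ℝ X]
    [CompleteSpace X] {a b : ℝ} {h : ℝ → X} {k : ℝ → ℝ}
    (hi : IntervalIntegrable (fun s => (h s, k s)) volume a b) :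
    ∫ s in a..b, (h s, k s) = (∫ s in a..b, h s, ∫ s in a..b, k s) :=
  Prod.ext ((ContinuousLinearMap.fst ℝ X ℝ).intervalIntegral_comp_comm hi).symm
    ((ContinuousLinearMap.snd ℝ X ℝ).intervalIntegral_comp_comm hi).symm

/-- A trajectory together with its accumulated cost solves the augmented equation. -/
theorem exists_augmented_trajectory {n m : ℕ}
    {f : EuclideanSpace ℝ (Fin n) → EuclideanSpace ℝ (Fin m) → ℝ → EuclideanSpace ℝ (Fin n)}
    {L : EuclideanSpace ℝ (Fin n) → EuclideanSpace ℝ (Fin m) → ℝ → ℝ}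
    (hF : IsC1Field (augmentedField f L) (augmentedDeriv f L)) {a b : ℝ} (hab : a ≤ b)
    {x : ℝ → EuclideanSpace ℝ (Fin n)} (hxc : ContinuousOn x (Icc a b))
    {u : ℝ → EuclideanSpace ℝ (Fin m)} (hu : BddMeasurableOn u a b) {S : Set ℝ} (hS : S.Finite)
    (hd : ∀ t ∈ Ioo a b \ S, HasDerivAt x (f (x t) (u t) t) t) (z₀ : ℝ) :
    ∃ Z : ℝ → EuclideanSpace ℝ (Fin n) × ℝ, ContinuousOn Z (Icc a b) ∧
      (∀ t ∈ Icc a b, Z t = (x a, z₀) + ∫ s in a..t, augmentedField f L ((Z s, u s), s)) ∧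
      ∀ t, (Z t).1 = x t := by
  have hI : IntegrableOn (fun s => augmentedField f L (((x s, (0 : ℝ)), u s), s)) (Icc a b) :=
    (BddMeasurableOn.comp_continuous hF.cont
      (.of_continuousOn (hxc.prodMk continuousOn_const)) hu).integrableOn
  have hIf : IntegrableOn (fun s => f (x s) (u s) s) (Icc a b) := hI.fst
  have hIL : IntegrableOn (fun s => L (x s) (u s) s) (Icc a b) := hI.snd
  have ha : a ∈ Icc a b := ⟨le_rfl, hab⟩
  refine ⟨fun t => (x t, z₀ + ∫ s in a..t, L (x s) (u s) s), ?_, fun t ht => ?_, fun _ => rfl⟩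
  · refine hxc.prodMk (continuousOn_const.add ?_)
    have := intervalIntegral.continuousOn_primitive_interval' (a := a) (b₁ := a) (b₂ := b)
        (hIL.intervalIntegrable_of_mem_Icc ha ⟨hab, le_rfl⟩) left_mem_uIcc
    rwa [uIcc_of_le hab] at this
  · change _ = _ + ∫ s in a..t, (f (x s) (u s) s, L (x s) (u s) s)
    rw [intervalIntegral_prodMk (hI.intervalIntegrable_of_mem_Icc ha ht),
      Prod.mk_add_mk, ← eq_add_integral_of_hasDerivAt_off_finite hxc hIf hS hd ht]

namespace SwitchedProblem
variable {n m : ℕ} {P : SwitchedProblem n m}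

/-- Control variations `v` produce admissible pairs near an admissible pair that crosses the
interface transversally, and the terminal state and cost depend on `v` in a strictly differentiable
way. -/
theorem Admissible.exists_endpoint_map (hP : P.Regular) {x : ℝ → EuclideanSpace ℝ (Fin n)}
    {u : ℝ → EuclideanSpace ℝ (Fin m)} (hxu : P.Admissible x u) {τ : ℝ}
    (hτ : P.CrossesOnceAt x τ) {um up : EuclideanSpace ℝ (Fin m)}
    (hum : Tendsto u (𝓝[<] τ) (𝓝 um)) (hup : Tendsto u (𝓝[>] τ) (𝓝 up))
    (htr₁ : fderiv ℝ P.g (x τ) (P.f₁ (x τ) um τ) ≠ 0)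
    (htr₂ : fderiv ℝ P.g (x τ) (P.f₂ (x τ) up τ) ≠ 0) :
    ∃ (x₁ x₂ : ℝ →ᵇ EuclideanSpace ℝ (Fin n) × ℝ)
      (Φ : (ℝ →ᵇ EuclideanSpace ℝ (Fin m)) → EuclideanSpace ℝ (Fin n) × ℝ)
      (Φ' : (ℝ →ᵇ EuclideanSpace ℝ (Fin m)) →L[ℝ] EuclideanSpace ℝ (Fin n) × ℝ),
      (∀ t ∈ Icc P.t₀ τ, (x₁ t).1 = x t) ∧ (∀ t ∈ Icc τ P.t_f, (x₂ t).1 = x t) ∧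
      HasStrictFDerivAt Φ Φ' 0 ∧ (Φ 0).1 = x P.t_f ∧ P.J x u = P.φ (x P.t_f) + (Φ 0).2 ∧
      (∀ᶠ v in 𝓝 0, ∃ y w, P.Admissible y w ∧ y P.t_f = (Φ v).1 ∧
        P.J y w = P.φ (Φ v).1 + (Φ v).2) ∧
      ∀ v, ∃ (y₁ y₂ : ℝ →ᵇ EuclideanSpace ℝ (Fin n) × ℝ) (d : ℝ)
        (c : EuclideanSpace ℝ (Fin n) × ℝ),
        (∀ t ∈ Icc P.t₀ τ, y₁ t = 0 + ∫ s in P.t₀..t,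
          augmentedDeriv P.f₁ P.L₁ ((x₁ s, extendRight u τ um s), s) (y₁ s, v s)) ∧
        (∀ t ∈ Icc τ P.t_f, y₂ t = c + ∫ s in τ..t,
          augmentedDeriv P.f₂ P.L₂ ((x₂ s, extendLeft u τ up s), s) (y₂ s, v s)) ∧
        y₁ τ + d • P.F₁ ((x₁ τ, um), τ) = y₂ τ + d • P.F₂ ((x₂ τ, up), τ) ∧
        (fderiv ℝ P.g (x τ)).comp (.fst ℝ _ ℝ) (y₁ τ + d • P.F₁ ((x₁ τ, um), τ)) = 0 ∧
        Φ' v = y₂ P.t_f := by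
  have hF₁ := hP.isC1Field₁
  have hF₂ := hP.isC1Field₂
  obtain ⟨h0τ, hτf⟩ := hτ.mem
  have hu := hxu.control
  have hu₁ : PiecewiseContinuousOn (extendRight u τ um) P.t₀ P.t_f :=
    hu.ite_lt (PiecewiseContinuousOn.const um) τ
  have hu₂ : PiecewiseContinuousOn (extendLeft u τ up) P.t₀ P.t_f :=
    (PiecewiseContinuousOn.const up).ite_le hu τ
  obtain ⟨S, hS, hSc⟩ := hu.exists_finite_continuousAt
  -- the nominal trajectory, continued beyond the crossing in both directions
  obtain ⟨Z₁, hZ₁c, hZ₁, hZ₁x⟩ := exists_augmented_trajectory hF₁ h0τ.le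
    (hxu.continuousOn.mono (Icc_subset_Icc_right hτf.le))
    (hu.bddMeasurableOn.mono (Icc_subset_Icc_right hτf.le)) hS (fun t ht => by
      have hg := hτ.before t ⟨ht.1.1.le, ht.1.2⟩
      have ht' : t ∈ Ioo P.t₀ P.t_f := ⟨ht.1.1, ht.1.2.trans hτf⟩
      have h := hxu.dynamics t ht' hg.ne (hSc t ⟨ht', ht.2⟩)
      rwa [f, if_pos hg.le] at h) 0
  -- The second phase starts with the cost accumulated by the first, so that the two augmented
  -- trajectories meet at `τ`.
  obtain ⟨Z₂, hZ₂c, hZ₂, hZ₂x⟩ := exists_augmented_trajectory hF₂ hτf.le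
    (hxu.continuousOn.mono (Icc_subset_Icc_left h0τ.le))
    (hu.bddMeasurableOn.mono (Icc_subset_Icc_left h0τ.le)) hS (fun t ht => by
      have hg := hτ.after t ⟨ht.1.1, ht.1.2.le⟩
      have ht' : t ∈ Ioo P.t₀ P.t_f := ⟨h0τ.trans ht.1.1, ht.1.2⟩
      have h := hxu.dynamics t ht' hg.ne' (hSc t ⟨ht', ht.2⟩)
      rwa [f, if_neg hg.not_ge] at h) (Z₁ τ).2
  rw [hxu.initial] at hZ₁
  obtain ⟨ε₁, hε₁, hε₁', x₁, hx₁, hx₁Z⟩ := hF₁.exists_extension_right h0τ.le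
    (ε₀ := P.t_f - τ) (by linarith) um
    (hu₁.bddMeasurableOn.mono (Icc_subset_Icc_right (by linarith))) hZ₁c hZ₁
  obtain ⟨ε₂, hε₂, hε₂', x₂, hx₂, hx₂Z⟩ := hF₂.exists_extension_left hτf.le
    (ε₀ := τ - P.t₀) (by linarith) up
    (hu₂.bddMeasurableOn.mono (Icc_subset_Icc_left (by linarith))) hZ₂c hZ₂
  set β := τ + ε₁
  set α := τ - ε₂
  have hβ : β ≤ P.t_f := by linarith
  have hα : P.t₀ ≤ α := by linarith
  have hτ₁ : τ ∈ Ioo P.t₀ β := ⟨h0τ, by linarith⟩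
  have hτ₂ : τ ∈ Ioo α P.t_f := ⟨by linarith, hτf⟩
  have hb₁ := hu₁.bddMeasurableOn.mono (Icc_subset_Icc_right hβ)
  have hb₂ := hu₂.bddMeasurableOn.mono (Icc_subset_Icc_left hα)
  have ha₁ : P.t₀ ∈ Icc P.t₀ β := ⟨le_rfl, (hτ₁.1.trans hτ₁.2).le⟩
  have hτm₂ := Ioo_subset_Icc_self hτ₂
  obtain ⟨X₁, X₁', hX₁, hX₁x⟩ := hF₁.exists_isFlowNear ha₁ hb₁ hx₁
  obtain ⟨X₂, X₂', hX₂, hX₂x⟩ := hF₂.exists_isFlowNear hτm₂ hb₂ hx₂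
  set ξ₁ : EuclideanSpace ℝ (Fin n) × ℝ := (P.x₀, 0)
  set ξ₂ : EuclideanSpace ℝ (Fin n) × ℝ := (x τ, (Z₁ τ).2)
  have hx₁x : ∀ t ∈ Icc P.t₀ τ, (x₁ t).1 = x t := fun t ht => by rw [hx₁Z t ht, hZ₁x]
  have hx₂x : ∀ t ∈ Icc τ P.t_f, (x₂ t).1 = x t := fun t ht => by rw [hx₂Z t ht, hZ₂x]
  have hx₁τ : x₁ τ = ξ₂ := by
    rw [hx₁Z τ ⟨h0τ.le, le_rfl⟩]; exact Prod.ext (hZ₁x τ) rfl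
  have hx₂τ : x₂ τ = ξ₂ := by
    rw [hx₂, clampTo_of_mem hτm₂, intervalIntegral.integral_same, add_zero]
  have huτ₁ := hu.eventually_continuousAt_extendRight hτ.mem hum
  have huτ₂ := hu.eventually_continuousAt_extendLeft hτ.mem hup
  have hu₁τ : extendRight u τ um τ = um := if_neg (lt_irrefl τ)
  have hu₂τ : extendLeft u τ up τ = up := if_pos le_rfl
  -- the interface function of the augmented state
  let γ : EuclideanSpace ℝ (Fin n) × ℝ → ℝ := fun z => P.g z.1
  have hγ : ContDiff ℝ 1 γ := hP.g.comp contDiff_fst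
  have hγ' : ∀ z, HasFDerivAt γ ((fderiv ℝ P.g z.1).comp (.fst ℝ _ ℝ)) z := fun z =>
    HasFDerivAt.comp (g := P.g) z (hP.g.differentiable one_ne_zero _).hasFDerivAt hasFDerivAt_fst
  have hγ₂ : HasStrictFDerivAt γ ((fderiv ℝ P.g (x τ)).comp (.fst ℝ _ ℝ)) ξ₂ := by
    have h := hγ.contDiffAt.hasStrictFDerivAt (x := ξ₂) one_ne_zero
    rwa [(hγ' ξ₂).fderiv] at h
  have hbase : ∀ t ∈ Icc P.t₀ β, x₁ t = ξ₁ + ∫ s in P.t₀..t,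
      P.F₁ ((x₁ s, extendRight u τ um s), s) := fun t ht => by
    conv_lhs => rw [hx₁ t, clampTo_of_mem ht]
  have hbase₂ : ∀ t ∈ Icc α P.t_f, x₂ t = ξ₂ + ∫ s in τ..t,
      P.F₂ ((x₂ s, extendLeft u τ up s), s) := fun t ht => by
    conv_lhs => rw [hx₂ t, clampTo_of_mem ht]
  have hI₁ : IntegrableOn (fun s => P.F₁ ((x₁ s, extendRight u τ um s), s)) (Icc P.t₀ β) :=
    (BddMeasurableOn.comp_continuous hF₁.cont
      (.of_continuousOn x₁.continuous.continuousOn) hb₁).integrableOn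
  have hI₂ : IntegrableOn (fun s => P.F₂ ((x₂ s, extendLeft u τ up s), s)) (Icc α P.t_f) :=
    (BddMeasurableOn.comp_continuous hF₂.cont
      (.of_continuousOn x₂.continuous.continuousOn) hb₂).integrableOn
  -- the crossing is from `g < 0` to `g > 0` at positive speed
  have hpos₁ : 0 < fderiv ℝ γ (x₁ τ) (P.F₁ ((x₁ τ, extendRight u τ um τ), τ)) := by
    have hd := hasDerivAt_of_eq_add_integral hI₁ ha₁ hbase hτ₁ (hF₁.cont.continuousAt.comp
      ((x₁.continuous.continuousAt.prodMk huτ₁.self_of_nhds).prodMk continuousAt_id))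
    have hd' := (hγ' (x₁ τ)).comp_hasDerivAt τ hd
    rw [← (hγ' (x₁ τ)).fderiv] at hd'
    refine lt_of_le_of_ne (hd'.nonneg_of_lt_before h0τ fun t ht => ?_) ?_
    · change P.g (x₁ t).1 ≤ P.g (x₁ τ).1
      rw [hx₁x t ⟨ht.1, ht.2.le⟩, hx₁x τ ⟨h0τ.le, le_rfl⟩, hτ.at_interface]
      exact (hτ.before t ht).le
    · rw [(hγ' (x₁ τ)).fderiv, hu₁τ, hx₁τ]
      exact htr₁.symm
  have hpos₂ : 0 < fderiv ℝ γ (x₂ τ) (P.F₂ ((x₂ τ, extendLeft u τ up τ), τ)) := by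
    have hd := hasDerivAt_of_eq_add_integral hI₂ hτm₂ hbase₂ hτ₂ (hF₂.cont.continuousAt.comp
      ((x₂.continuous.continuousAt.prodMk huτ₂.self_of_nhds).prodMk continuousAt_id))
    have hd' := (hγ' (x₂ τ)).comp_hasDerivAt τ hd
    rw [← (hγ' (x₂ τ)).fderiv] at hd'
    refine lt_of_le_of_ne (hd'.nonneg_of_lt_after hτf fun t ht => ?_) ?_
    · change P.g (x₂ τ).1 ≤ P.g (x₂ t).1
      rw [hx₂x t ⟨ht.1.le, ht.2⟩, hx₂x τ ⟨le_rfl, hτf.le⟩, hτ.at_interface]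
      exact (hτ.after t ht).le
    · rw [(hγ' (x₂ τ)).fderiv, hu₂τ, hx₂τ]
      exact htr₂.symm
  have htr : (fderiv ℝ P.g (x τ)).comp (.fst ℝ _ ℝ)
      (P.F₁ ((X₁ (ξ₁, 0) τ, extendRight u τ um τ), τ)) ≠ 0 := by
    rw [hX₁x, hu₁τ, hx₁τ]; exact htr₁
  obtain ⟨ξ, σ, ξ', σ', hξ, hσ, hξ0, hσ0, hcross, hlin⟩ := exists_switching_data hF₁ hF₂ hτ₁ hτ₂
    hb₁ hb₂ huτ₁.self_of_nhds huτ₂.self_of_nhds hX₁ hX₂ (by rw [hX₁x, hX₂x, hx₁τ, hx₂τ])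
    (γ := γ) (γ' := (fderiv ℝ P.g (x τ)).comp (.fst ℝ _ ℝ)) (by rw [hX₁x, hx₁τ]; exact hγ₂)
    (by rw [hX₁x, hx₁τ]; exact hτ.at_interface) htr
  obtain ⟨η₁, hη₁, hmono₁⟩ := hX₁.exists_strictMonoOn hF₁ ha₁ hb₁ hτ₁ huτ₁ hγ
    (by rw [hX₁x]; exact hpos₁)
  obtain ⟨η₂, hη₂, hmono₂⟩ := hX₂.exists_strictMonoOn hF₂ hτm₂ hb₂ hτ₂ huτ₂ hγ
    (by rw [hX₂x]; exact hpos₂)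
  -- Halving makes `η` strictly smaller than both monotonicity windows and both continuation
  -- lengths, so every switching time within `η` of `τ` lies inside all of them.
  set η := min (min η₁ η₂) (min ε₁ ε₂) / 2
  have hη : 0 < η := by positivity
  have hle₁ : η < η₁ := by
    have : min (min η₁ η₂) (min ε₁ ε₂) ≤ η₁ := (min_le_left _ _).trans (min_le_left _ _)
    change _ / 2 < _; linarith
  have hle₂ : η < η₂ := by
    have : min (min η₁ η₂) (min ε₁ ε₂) ≤ η₂ := (min_le_left _ _).trans (min_le_right _ _)
    change _ / 2 < _; linarith
  have hle₃ : η < ε₁ := by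
    have : min (min η₁ η₂) (min ε₁ ε₂) ≤ ε₁ := (min_le_right _ _).trans (min_le_left _ _)
    change _ / 2 < _; linarith
  have hle₄ : η < ε₂ := by
    have : min (min η₁ η₂) (min ε₁ ε₂) ≤ ε₂ := (min_le_right _ _).trans (min_le_right _ _)
    change _ / 2 < _; linarith
  -- Away from `τ` the sign of `g` persists by compactness. Within `η` of `τ` strict monotonicity
  -- together with the zero at `σ v` decides it, so the perturbed trajectory crosses exactly once.
  have hneg : ∀ᶠ y in 𝓝 x₁, ∀ t ∈ Icc P.t₀ (τ - η), γ (y t) < 0 :=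
    eventually_forall_mem_lt_zero hγ.continuous isCompact_Icc fun t ht => by
      change P.g (x₁ t).1 < 0
      rw [hx₁x t ⟨ht.1, by linarith [ht.2]⟩]
      exact hτ.before t ⟨ht.1, by linarith [ht.2]⟩
  have hposi : ∀ᶠ y in 𝓝 x₂, ∀ t ∈ Icc (τ + η) P.t_f, -γ (y t) < 0 :=
    eventually_forall_mem_lt_zero hγ.continuous.neg isCompact_Icc fun t ht => by
      change -P.g (x₂ t).1 < 0
      rw [hx₂x t ⟨by linarith [ht.1], ht.2⟩, neg_lt_zero]
      exact hτ.after t ⟨by linarith [ht.1], ht.2⟩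
  have hp₁ : Tendsto (fun v : ℝ →ᵇ EuclideanSpace ℝ (Fin m) => (ξ₁, v)) (𝓝 0) (𝓝 (ξ₁, 0)) :=
    (continuous_const.prodMk continuous_id).tendsto _
  have hp₂ : Tendsto (fun v : ℝ →ᵇ EuclideanSpace ℝ (Fin m) => (ξ v, v)) (𝓝 0) (𝓝 (ξ₂, 0)) := by
    rw [← hξ0, nhds_prod_eq]
    exact hξ.continuousAt.tendsto.prodMk tendsto_id
  have hX₁t : Tendsto X₁ (𝓝 (ξ₁, 0)) (𝓝 x₁) := by
    rw [← hX₁x]; exact hX₁.strict.continuousAt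
  have hX₂t : Tendsto X₂ (𝓝 (ξ₂, 0)) (𝓝 x₂) := by
    rw [← hX₂x]; exact hX₂.strict.continuousAt
  have hσt : ∀ᶠ v in 𝓝 0, σ v ∈ Ioo (τ - η) (τ + η) := by
    refine hσ.continuousAt.eventually (Ioo_mem_nhds ?_ ?_) <;> rw [hσ0] <;> linarith
  have hpair : HasStrictFDerivAt (fun v => (ξ v, v))
      (ξ'.prod (ContinuousLinearMap.id ℝ (ℝ →ᵇ EuclideanSpace ℝ (Fin m)))) 0 :=
    hξ.prodMk (hasStrictFDerivAt_id _)
  have hX₂s : HasStrictFDerivAt X₂ X₂' ((fun v => (ξ v, v)) 0) := by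
    change HasStrictFDerivAt X₂ X₂' (ξ 0, 0)
    rw [hξ0]; exact hX₂.strict
  have hΦ := HasStrictFDerivAt.comp (g := X₂) (f := fun v => (ξ v, v)) 0 hX₂s hpair
  have hΦ' := HasStrictFDerivAt.comp (f := X₂ ∘ fun v => (ξ v, v)) 0
    (evalCLM ℝ P.t_f : (ℝ →ᵇ EuclideanSpace ℝ (Fin n) × ℝ) →L[ℝ] _).hasStrictFDerivAt hΦ
  have hΦ0 : X₂ (ξ 0, 0) = x₂ := by rw [hξ0, hX₂x]
  refine ⟨x₁, x₂, fun v => X₂ (ξ v, v) P.t_f, _, hx₁x, hx₂x, hΦ', ?_, ?_, ?_, fun v => ?_⟩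
  · change (X₂ (ξ 0, 0) P.t_f).1 = _
    rw [hΦ0, hx₂x _ ⟨hτf.le, le_rfl⟩]
  · change _ = _ + (X₂ (ξ 0, 0) P.t_f).2
    rw [hΦ0, J, hτ.integral_L_eq (hI₁.mono_set (Icc_subset_Icc_right hτ₁.2.le))
      (hI₂.mono_set (Icc_subset_Icc_left hτ₂.1.le))
      (fun s hs => ⟨hx₁x s (Ioo_subset_Icc_self hs), if_pos hs.2⟩)
      (fun s hs => ⟨hx₂x s (Ioo_subset_Icc_self hs), if_neg hs.1.not_ge⟩),
      ← sub_eq_iff_eq_add'.2 (hbase τ ⟨h0τ.le, hτ₁.2.le⟩),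
      ← sub_eq_iff_eq_add'.2 (hbase₂ P.t_f ⟨(hτ₂.1.trans hτf).le, le_rfl⟩), hx₁τ]
    simp [ξ₁]
  · filter_upwards [hcross, hσt, hp₁.eventually hX₁.eventually_eq,
      hp₂.eventually hX₂.eventually_eq, hp₁.eventually hmono₁, hp₂.eventually hmono₂,
      (hX₁t.comp hp₁).eventually hneg, (hX₂t.comp hp₂).eventually hposi]
      with v ⟨hm, hz⟩ hσv he₁ he₂ hm₁ hm₂ hn hp
    have hz₂ : γ (X₂ (ξ v, v) (σ v)) = 0 := by rw [← hm, hz]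
    have hσm₁ : σ v ∈ Ioo (τ - η₁) (τ + η₁) := ⟨by linarith [hσv.1], by linarith [hσv.2]⟩
    have hσm₂ : σ v ∈ Ioo (τ - η₂) (τ + η₂) := ⟨by linarith [hσv.1], by linarith [hσv.2]⟩
    refine exists_admissible_of_phases hP (hu₁.add_continuous v.continuous)
      (hu₂.add_continuous v.continuous) (σ := σ v) (α := α) (β := β) (a := τ)
      ⟨by linarith [hσv.1], by linarith [hσv.2]⟩ (by linarith [hσv.2]) (by linarith [hσv.1])
      hβ hα hτm₂ (X₁ (ξ₁, v)).continuous (X₂ (ξ v, v)).continuous (c := ξ v)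
      (fun t ht => ?_) (fun t ht => ?_) hm (fun t ht => ?_) hz fun t ht => ?_
    · conv_lhs => rw [he₁ t, clampTo_of_mem ht]
    · conv_lhs => rw [he₂ t, clampTo_of_mem ht]
    · rcases le_total t (τ - η) with hle | hge
      · exact hn t ⟨ht.1, hle⟩
      · have := hm₁ (a := t) ⟨by linarith, by linarith [ht.2, hσm₁.2]⟩ hσm₁ ht.2
        exact this.trans_eq hz
    · rcases le_total (τ + η) t with hle | hge
      · exact neg_lt_zero.1 (hp t ⟨hle, ht.2⟩)
      · have := hm₂ (b := t) hσm₂ ⟨by linarith [ht.1, hσm₂.1], by linarith⟩ ht.1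
        exact hz₂.symm.trans_lt this
  · obtain ⟨hl₁, hl₂⟩ := hlin v
    rw [hX₁x, hu₁τ] at hl₁ hl₂
    rw [hX₂x, hu₂τ] at hl₁
    -- In the first variation `d` is the variation of the switching time and `c` that of the second
    -- phase at time `τ`. The initial state is not varied, hence the `0`.
    refine ⟨X₁' (0, v), X₂' (ξ' v, v), σ' v, ξ' v, fun t ht => ?_, fun t ht => ?_, hl₁, hl₂, rfl⟩
    · conv_lhs => rw [hX₁.deriv_eq, hX₁x, clampTo_of_mem (show t ∈ Icc P.t₀ β from
        ⟨ht.1, by linarith [ht.2]⟩)]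
    · conv_lhs => rw [hX₂.deriv_eq, hX₂x, clampTo_of_mem (show t ∈ Icc α P.t_f from
        ⟨by linarith [ht.1], ht.2⟩)]

end SwitchedProblem

end

/-! ### From augmented costates to the Hamiltonian conditions -/

section
open MeasureTheory BoundedContinuousFunction InnerProductSpace
open scoped BoundedContinuousFunction

section hamiltonian
variable {n m : ℕ}
  {f : EuclideanSpace ℝ (Fin n) → EuclideanSpace ℝ (Fin m) → ℝ → EuclideanSpace ℝ (Fin n)}
  {L : EuclideanSpace ℝ (Fin n) → EuclideanSpace ℝ (Fin m) → ℝ → ℝ}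

/-- The vector that represents the state component of a covector of the augmented system. -/
noncomputable def stateCostate (q : EuclideanSpace ℝ (Fin n) × ℝ →L[ℝ] ℝ) :
    EuclideanSpace ℝ (Fin n) :=
  (toDual ℝ (EuclideanSpace ℝ (Fin n))).symm (q.comp (.inl ℝ _ ℝ))

theorem exists_stateCostate_clm (n : ℕ) :
    ∃ R : (EuclideanSpace ℝ (Fin n) × ℝ →L[ℝ] ℝ) →L[ℝ] EuclideanSpace ℝ (Fin n),
      ∀ q, R q = stateCostate q :=
  ⟨LinearMap.toContinuousLinearMap
    { toFun := stateCostate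
      map_add' := fun q r => by
        simp only [stateCostate, ContinuousLinearMap.add_comp, map_add]
      map_smul' := fun c q => by
        simp [stateCostate, ContinuousLinearMap.smul_comp] }, fun _ => rfl⟩

theorem stateCostate_fderiv_fst (D : EuclideanSpace ℝ (Fin n) →L[ℝ] ℝ) :
    stateCostate (D.comp (.fst ℝ _ ℝ)) = (toDual ℝ (EuclideanSpace ℝ (Fin n))).symm D := by
  rw [stateCostate, ContinuousLinearMap.comp_assoc, ContinuousLinearMap.fst_comp_inl,
    ContinuousLinearMap.comp_id]

/-- The Hamiltonian is the full costate applied to the augmented field, the cost component `c` of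
the costate being the multiplier of `L`. Derivatives of the Hamiltonian thus reduce to
`augmentedDeriv`. -/
theorem hamiltonian_eq_apply {c : ℝ} {q : EuclideanSpace ℝ (Fin n) × ℝ →L[ℝ] ℝ}
    (hq : q (0, 1) = c) (z : EuclideanSpace ℝ (Fin n) × ℝ) (w : EuclideanSpace ℝ (Fin m)) (t : ℝ) :
    c * L z.1 w t + inner ℝ (stateCostate q) (f z.1 w t) = q (augmentedField f L ((z, w), t)) := by
  have h1 : augmentedField f L ((z, w), t) = (f z.1 w t, 0) + L z.1 w t • ((0, 1) :
      EuclideanSpace ℝ (Fin n) × ℝ) := by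
    simp [augmentedField]
  rw [h1, map_add, map_smul, hq, stateCostate, toDual_symm_apply, smul_eq_mul]
  simp [add_comm, mul_comm]

theorem gradient_hamiltonian_state (hF : IsC1Field (augmentedField f L) (augmentedDeriv f L))
    {c : ℝ} {q : EuclideanSpace ℝ (Fin n) × ℝ →L[ℝ] ℝ} (hq : q (0, 1) = c)
    (z : EuclideanSpace ℝ (Fin n) × ℝ) (w : EuclideanSpace ℝ (Fin m)) (t : ℝ) :
    gradient (fun y => c * L y w t + inner ℝ (stateCostate q) (f y w t)) z.1 =
      stateCostate (q.comp ((augmentedDeriv f L ((z, w), t)).comp (.inl ℝ _ _))) := by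
  have h1 : HasFDerivAt (fun y : EuclideanSpace ℝ (Fin n) => ((y, z.2), w))
      ((ContinuousLinearMap.inl ℝ (EuclideanSpace ℝ (Fin n) × ℝ) (EuclideanSpace ℝ (Fin m))).comp
        (.inl ℝ _ ℝ)) z.1 :=
    HasFDerivAt.comp (g := fun y' : EuclideanSpace ℝ (Fin n) × ℝ => (y', w))
      (f := fun y => (y, z.2)) z.1 (hasFDerivAt_prodMk_left (z.1, z.2) w)
      (hasFDerivAt_prodMk_left z.1 z.2)
  have h2 := (hF.hasFDerivAt (z, w) t).comp (f := fun y => ((y, z.2), w)) z.1 h1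
  have h3 := q.hasFDerivAt.comp z.1 h2
  rw [gradient, stateCostate]
  congr 1
  refine HasFDerivAt.fderiv (h3.congr_of_eventuallyEq (Eventually.of_forall fun y => ?_))
  exact hamiltonian_eq_apply hq (y, z.2) w t

theorem gradient_hamiltonian_control (hF : IsC1Field (augmentedField f L) (augmentedDeriv f L))
    {c : ℝ} {q : EuclideanSpace ℝ (Fin n) × ℝ →L[ℝ] ℝ} (hq : q (0, 1) = c)
    (z : EuclideanSpace ℝ (Fin n) × ℝ) (w : EuclideanSpace ℝ (Fin m)) (t : ℝ) :
    gradient (fun w => c * L z.1 w t + inner ℝ (stateCostate q) (f z.1 w t)) w =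
      (toDual ℝ (EuclideanSpace ℝ (Fin m))).symm
        (q.comp ((augmentedDeriv f L ((z, w), t)).comp (.inr ℝ _ _))) := by
  have h2 := (hF.hasFDerivAt (z, w) t).comp (f := fun w => (z, w)) w (hasFDerivAt_prodMk_right z w)
  have h3 := q.hasFDerivAt.comp w h2
  rw [gradient]
  congr 1
  refine HasFDerivAt.fderiv (h3.congr_of_eventuallyEq (Eventually.of_forall fun w => ?_))
  exact hamiltonian_eq_apply hq z w t

variable {u : ℝ → EuclideanSpace ℝ (Fin m)} {α β b : ℝ}

theorem integrableOn_adjoint (hF : IsC1Field (augmentedField f L) (augmentedDeriv f L))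
    (hu : BddMeasurableOn u α β) (x : ℝ →ᵇ EuclideanSpace ℝ (Fin n) × ℝ)
    (q : ℝ →ᵇ (EuclideanSpace ℝ (Fin n) × ℝ →L[ℝ] ℝ)) :
    IntegrableOn (fun s => -(q s).comp ((augmentedDeriv f L ((x s, u s), s)).comp (.inl ℝ _ _)))
      (Icc α β) :=
  ((BddMeasurableOn.of_continuousOn q.continuous.continuousOn).clm_comp
    (hF.bddMeasurableOn_deriv_comp hu x (.inl ℝ _ _))).integrableOn.neg

/-- The multiplier of the cost is constant in time. -/
theorem costate_apply_cost (hF : IsC1Field (augmentedField f L) (augmentedDeriv f L))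
    (hu : BddMeasurableOn u α β) (hb : b ∈ Icc α β) {x : ℝ →ᵇ EuclideanSpace ℝ (Fin n) × ℝ}
    {q : ℝ →ᵇ (EuclideanSpace ℝ (Fin n) × ℝ →L[ℝ] ℝ)} {κ : EuclideanSpace ℝ (Fin n) × ℝ →L[ℝ] ℝ}
    {t : ℝ} (ht : t ∈ Icc α β) (hq : q t = κ + ∫ s in b..t,
      -(q s).comp ((augmentedDeriv f L ((x s, u s), s)).comp (.inl ℝ _ _))) :
    q t (0, 1) = κ (0, 1) := by
  rw [hq, _root_.add_apply, ContinuousLinearMap.intervalIntegral_apply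
    ((integrableOn_adjoint hF hu x q).intervalIntegrable_of_mem_Icc hb ht), add_eq_left]
  refine (intervalIntegral.integral_congr (g := fun _ => (0 : ℝ)) fun s _ => ?_).trans (by simp)
  -- The augmented field does not depend on the accumulated cost, so the adjoint equation leaves the
  -- cost component unchanged.
  have : augmentedDeriv f L ((x s, u s), s) ((0, 1), 0) = 0 := by
    have h0 : ((ContinuousLinearMap.fst ℝ (EuclideanSpace ℝ (Fin n)) ℝ).prodMap
      (.id ℝ (EuclideanSpace ℝ (Fin m)))) (((0 : EuclideanSpace ℝ (Fin n)), (1 : ℝ)), 0) = 0 := rfl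
    rw [augmentedDeriv, ContinuousLinearMap.comp_apply, h0, map_zero]
  change -(q s (augmentedDeriv f L ((x s, u s), s) ((0, 1), 0))) = 0
  rw [this, map_zero, neg_zero]

theorem hasDerivAt_stateCostate (hF : IsC1Field (augmentedField f L) (augmentedDeriv f L))
    (hu : BddMeasurableOn u α β) (hb : b ∈ Icc α β) {x : ℝ →ᵇ EuclideanSpace ℝ (Fin n) × ℝ}
    {q : ℝ →ᵇ (EuclideanSpace ℝ (Fin n) × ℝ →L[ℝ] ℝ)} {κ : EuclideanSpace ℝ (Fin n) × ℝ →L[ℝ] ℝ}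
    (hq : ∀ t ∈ Icc α β, q t = κ + ∫ s in b..t,
      -(q s).comp ((augmentedDeriv f L ((x s, u s), s)).comp (.inl ℝ _ _)))
    {t : ℝ} (ht : t ∈ Ioo α β) (hut : ContinuousAt u t) :
    HasDerivAt (fun t => stateCostate (q t)) (-stateCostate ((q t).comp
      ((augmentedDeriv f L ((x t, u t), t)).comp (.inl ℝ _ _)))) t := by
  obtain ⟨R, hR⟩ := exists_stateCostate_clm n
  have h1 := hasDerivAt_of_eq_add_integral (integrableOn_adjoint hF hu x q) hb hq ht
    (q.continuous.continuousAt.clm_comp (hF.continuousAt_deriv_comp x (.inl ℝ _ _) hut)).neg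
  have h2 := R.hasFDerivAt.comp_hasDerivAt t h1
  rw [map_neg, hR] at h2
  exact h2.congr_of_eventuallyEq (Eventually.of_forall fun s => (hR _).symm)

end hamiltonian

namespace SwitchedProblem
variable {n m : ℕ} {P : SwitchedProblem n m}

/-- Costates of the augmented system satisfy the stationarity conditions. -/
theorem stationaryWith_of_costates (hP : P.Regular) {x : ℝ → EuclideanSpace ℝ (Fin n)}
    {u : ℝ → EuclideanSpace ℝ (Fin m)} (hxu : P.Admissible x u) {τ : ℝ}
    (hτ : P.CrossesOnceAt x τ) {um up : EuclideanSpace ℝ (Fin m)}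
    (hum : Tendsto u (𝓝[<] τ) (𝓝 um)) (hup : Tendsto u (𝓝[>] τ) (𝓝 up))
    {x₁ x₂ : ℝ →ᵇ EuclideanSpace ℝ (Fin n) × ℝ} (hx₁ : ∀ t ∈ Icc P.t₀ τ, (x₁ t).1 = x t)
    (hx₂ : ∀ t ∈ Icc τ P.t_f, (x₂ t).1 = x t)
    {q₁ q₂ : ℝ →ᵇ (EuclideanSpace ℝ (Fin n) × ℝ →L[ℝ] ℝ)}
    {ℓ : EuclideanSpace ℝ (Fin n) × ℝ →L[ℝ] ℝ} {ν c : ℝ} (hc : ℓ (0, 1) = c)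
    (hq₁ : ∀ t ∈ Icc P.t₀ τ, q₁ t = (q₂ τ + ν • (fderiv ℝ P.g (x τ)).comp (.fst ℝ _ ℝ)) +
      ∫ s in τ..t, -(q₁ s).comp
        ((augmentedDeriv P.f₁ P.L₁ ((x₁ s, extendRight u τ um s), s)).comp (.inl ℝ _ _)))
    (hq₂ : ∀ t ∈ Icc τ P.t_f, q₂ t = ℓ + ∫ s in P.t_f..t, -(q₂ s).comp
        ((augmentedDeriv P.f₂ P.L₂ ((x₂ s, extendLeft u τ up s), s)).comp (.inl ℝ _ _)))
    (hham : q₁ τ (P.F₁ ((x₁ τ, um), τ)) = q₂ τ (P.F₂ ((x₂ τ, up), τ)))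
    (hc₁ : ∀ t ∈ Ioo P.t₀ τ, ContinuousAt (extendRight u τ um) t → (q₁ t).comp
      ((augmentedDeriv P.f₁ P.L₁ ((x₁ t, extendRight u τ um t), t)).comp (.inr ℝ _ _)) = 0)
    (hc₂ : ∀ t ∈ Ioo τ P.t_f, ContinuousAt (extendLeft u τ up) t → (q₂ t).comp
      ((augmentedDeriv P.f₂ P.L₂ ((x₂ t, extendLeft u τ up t), t)).comp (.inr ℝ _ _)) = 0) :
    P.StationaryWith x u τ um up c (fun t => stateCostate (q₁ t)) (fun t => stateCostate (q₂ t))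
      ν := by
  obtain ⟨R, hR⟩ := exists_stateCostate_clm n
  have hF₁ := hP.isC1Field₁
  have hF₂ := hP.isC1Field₂
  obtain ⟨h0τ, hτf⟩ := hτ.mem
  have hb₁ : BddMeasurableOn (extendRight u τ um) P.t₀ τ :=
    (hxu.control.ite_lt (PiecewiseContinuousOn.const um) τ).bddMeasurableOn.mono
      (Icc_subset_Icc_right hτf.le)
  have hb₂ : BddMeasurableOn (extendLeft u τ up) τ P.t_f :=
    ((PiecewiseContinuousOn.const up).ite_le hxu.control τ).bddMeasurableOn.mono
      (Icc_subset_Icc_left h0τ.le)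
  have hτ₁ : τ ∈ Icc P.t₀ τ := ⟨h0τ.le, le_rfl⟩
  have hτ₂ : τ ∈ Icc τ P.t_f := ⟨le_rfl, hτf.le⟩
  have hk₂ : ∀ t ∈ Icc τ P.t_f, q₂ t (0, 1) = c := fun t ht => by
    rw [costate_apply_cost hF₂ hb₂ ⟨hτf.le, le_rfl⟩ ht (hq₂ t ht), hc]
  -- The jump at the interface involves only the state component, so the cost multiplier is the same
  -- in both phases.
  have hk₁ : ∀ t ∈ Icc P.t₀ τ, q₁ t (0, 1) = c := fun t ht => by
    rw [costate_apply_cost hF₁ hb₁ hτ₁ ht (hq₁ t ht), _root_.add_apply, hk₂ τ hτ₂]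
    simp
  have hu₁ : ∀ t, t < τ → extendRight u τ um t = u t := fun t ht => if_pos ht
  have hu₂ : ∀ t, τ < t → extendLeft u τ up t = u t := fun t ht => if_neg ht.not_ge
  have hH₁ : ∀ t ∈ Icc P.t₀ τ, ∀ w,
      P.H₁ c (x t) (stateCostate (q₁ t)) w t = q₁ t (P.F₁ ((x₁ t, w), t)) := fun t ht w => by
    rw [← hx₁ t ht]; exact hamiltonian_eq_apply (hk₁ t ht) (x₁ t) w t
  have hH₂ : ∀ t ∈ Icc τ P.t_f, ∀ w,
      P.H₂ c (x t) (stateCostate (q₂ t)) w t = q₂ t (P.F₂ ((x₂ t, w), t)) := fun t ht w => by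
    rw [← hx₂ t ht]; exact hamiltonian_eq_apply (hk₂ t ht) (x₂ t) w t
  refine ⟨?_, ?_, fun t ht hut => ?_, fun t ht hut => ?_, fun t ht hut => ?_, fun t ht hut => ?_,
    ?_, ?_, ?_⟩
  · simp_rw [← hR]; exact (R.continuous.comp q₁.continuous).continuousOn
  · simp_rw [← hR]; exact (R.continuous.comp q₂.continuous).continuousOn
  · have hm := Ioo_subset_Icc_self ht
    have h1 := hasDerivAt_stateCostate hF₁ hb₁ hτ₁ hq₁ ht
      ((continuousAt_extendRight_iff ht.2).2 hut)
    rw [hu₁ t ht.2, ← gradient_hamiltonian_state hF₁ (hk₁ t hm), hx₁ t hm] at h1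
    exact h1
  · have hm := Ioo_subset_Icc_self ht
    have h1 := hasDerivAt_stateCostate hF₂ hb₂ ⟨hτf.le, le_rfl⟩ hq₂ ht
      ((continuousAt_extendLeft_iff ht.1).2 hut)
    rw [hu₂ t ht.1, ← gradient_hamiltonian_state hF₂ (hk₂ t hm), hx₂ t hm] at h1
    exact h1
  · have hm := Ioo_subset_Icc_self ht
    have h1 := gradient_hamiltonian_control hF₁ (hk₁ t hm) (x₁ t) (u t) t
    have h2 := hc₁ t ht ((continuousAt_extendRight_iff ht.2).2 hut)
    rw [hu₁ t ht.2] at h2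
    rw [h2, map_zero, hx₁ t hm] at h1
    exact h1
  · have hm := Ioo_subset_Icc_self ht
    have h1 := gradient_hamiltonian_control hF₂ (hk₂ t hm) (x₂ t) (u t) t
    have h2 := hc₂ t ht ((continuousAt_extendLeft_iff ht.1).2 hut)
    rw [hu₂ t ht.1] at h2
    rw [h2, map_zero, hx₂ t hm] at h1
    exact h1
  · have h1 : q₁ τ = q₂ τ + ν • (fderiv ℝ P.g (x τ)).comp (.fst ℝ _ ℝ) := by
      rw [hq₁ τ hτ₁, intervalIntegral.integral_same, add_zero]
    have h2 : gradient P.g (x τ) = R ((fderiv ℝ P.g (x τ)).comp (.fst ℝ _ ℝ)) := by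
      rw [hR, stateCostate_fderiv_fst]; rfl
    rw [h2, ← hR, ← hR, h1, map_add, map_smul]
    abel
  · rw [hH₁ τ hτ₁, hH₂ τ hτ₂, hham]
  -- The one-sided limits of `u` give each half of the limit, and the equality of the two
  -- Hamiltonians identifies them.
  · rw [hH₁ τ hτ₁, ← nhdsLT_sup_nhdsGT, tendsto_sup]
    constructor
    · have hlim : Tendsto (fun t => q₁ t (P.F₁ ((x₁ t, u t), t))) (𝓝[<] τ)
          (𝓝 (q₁ τ (P.F₁ ((x₁ τ, um), τ)))) := by
        have hF := (hF₁.cont.tendsto ((x₁ τ, um), τ)).comp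
          (((x₁.continuous.tendsto τ).mono_left nhdsWithin_le_nhds |>.prodMk_nhds hum).prodMk_nhds
            (tendsto_id.mono_left nhdsWithin_le_nhds))
        exact (isBoundedBilinearMap_apply.continuous.tendsto _).comp
          (((q₁.continuous.tendsto τ).mono_left nhdsWithin_le_nhds).prodMk_nhds hF)
      refine hlim.congr' ?_
      filter_upwards [Ioo_mem_nhdsLT h0τ] with t ht
      rw [if_pos ht.2, ← hH₁ t (Ioo_subset_Icc_self ht), H, L, f,
        if_pos (hτ.before t ⟨ht.1.le, ht.2⟩).le, if_pos (hτ.before t ⟨ht.1.le, ht.2⟩).le]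
      rfl
    · have hlim : Tendsto (fun t => q₂ t (P.F₂ ((x₂ t, u t), t))) (𝓝[>] τ)
          (𝓝 (q₂ τ (P.F₂ ((x₂ τ, up), τ)))) := by
        have hF := (hF₂.cont.tendsto ((x₂ τ, up), τ)).comp
          (((x₂.continuous.tendsto τ).mono_left nhdsWithin_le_nhds |>.prodMk_nhds hup).prodMk_nhds
            (tendsto_id.mono_left nhdsWithin_le_nhds))
        exact (isBoundedBilinearMap_apply.continuous.tendsto _).comp
          (((q₂.continuous.tendsto τ).mono_left nhdsWithin_le_nhds).prodMk_nhds hF)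
      rw [hham]
      refine hlim.congr' ?_
      filter_upwards [Ioo_mem_nhdsGT hτf] with t ht
      rw [if_neg ht.1.not_gt, ← hH₂ t (Ioo_subset_Icc_self ht), H, L, f,
        if_neg (hτ.after t ⟨ht.1, ht.2.le⟩).not_ge, if_neg (hτ.after t ⟨ht.1, ht.2.le⟩).not_ge]
      rfl

end SwitchedProblem

/-- A proper subspace lies in the kernel of a nonzero functional, which is continuous in finite
dimension. It supplies the multiplier for a prescribed terminal state. -/
theorem exists_ne_zero_comp_eq_zero {V E : Type*} [NormedAddCommGroup V] [NormedSpace ℝ V]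
    [NormedAddCommGroup E] [NormedSpace ℝ E] [FiniteDimensional ℝ E] {T : V →L[ℝ] E}
    (hT : T.range ≠ ⊤) : ∃ ℓ : E →L[ℝ] ℝ, ℓ ≠ 0 ∧ ∀ v, ℓ (T v) = 0 := by
  obtain ⟨g, hg, hle⟩ := Submodule.exists_le_ker_of_lt_top _ hT.lt_top
  refine ⟨LinearMap.toContinuousLinearMap g, fun h => hg ?_, fun v => hle ⟨v, rfl⟩⟩
  exact LinearMap.toContinuousLinearMap.injective (h.trans (map_zero _).symm)

/-- Part one: free terminal state. Part two: prescribed terminal state. -/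
theorem theorem1 {n m : ℕ} (P : SwitchedProblem n m) (hP : P.Regular)
    (x : ℝ → EuclideanSpace ℝ (Fin n)) (u : ℝ → EuclideanSpace ℝ (Fin m))
    (τ : ℝ) (hτ : P.CrossesOnceAt x τ)
    (um up : EuclideanSpace ℝ (Fin m))
    (hum : Tendsto u (𝓝[<] τ) (𝓝 um)) (hup : Tendsto u (𝓝[>] τ) (𝓝 up))
    (htr₁ : inner ℝ (gradient P.g (x τ)) (P.f₁ (x τ) um τ) ≠ 0)
    (htr₂ : inner ℝ (gradient P.g (x τ)) (P.f₂ (x τ) up τ) ≠ 0) :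
    (P.IsOptimal Set.univ x u →
      ∃ (p₁ p₂ : ℝ → EuclideanSpace ℝ (Fin n)) (ν : ℝ),
        P.StationaryWith x u τ um up 1 p₁ p₂ ν ∧
        p₂ P.t_f = gradient P.φ (x P.t_f)) ∧
    (∀ x_f : EuclideanSpace ℝ (Fin n), P.IsOptimal {x_f} x u →
      (∃ (p₁ p₂ : ℝ → EuclideanSpace ℝ (Fin n)) (ν : ℝ),
        P.StationaryWith x u τ um up 1 p₁ p₂ ν) ∨
      (∃ (p₁ p₂ : ℝ → EuclideanSpace ℝ (Fin n)) (ν : ℝ),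
        P.StationaryWith x u τ um up 0 p₁ p₂ ν ∧ p₂ P.t_f ≠ 0)) := by
  have hg : ∀ w, inner ℝ (gradient P.g (x τ)) w = fderiv ℝ P.g (x τ) w := fun w => by
    rw [gradient, toDual_symm_apply]
  rw [hg] at htr₁ htr₂
  obtain ⟨h0τ, hτf⟩ := hτ.mem
  -- the costates that belong to a covector annihilating the first variations
  have hcostates : ∀ (hxu : P.Admissible x u) {x₁ x₂ : ℝ →ᵇ EuclideanSpace ℝ (Fin n) × ℝ}
      (_ : ∀ t ∈ Icc P.t₀ τ, (x₁ t).1 = x t) (_ : ∀ t ∈ Icc τ P.t_f, (x₂ t).1 = x t)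
      {ℓ : EuclideanSpace ℝ (Fin n) × ℝ →L[ℝ] ℝ} (_ : ∀ v : ℝ →ᵇ EuclideanSpace ℝ (Fin m),
        ∃ (y₁ y₂ : ℝ →ᵇ EuclideanSpace ℝ (Fin n) × ℝ) (d : ℝ) (c : EuclideanSpace ℝ (Fin n) × ℝ),
        (∀ t ∈ Icc P.t₀ τ, y₁ t = 0 + ∫ s in P.t₀..t,
          augmentedDeriv P.f₁ P.L₁ ((x₁ s, extendRight u τ um s), s) (y₁ s, v s)) ∧
        (∀ t ∈ Icc τ P.t_f, y₂ t = c + ∫ s in τ..t,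
          augmentedDeriv P.f₂ P.L₂ ((x₂ s, extendLeft u τ up s), s) (y₂ s, v s)) ∧
        y₁ τ + d • P.F₁ ((x₁ τ, um), τ) = y₂ τ + d • P.F₂ ((x₂ τ, up), τ) ∧
        (fderiv ℝ P.g (x τ)).comp (.fst ℝ _ ℝ) (y₁ τ + d • P.F₁ ((x₁ τ, um), τ)) = 0 ∧
        ℓ (y₂ P.t_f) = 0),
      ∃ (p₁ p₂ : ℝ → EuclideanSpace ℝ (Fin n)) (ν : ℝ),
        P.StationaryWith x u τ um up (ℓ (0, 1)) p₁ p₂ ν ∧ p₂ P.t_f = stateCostate ℓ := by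
    intro hxu x₁ x₂ hx₁ hx₂ ℓ hvar
    have hu := hxu.control
    obtain ⟨S, hS, hSc⟩ := hu.exists_finite_continuousAt
    have hw : (fderiv ℝ P.g (x τ)).comp (.fst ℝ _ ℝ) (P.F₁ ((x₁ τ, um), τ)) ≠ 0 := by
      have h1 : (fderiv ℝ P.g (x τ)) (P.f₁ (x₁ τ).1 um τ) ≠ 0 := by
        rwa [hx₁ τ ⟨h0τ.le, le_rfl⟩]
      exact h1
    obtain ⟨q₁, q₂, ν, hq₁, hq₂, hham, hc₁, hc₂⟩ := exists_costates hP.isC1Field₁ hP.isC1Field₂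
      h0τ hτf
      ((hu.ite_lt (PiecewiseContinuousOn.const um) τ).bddMeasurableOn.mono
        (Icc_subset_Icc_right hτf.le))
      (((PiecewiseContinuousOn.const up).ite_le hu τ).bddMeasurableOn.mono
        (Icc_subset_Icc_left h0τ.le)) hS.countable
      (fun t ht => (continuousAt_extendRight_iff ht.1.2).2
        (hSc t ⟨⟨ht.1.1, ht.1.2.trans hτf⟩, ht.2⟩))
      (fun t ht => (continuousAt_extendLeft_iff ht.1.1).2
        (hSc t ⟨⟨h0τ.trans ht.1.1, ht.1.2⟩, ht.2⟩)) x₁ x₂ hw hvar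
    refine ⟨_, _, ν, SwitchedProblem.stationaryWith_of_costates hP hxu hτ hum hup hx₁ hx₂ rfl hq₁ hq₂ hham hc₁ hc₂,
      ?_⟩
    rw [hq₂ _ ⟨hτf.le, le_rfl⟩, intervalIntegral.integral_same, add_zero]
  constructor
  · rintro ⟨hxu, -, hmin⟩
    obtain ⟨x₁, x₂, Φ, Φ', hx₁, hx₂, hΦ, hΦ0, hJ0, hev, hvar⟩ :=
      hxu.exists_endpoint_map hP hτ hum hup htr₁ htr₂
    -- The differential of `(y, z) ↦ φ y + z` at the optimal end point. Its cost component is `1`,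
    -- which yields `c = 1`, and its state component yields the transversality condition.
    let ℓ : EuclideanSpace ℝ (Fin n) × ℝ →L[ℝ] ℝ :=
      (fderiv ℝ P.φ (x P.t_f)).comp (.fst ℝ _ ℝ) + .snd ℝ _ ℝ
    have hd : HasFDerivAt (fun z : EuclideanSpace ℝ (Fin n) × ℝ => P.φ z.1 + z.2) ℓ (Φ 0) := by
      have hφ := (hP.φ (Φ 0).1).hasFDerivAt
      have h1 := (hφ.comp (Φ 0) hasFDerivAt_fst).add (hasFDerivAt_snd (p := Φ 0))
      rw [hΦ0] at h1
      exact h1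
    have hmin' : IsLocalMin ((fun z : EuclideanSpace ℝ (Fin n) × ℝ => P.φ z.1 + z.2) ∘ Φ) 0 := by
      filter_upwards [hev] with v ⟨y, w, hyw, _, hJ⟩
      have h1 := hmin y w hyw (mem_univ _)
      rw [hJ0, hJ, ← hΦ0] at h1
      exact h1
    have hzero := hmin'.hasFDerivAt_eq_zero (hd.comp 0 hΦ.hasFDerivAt)
    obtain ⟨p₁, p₂, ν, hst, hend⟩ := hcostates hxu hx₁ hx₂ (ℓ := ℓ) (fun v => by
      obtain ⟨y₁, y₂, d, c, h1, h2, h3, h4, h5⟩ := hvar v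
      refine ⟨y₁, y₂, d, c, h1, h2, h3, h4, ?_⟩
      rw [← h5]
      exact congrArg (fun T : (ℝ →ᵇ EuclideanSpace ℝ (Fin m)) →L[ℝ] ℝ => T v) hzero)
    have hc : ℓ (0, 1) = 1 := by simp [ℓ]
    rw [hc] at hst
    refine ⟨p₁, p₂, ν, hst, hend.trans ?_⟩
    rw [gradient, stateCostate]
    congr 1
    ext w
    simp [ℓ]
  · rintro x_f ⟨hxu, hxf, hmin⟩
    obtain ⟨x₁, x₂, Φ, Φ', hx₁, hx₂, hΦ, hΦ0, hJ0, hev, hvar⟩ :=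
      hxu.exists_endpoint_map hP hτ hum hup htr₁ htr₂
    -- If `Φ'` were onto, `Φ` would map neighbourhoods of `0` onto neighbourhoods of `Φ 0`. The
    -- point with the same terminal state and cost lowered by a small `r > 0` would then be
    -- attained, against optimality.
    have hrange : Φ'.range ≠ ⊤ := by
      intro htop
      have : CompleteSpace (EuclideanSpace ℝ (Fin n) × ℝ) := FiniteDimensional.complete ℝ _
      have hmap := hΦ.map_nhds_eq_of_surj htop
      have hmem : Φ '' {v | ∃ y w, P.Admissible y w ∧ y P.t_f = (Φ v).1 ∧
          P.J y w = P.φ (Φ v).1 + (Φ v).2} ∈ 𝓝 (Φ 0) := by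
        rw [← hmap]; exact image_mem_map hev
      have hcont : ContinuousAt (fun r : ℝ => ((Φ 0).1, (Φ 0).2 - r)) 0 := by fun_prop
      have hnear : ∀ᶠ r in 𝓝 (0 : ℝ), ((Φ 0).1, (Φ 0).2 - r) ∈ Φ '' {v | ∃ y w,
          P.Admissible y w ∧ y P.t_f = (Φ v).1 ∧ P.J y w = P.φ (Φ v).1 + (Φ v).2} :=
        hcont.preimage_mem_nhds (by rw [sub_zero]; exact hmem)
      obtain ⟨r, ⟨v, ⟨y, w, hyw, hy, hJ⟩, hv⟩, hr⟩ :=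
        ((hnear.filter_mono nhdsWithin_le_nhds).and (self_mem_nhdsWithin (s := Ioi (0 : ℝ)))).exists
      have hr0 : 0 < r := hr
      rw [hv] at hy hJ
      have h1 := hmin y w hyw (by rw [hy, hΦ0]; exact hxf)
      rw [hJ0, hJ] at h1
      simp only [hΦ0] at h1
      linarith
    obtain ⟨ℓ, hℓ, hℓΦ⟩ := exists_ne_zero_comp_eq_zero hrange
    have hvar' : ∀ a : ℝ, ∀ v, (a • ℓ) (Φ' v) = 0 := fun a v => by
      rw [_root_.smul_apply, hℓΦ, smul_zero]
    have key := fun a : ℝ => hcostates hxu hx₁ hx₂ (ℓ := a • ℓ) (fun v => by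
      obtain ⟨y₁, y₂, d, c, h1, h2, h3, h4, h5⟩ := hvar v
      exact ⟨y₁, y₂, d, c, h1, h2, h3, h4, by rw [← h5, hvar' a v]⟩)
    -- The cost component of `ℓ` is the multiplier `c`. If it vanishes, `ℓ ≠ 0` forces the terminal
    -- costate to be nonzero. Otherwise `ℓ` is rescaled to `c = 1`; its sign does not matter, since
    -- only equations are claimed.
    by_cases hc : ℓ (0, 1) = 0
    · right
      obtain ⟨p₁, p₂, ν, hst, hend⟩ := key 1
      rw [one_smul] at hst hend
      rw [hc] at hst
      refine ⟨p₁, p₂, ν, hst, fun h0 => hℓ ?_⟩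
      rw [hend, stateCostate, map_eq_zero_iff _ (LinearIsometryEquiv.injective _)] at h0
      exact ContinuousLinearMap.prod_ext h0 (ContinuousLinearMap.ext_ring (by simpa using hc))
    · left
      obtain ⟨p₁, p₂, ν, hst, -⟩ := key (ℓ (0, 1))⁻¹
      rw [_root_.smul_apply, smul_eq_mul, inv_mul_cancel₀ hc] at hst
      exact ⟨p₁, p₂, ν, hst⟩

end
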